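/- Let $\Delta$ be a complete rational polyhedral fan in $\mathbb{R}^n$ (a finite set of pointed cones generated by points of $\mathbb{Z}^n$, closed under taking faces, any two meeting in a common face, with union $\mathbb{R}^n$). Suppose that $\Delta$ is Gorenstein: there is a function $K_\Delta:\mathbb{R}^n\to\mathbb{R}$ that on each cone $\sigma\in\Delta$ is linear, takes integer values on $\sigma\cap\mathbb{Z}^n$, and equals $1$ at the primitive lattice points of the edges of $\sigma$. Sheaves on a fan are taken for the topology whose open sets are the subfans; a sheaf $\mathcal F$ is given by its stalks $\mathcal F_\sigma$ and by restriction maps $\mathcal F_\sigma\to\mathcal F_\tau$ for faces $\tau\le\sigma$. Let $\mathcal A$ be the sheaf of graded rings for which $\mathcal A_\sigma$ is the ring of polynomial functions on $\sigma$. A sheaf $\mathcal F$ of $\mathcal A$-modules is locally free if each $\mathcal F_\sigma$ is a finitely generated free $\mathcal A_\sigma$-module, and flabby if for all open sets $U\subseteq V$ every section over $U$ extends to $V$. A crepant simplicial subdivision of $\Delta$ is a rational simplicial fan $\hat\Delta$ subdividing $\Delta$ that is Gorenstein with $K_{\hat\Delta}=K_\Delta$; write $\phi:\hat\Delta\to\Delta$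 for the induced map. For $\sigma\in\hat\Delta$ with primitive lattice points $v_1,\dots,v_d$ on its edges let $$\mathrm{Box}(\sigma)=\{v\in\mathbb{Z}^n : v=\alpha_1v_1+\cdots+\alpha_dv_d,\ 0\le\alpha_i<1\}.$$ Let $\mathcal E_{\hat\Delta}$ be the sheaf of graded $\mathcal A_{\hat\Delta}$-modules whose stalk at $\sigma$ is the free graded $\mathcal A_\sigma$-module with basis $\mathrm{Box}(\sigma)$, where $v$ has degree $K_\Delta(v)$; for a face $\tau\le\sigma$ the restriction map restricts polynomial functions to $\tau$ and sends the basis element $v$ to $v$ if $v\in\mathrm{Box}(\tau)$ and to $0$ otherwise. Then $\Delta$ has a crepant simplicial subdivision. Moreover, for every crepant simplicial subdivision $\phi:\hat\Delta\to\Delta$, the push-forward $\mathcal E_\Delta=\phi_*\mathcal E_{\hat\Delta}$ (with stalks $(\mathcal E_\Delta)_\sigma=\Gamma(\mathcal E_{\hat\Delta},\{\tau\in\hat\Delta:\tau\subseteq\sigma\})$, a sheaf of graded $\mathcal A_\Delta$-modules) is locally free and flabby, and for every integer $k\ge 0$ the set $K_\Delta^{-1}(k)\cap\mathbb{Z}^n$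 is finite and the space $\Gamma(\mathcal E_\Delta,\Delta)_k$ of global sections of degree $k$ has finite dimension $$\dim_{\mathbb{R}}\Gamma(\mathcal E_\Delta,\Delta)_k=\#\bigl(K_\Delta^{-1}(k)\cap\mathbb{Z}^n\bigr).$$ -/

import Mathlib

namespace EhrhartFan

noncomputable section

/-! ### Lattice points and cones in `ℝⁿ` -/

/-- The point `v` of `ℝⁿ` lies in the lattice `ℤⁿ`. -/
def IsLatticePoint {n : ℕ} (v : Fin n → ℝ) : Prop :=
  ∀ i, ∃ z : ℤ, v i = (z : ℝ)

/-- A primitive lattice point: it is not `m` times a lattice point, for any natural number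
`m ≠ 1` (in particular, it is not `0`). -/
def IsPrimitive {n : ℕ} (v : Fin n → ℝ) : Prop :=
  IsLatticePoint v ∧ ∀ w : Fin n → ℝ, IsLatticePoint w → ∀ m : ℕ, v = m • w → m = 1

/-- The primitive lattice points on the edges (the one-dimensional faces) of the cone `σ`. -/
def primGens {n : ℕ} (σ : PointedCone ℝ (Fin n → ℝ)) : Set (Fin n → ℝ) :=
  {v | IsPrimitive v ∧ (PointedCone.hull ℝ {v}).IsFaceOf σ}

/-- A rational polyhedral cone: it is generated by finitely many lattice points. -/
def IsRationalCone {n : ℕ} (σ : PointedCone ℝ (Fin n → ℝ)) : Prop :=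
  ∃ s : Set (Fin n → ℝ), s.Finite ∧ (∀ v ∈ s, IsLatticePoint v) ∧ PointedCone.hull ℝ s = σ

/-- `Box(σ)`: the lattice points `∑ αᵢ vᵢ` with `0 ≤ αᵢ < 1`, where the `vᵢ` are the primitive
lattice points on the edges of `σ`. -/
def Box {n : ℕ} (σ : PointedCone ℝ (Fin n → ℝ)) : Set (Fin n → ℝ) :=
  {v | IsLatticePoint v ∧ ∃ c : (Fin n → ℝ) →₀ ℝ, (c.support : Set (Fin n → ℝ)) ⊆ primGens σ ∧
    (∀ u, 0 ≤ c u ∧ c u < 1) ∧ c.sum (fun u r => r • u) = v}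

theorem primGens_mono {n : ℕ} {σ τ : PointedCone ℝ (Fin n → ℝ)} (h : τ.IsFaceOf σ) :
    primGens τ ⊆ primGens σ :=
  fun _ hv => ⟨hv.1, hv.2.trans h⟩

theorem box_mono {n : ℕ} {σ τ : PointedCone ℝ (Fin n → ℝ)} (h : τ.IsFaceOf σ) :
    Box τ ⊆ Box σ := by
  rintro v ⟨hv, c, hc, hc', hs⟩
  exact ⟨hv, c, hc.trans (primGens_mono h), hc', hs⟩

/-! ### Fans -/

/-- A rational polyhedral fan in `ℝⁿ`: a finite set of rational polyhedral cones containing no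
line, closed under taking faces, any two of which meet in a common face. -/
structure RationalFan (n : ℕ) where
  cones : Set (PointedCone ℝ (Fin n → ℝ))
  finite : cones.Finite
  rational : ∀ σ ∈ cones, IsRationalCone σ
  salient : ∀ σ ∈ cones, (σ : ConvexCone ℝ (Fin n → ℝ)).Salient
  face_mem : ∀ σ ∈ cones, ∀ τ : PointedCone ℝ (Fin n → ℝ), τ.IsFaceOf σ → τ ∈ cones
  inf_isFaceOf : ∀ σ ∈ cones, ∀ τ ∈ cones, (σ ⊓ τ).IsFaceOf σ

namespace RationalFan

/-- The cones of a fan, ordered by inclusion. -/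
abbrev Cone {n : ℕ} (Δ : RationalFan n) : Type := {σ : PointedCone ℝ (Fin n → ℝ) // σ ∈ Δ.cones}

/-- The inclusion order on the cones of a fan is the face order. Thus subfans are lower sets. -/
theorem isFaceOf_iff_le {n : ℕ} (Δ : RationalFan n) (τ σ : Δ.Cone) :
    τ.1.IsFaceOf σ.1 ↔ τ ≤ σ := by
  refine ⟨fun h => h.le, fun h => ?_⟩
  have h1 := Δ.inf_isFaceOf σ.1 σ.2 τ.1 τ.2
  rwa [inf_eq_right.2 (show τ.1 ≤ σ.1 from h)] at h1

instance {n : ℕ} (Δ : RationalFan n) : Finite Δ.Cone := Δ.finite.to_subtype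

/-- The support of a fan: the union of its cones. -/
def support {n : ℕ} (Δ : RationalFan n) : Set (Fin n → ℝ) :=
  {v | ∃ σ ∈ Δ.cones, v ∈ σ}

/-- A fan is complete if its cones cover `ℝⁿ`. -/
def IsComplete {n : ℕ} (Δ : RationalFan n) : Prop :=
  Δ.support = Set.univ

/-- A fan is simplicial if each of its cones is generated by linearly independent vectors. -/
def IsSimplicial {n : ℕ} (Δ : RationalFan n) : Prop :=
  ∀ σ ∈ Δ.cones, σ.IsSimplicial

/-- `K` is the function `K_Δ` of the fan `Δ`: on each cone `σ` of `Δ` it is linear, integral at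
the lattice points of `σ`, and equal to `1` at the primitive lattice points on the edges of `σ`.
The fan `Δ` is Gorenstein if and only if such a `K` exists. These conditions determine `K` on the
support of `Δ`. -/
def IsGorensteinFunction {n : ℕ} (Δ : RationalFan n) (K : (Fin n → ℝ) → ℝ) : Prop :=
  ∀ σ ∈ Δ.cones,
    (∃ L : (Fin n → ℝ) →ₗ[ℝ] ℝ, ∀ v ∈ σ, K v = L v) ∧
    (∀ v ∈ σ, IsLatticePoint v → ∃ z : ℤ, K v = (z : ℝ)) ∧
    (∀ v ∈ primGens σ, K v = 1)

/-- `Δ'` is a subdivision of `Δ`: the two fans have the same support, and each cone of `Δ'` is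
contained in a cone of `Δ`. -/
def IsSubdivision {n : ℕ} (Δ' Δ : RationalFan n) : Prop :=
  Δ'.support = Δ.support ∧ ∀ σ' ∈ Δ'.cones, ∃ σ ∈ Δ.cones, σ' ≤ σ

/-- `Δ'` is a crepant simplicial subdivision of the Gorenstein fan `Δ` with `K_Δ = K`: it is a
simplicial subdivision which is again Gorenstein, with the same function `K_{Δ'} = K`. -/
structure IsCrepantSimplicialSubdivision {n : ℕ} (Δ' Δ : RationalFan n)
    (K : (Fin n → ℝ) → ℝ) : Prop where
  subdivision : Δ'.IsSubdivision Δ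
  simplicial : Δ'.IsSimplicial
  crepant : Δ'.IsGorensteinFunction K

theorem IsGorensteinFunction.exists_nat_of_mem_box {n : ℕ} {Δ : RationalFan n}
    {K : (Fin n → ℝ) → ℝ} (hK : Δ.IsGorensteinFunction K) (σ : Δ.Cone) {v : Fin n → ℝ}
    (hv : v ∈ Box σ.1) : ∃ m : ℕ, K v = (m : ℝ) := by
  obtain ⟨⟨L, hL⟩, hint, hone⟩ := hK σ.1 σ.2
  obtain ⟨hlat, c, hc, hc', rfl⟩ := hv
  have hmem : ∀ u ∈ c.support, u ∈ σ.1 := fun u hu =>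
    (hc hu).2.le (Submodule.subset_span rfl)
  have hσ : c.sum (fun u r => r • u) ∈ σ.1 :=
    Submodule.sum_mem _ fun u hu => PointedCone.smul_mem σ.1 (hc' u).1 (hmem u hu)
  obtain ⟨z, hz⟩ := hint _ hσ hlat
  have hnn : 0 ≤ K (c.sum (fun u r => r • u)) := by
    rw [hL _ hσ, Finsupp.sum, map_sum]
    refine Finset.sum_nonneg fun u hu => ?_
    rw [map_smul, ← hL u (hmem u hu), hone u (hc hu)]
    simpa using (hc' u).1
  rw [hz] at hnn
  obtain ⟨m, rfl⟩ := Int.eq_ofNat_of_zero_le (by exact_mod_cast hnn : 0 ≤ z)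
  exact ⟨m, by simpa using hz⟩

end RationalFan

/-! ### Polynomial functions on a cone -/

/-- The function on the cone `σ` given by a polynomial in the `n` coordinates. -/
def polyEval {n : ℕ} (σ : PointedCone ℝ (Fin n → ℝ)) : MvPolynomial (Fin n) ℝ →ₐ[ℝ] (σ → ℝ) :=
  MvPolynomial.aeval fun (i : Fin n) (x : σ) => x.1 i

/-- The ring `𝒜_σ` of polynomial functions on the cone `σ`: the functions `σ → ℝ` that are given
by a polynomial in the `n` coordinates. -/
def polyFun {n : ℕ} (σ : PointedCone ℝ (Fin n → ℝ)) : Subalgebra ℝ (σ → ℝ) :=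
  (polyEval σ).range

theorem polyEval_apply {n : ℕ} (σ : PointedCone ℝ (Fin n → ℝ))
    (P : MvPolynomial (Fin n) ℝ) (x : σ) :
    polyEval σ P x = MvPolynomial.eval x.1 P := by
  unfold polyEval
  induction P using MvPolynomial.induction_on with
  | C a => simp
  | add p q hp hq => simp [hp, hq]
  | mul_X p i hp => simp [hp]

/-- The restriction `𝒜_σ → 𝒜_τ` of polynomial functions to a smaller cone. -/
def polyRes {n : ℕ} {σ τ : PointedCone ℝ (Fin n → ℝ)} (h : τ ≤ σ) :
    polyFun σ →ₐ[ℝ] polyFun τ where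
  toFun f := ⟨fun x => f.1 ⟨x.1, h x.2⟩, by
    obtain ⟨P, hP⟩ := f.2
    refine ⟨P, funext fun x => ?_⟩
    rw [← hP]
    exact (polyEval_apply τ P x).trans (polyEval_apply σ P ⟨x.1, h x.2⟩).symm⟩
  map_one' := rfl
  map_mul' _ _ := rfl
  map_zero' := rfl
  map_add' _ _ := rfl
  commutes' _ := rfl

/-- The polynomial functions on `σ` that are homogeneous of degree `k`. -/
def polyDeg {n : ℕ} (σ : PointedCone ℝ (Fin n → ℝ)) (k : ℕ) : Submodule ℝ (polyFun σ) :=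
  ((MvPolynomial.homogeneousSubmodule (Fin n) ℝ k).map (polyEval σ).toLinearMap).comap
    (polyFun σ).val.toLinearMap

theorem mem_polyDeg {n : ℕ} {σ : PointedCone ℝ (Fin n → ℝ)} {k : ℕ} {f : polyFun σ} :
    f ∈ polyDeg σ k ↔ ∃ P : MvPolynomial (Fin n) ℝ, P.IsHomogeneous k ∧ polyEval σ P = f.1 :=
  Iff.rfl

theorem polyRes_mem_polyDeg {n : ℕ} {σ τ : PointedCone ℝ (Fin n → ℝ)} (h : τ ≤ σ) {k : ℕ}
    {f : polyFun σ} (hf : f ∈ polyDeg σ k) : polyRes h f ∈ polyDeg τ k := by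
  obtain ⟨P, hP, hPf⟩ := hf
  refine ⟨P, hP, funext fun x => ?_⟩
  refine Eq.trans ?_ (congrFun hPf ⟨x.1, h x.2⟩)
  exact (polyEval_apply τ P x).trans (polyEval_apply σ P ⟨x.1, h x.2⟩).symm

theorem mul_mem_polyDeg {n : ℕ} {σ : PointedCone ℝ (Fin n → ℝ)} {i j : ℕ} {f g : polyFun σ}
    (hf : f ∈ polyDeg σ i) (hg : g ∈ polyDeg σ j) : f * g ∈ polyDeg σ (i + j) := by
  obtain ⟨P, hP, hPf⟩ := mem_polyDeg.1 hf
  obtain ⟨Q, hQ, hQg⟩ := mem_polyDeg.1 hg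
  refine mem_polyDeg.2 ⟨P * Q, hP.mul hQ, ?_⟩
  rw [map_mul, hPf, hQg]
  rfl

/-- A criterion for a vector space to be the direct sum of a family of subspaces. -/
theorem isInternal_of {M : Type*} [AddCommGroup M] [Module ℝ M] (A : ℕ → Submodule ℝ M)
    (h1 : ∀ (s : Finset ℕ) (f : ℕ → M), (∀ i, f i ∈ A i) → ∑ i ∈ s, f i = 0 → ∀ i ∈ s, f i = 0)
    (h2 : ⨆ i, A i = ⊤) : DirectSum.IsInternal A := by
  classical
  refine ⟨?_, ?_⟩
  · refine (injective_iff_map_eq_zero _).2 fun x hx => ?_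
    rw [DirectSum.coeAddMonoidHom_eq_dfinsuppSum, DFinsupp.sum] at hx
    have := h1 x.support (fun i => (x i : M)) (fun i => (x i).2) hx
    refine DFinsupp.ext fun i => ?_
    by_cases hi : i ∈ x.support
    · exact Subtype.ext (this i hi)
    · simpa using hi
  · have : Function.Surjective (DirectSum.coeLinearMap A) := by
      rw [← LinearMap.range_eq_top, DirectSum.range_coeLinearMap, h2]
    exact this

/-- The projections to the components of a direct sum decomposition. -/
theorem exists_proj {M : Type*} [AddCommGroup M] [Module ℝ M] {A : ℕ → Submodule ℝ M}
    (h : DirectSum.IsInternal A) : ∃ p : ℕ → M →ₗ[ℝ] M, (∀ i x, p i x ∈ A i) ∧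
      (∀ i, ∀ x ∈ A i, p i x = x) ∧ (∀ i j, i ≠ j → ∀ x ∈ A i, p j x = 0) ∧
      ∀ x, ∃ N, ∀ m, N ≤ m → ∑ i ∈ Finset.range m, p i x = x := by
  classical
  let e : (DirectSum ℕ fun i => A i) ≃ₗ[ℝ] M :=
    LinearEquiv.ofBijective (DirectSum.coeLinearMap A) h
  have he : ∀ y, e y = DirectSum.coeLinearMap A y := fun y => rfl
  have hs : ∀ i (x : A i), e.symm (x : M) = DirectSum.lof ℝ ℕ (fun i => A i) i x := by
    intro i x
    rw [LinearEquiv.symm_apply_eq, he, DirectSum.coeLinearMap_lof]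
  refine ⟨fun i => (A i).subtype ∘ₗ DirectSum.component ℝ ℕ (fun i => A i) i ∘ₗ
    e.symm.toLinearMap, fun i x => ?_, fun i x hx => ?_, fun i j hij x hx => ?_, fun x => ?_⟩
  · exact Subtype.property _
  · have := hs i ⟨x, hx⟩
    simp only [LinearMap.comp_apply, LinearEquiv.coe_coe]
    rw [show e.symm x = _ from this, DirectSum.component.lof_self]
    rfl
  · have := hs i ⟨x, hx⟩
    simp only [LinearMap.comp_apply, LinearEquiv.coe_coe]
    rw [show e.symm x = _ from this, DirectSum.component.of, dif_neg hij]
    rfl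
  · set y := e.symm x with hy
    refine ⟨y.support.sup id + 1, fun m hm => ?_⟩
    have hx : e y = x := by simp [hy]
    have hx2 : ∑ i ∈ y.support, (y i : M) = x := by
      rw [← hx, he, DirectSum.coeLinearMap_eq_dfinsuppSum, DFinsupp.sum]
    have hsub : y.support ⊆ Finset.range m := fun i hi => by
      have : i ≤ y.support.sup id := Finset.le_sup (f := id) hi
      simp only [Finset.mem_range]
      omega
    calc ∑ i ∈ Finset.range m, _ = ∑ i ∈ Finset.range m, (y i : M) := rfl
      _ = ∑ i ∈ y.support, (y i : M) := by
          refine (Finset.sum_subset hsub fun i _ hi => ?_).symm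
          have : y i = 0 := by simpa using hi
          simp [this]
      _ = x := hx2

theorem polyFun_smul_apply {n : ℕ} {σ : PointedCone ℝ (Fin n → ℝ)} {k : ℕ} {f : polyFun σ}
    (hf : f ∈ polyDeg σ k) (t : ℝ) (ht : 0 ≤ t) (x : σ) :
    f.1 ⟨t • x.1, PointedCone.smul_mem σ ht x.2⟩ = t ^ k * f.1 x := by
  obtain ⟨P, hP, hPf⟩ := mem_polyDeg.1 hf
  rw [← hPf]
  have h1 := polyEval_apply σ P ⟨t • x.1, PointedCone.smul_mem σ ht x.2⟩
  have h2 := polyEval_apply σ P x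
  refine h1.trans ?_
  refine Eq.trans ?_ (congrArg (t ^ k * ·) h2.symm)
  have hP' : P.IsHomogeneous k := hP
  have h3 : MvPolynomial.eval (t • x.1) P = t ^ k * MvPolynomial.eval x.1 P := by
    rw [MvPolynomial.eval_eq, MvPolynomial.eval_eq, Finset.mul_sum]
    refine Finset.sum_congr rfl fun d hd => ?_
    have hdeg := hP'.degree_eq_sum_deg_support hd
    simp only [Pi.smul_apply, smul_eq_mul, mul_pow, Finset.prod_mul_distrib]
    rw [Finset.prod_pow_eq_pow_sum, hdeg]
    ring
  exact h3

/-- The ring of polynomial functions on a cone is the direct sum of its homogeneous parts. -/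
theorem polyDeg_isInternal {n : ℕ} (σ : PointedCone ℝ (Fin n → ℝ)) :
    DirectSum.IsInternal (polyDeg σ) := by
  refine isInternal_of _ ?_ ?_
  · intro s f hf hsum i hi
    refine Subtype.ext (funext fun x => ?_)
    let Q : Polynomial ℝ := ∑ j ∈ s, Polynomial.monomial j ((f j).1 x)
    have hQ : Q = 0 := by
      refine Polynomial.eq_zero_of_infinite_isRoot Q ((Set.Ici_infinite (0 : ℝ)).mono ?_)
      intro t ht
      have ht' : (0 : ℝ) ≤ t := ht
      have h0 := congrFun (congrArg Subtype.val hsum)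
        ⟨t • x.1, PointedCone.smul_mem σ ht' x.2⟩
      simp only [AddSubmonoidClass.coe_finsetSum, Finset.sum_apply] at h0
      show Polynomial.eval t Q = 0
      simp only [Q, Polynomial.eval_finsetSum, Polynomial.eval_monomial]
      refine Eq.trans (Finset.sum_congr rfl fun j _ => ?_) h0
      rw [polyFun_smul_apply (hf j) t ht' x, mul_comm]
    have := congrArg (Polynomial.coeff · i) hQ
    simpa [Q, Polynomial.finsetSum_coeff, Polynomial.coeff_monomial, hi] using this
  · rw [eq_top_iff]
    intro f _
    obtain ⟨P, hP⟩ := f.2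
    have hP' : polyEval σ P = f.1 := hP
    have : f = ∑ i ∈ Finset.range (P.totalDegree + 1),
        (⟨polyEval σ (MvPolynomial.homogeneousComponent i P), _, rfl⟩ : polyFun σ) := by
      refine Subtype.ext ?_
      rw [AddSubmonoidClass.coe_finsetSum]
      dsimp only
      rw [← map_sum, MvPolynomial.sum_homogeneousComponent, hP']
    rw [this]
    exact Submodule.sum_mem _ fun i _ => Submodule.mem_iSup_of_mem i
      (mem_polyDeg.2 ⟨_, MvPolynomial.homogeneousComponent_isHomogeneous i P, rfl⟩)

/-! ### Sheaves of graded `𝒜`-modules on a fan -/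

/-- A sheaf of graded `𝒜`-modules on a fan, for the topology whose open sets are the subfans:
graded `𝒜_σ`-modules (the stalks) and functorial restriction maps from cones to their faces,
linear over the restriction of polynomial functions and preserving degrees. -/
structure GradedSheaf {n : ℕ} (Δ : RationalFan n) where
  stalk : Δ.Cone → Type
  [addCommGroup : ∀ σ, AddCommGroup (stalk σ)]
  [moduleReal : ∀ σ, Module ℝ (stalk σ)]
  [modulePoly : ∀ σ : Δ.Cone, Module (polyFun σ.1) (stalk σ)]
  [isScalarTower : ∀ σ : Δ.Cone, IsScalarTower ℝ (polyFun σ.1) (stalk σ)]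
  res : ∀ {σ τ : Δ.Cone}, τ ≤ σ → stalk σ →ₗ[ℝ] stalk τ
  res_self : ∀ (σ : Δ.Cone) (s : stalk σ), res (le_refl σ) s = s
  res_res : ∀ {σ τ ρ : Δ.Cone} (h : τ ≤ σ) (h' : ρ ≤ τ) (s : stalk σ),
    res h' (res h s) = res (h'.trans h) s
  res_smul : ∀ {σ τ : Δ.Cone} (h : τ ≤ σ) (f : polyFun σ.1) (s : stalk σ),
    res h (f • s) = polyRes h f • res h s
  deg : ∀ σ : Δ.Cone, ℕ → Submodule ℝ (stalk σ)
  isInternal : ∀ σ, DirectSum.IsInternal (deg σ)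
  smul_mem_deg : ∀ (σ : Δ.Cone) {i j : ℕ} {f : polyFun σ.1} {s : stalk σ},
    f ∈ polyDeg σ.1 i → s ∈ deg σ j → f • s ∈ deg σ (i + j)
  res_mem_deg : ∀ {σ τ : Δ.Cone} (h : τ ≤ σ) {k : ℕ} {s : stalk σ},
    s ∈ deg σ k → res h s ∈ deg τ k

namespace GradedSheaf

attribute [instance] GradedSheaf.addCommGroup GradedSheaf.moduleReal GradedSheaf.modulePoly
  GradedSheaf.isScalarTower

variable {n : ℕ} {Δ : RationalFan n}

/-- The sections of a sheaf over an open set (a subfan, that is, a set of cones closed under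
taking faces): the families of elements of the stalks that are compatible with restriction. -/
def sections (F : GradedSheaf Δ) (U : LowerSet Δ.Cone) :
    Submodule ℝ (∀ σ : {σ // σ ∈ U}, F.stalk σ.1) where
  carrier := {s | ∀ (σ τ : {σ // σ ∈ U}) (h : τ.1 ≤ σ.1), F.res h (s σ) = s τ}
  add_mem' hs ht σ τ h := by simp [hs σ τ h, ht σ τ h]
  zero_mem' σ τ h := by simp
  smul_mem' c s hs σ τ h := by simp [hs σ τ h]

/-- The sections of degree `k` over an open set. -/
def sectionsDeg (F : GradedSheaf Δ) (U : LowerSet Δ.Cone) (k : ℕ) :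
    Submodule ℝ (F.sections U) where
  carrier := {s | ∀ σ, s.1 σ ∈ F.deg σ.1 k}
  add_mem' hs ht σ := (F.deg σ.1 k).add_mem (hs σ) (ht σ)
  zero_mem' σ := (F.deg σ.1 k).zero_mem
  smul_mem' c _ hs σ := (F.deg σ.1 k).smul_mem c (hs σ)

/-- `F` is flabby if for open sets `U ⊆ V` all sections over `U` extend to `V`. -/
def IsFlabby (F : GradedSheaf Δ) : Prop :=
  ∀ (U V : LowerSet Δ.Cone) (h : U ≤ V), ∀ s ∈ F.sections U, ∃ t ∈ F.sections V,
    ∀ (σ : Δ.Cone) (hσ : σ ∈ U), t ⟨σ, h hσ⟩ = s ⟨σ, hσ⟩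

/-- `F` is locally free if each stalk `F_σ` is a finitely generated free `𝒜_σ`-module. -/
def IsLocallyFree (F : GradedSheaf Δ) : Prop :=
  ∀ σ : Δ.Cone, Module.Finite (polyFun σ.1) (F.stalk σ) ∧ Module.Free (polyFun σ.1) (F.stalk σ)

theorem sectionsDeg_isInternal (F : GradedSheaf Δ) (U : LowerSet Δ.Cone) :
    DirectSum.IsInternal (F.sectionsDeg U) := by
  have hind : ∀ (σ : Δ.Cone) (s : Finset ℕ) (f : ℕ → F.stalk σ), (∀ i, f i ∈ F.deg σ i) →
      ∑ i ∈ s, f i = 0 → ∀ i ∈ s, f i = 0 := by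
    intro σ s f hf h0 i hi
    obtain ⟨p, -, hp2, hp3, -⟩ := exists_proj (F.isInternal σ)
    have := congrArg (p i) h0
    rw [map_sum, map_zero, Finset.sum_eq_single_of_mem i hi
      (fun j _ hj => hp3 j i hj _ (hf j)), hp2 i _ (hf i)] at this
    exact this
  refine isInternal_of _ ?_ ?_
  · intro s f hf hsum i hi
    refine Subtype.ext (funext fun σ => ?_)
    refine hind σ.1 s (fun j => (f j).1 σ) (fun j => hf j σ) ?_ i hi
    have h0 := congrFun (congrArg Subtype.val hsum) σ
    rw [AddSubmonoidClass.coe_finsetSum, Finset.sum_apply] at h0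
    exact h0
  · choose p hp1 hp2 hp3 hp4 using fun σ => exists_proj (F.isInternal σ)
    have hcomm : ∀ {σ τ : Δ.Cone} (h : τ ≤ σ) (i : ℕ) (x : F.stalk σ),
        F.res h (p σ i x) = p τ i (F.res h x) := by
      intro σ τ h i x
      obtain ⟨N, hN⟩ := hp4 σ x
      have hx := hN (max N (i + 1)) (le_max_left _ _)
      have hi : i ∈ Finset.range (max N (i + 1)) :=
        Finset.mem_range.2 (lt_of_lt_of_le (Nat.lt_succ_self i) (le_max_right _ _))
      conv_rhs => rw [← hx]
      rw [map_sum, map_sum, Finset.sum_eq_single_of_mem i hi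
        (fun j _ hj => hp3 τ j i hj _ (F.res_mem_deg h (hp1 σ j x)))]
      exact (hp2 τ i _ (F.res_mem_deg h (hp1 σ i x))).symm
    rw [eq_top_iff]
    rintro s -
    choose N hN using fun σ : {σ // σ ∈ U} => hp4 σ.1 (s.1 σ)
    obtain ⟨M, hM⟩ := (Set.finite_range N).bddAbove
    let c : ℕ → F.sections U := fun i =>
      ⟨fun σ => p σ.1 i (s.1 σ), fun σ τ h => by rw [hcomm, s.2 σ τ h]⟩
    have hs : s = ∑ i ∈ Finset.range M, c i := by
      refine Subtype.ext (funext fun σ => ?_)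
      simp only [AddSubmonoidClass.coe_finsetSum, Finset.sum_apply]
      exact (hN σ M (hM ⟨σ, rfl⟩)).symm
    rw [hs]
    exact Submodule.sum_mem _ fun i _ => Submodule.mem_iSup_of_mem i fun σ => hp1 σ.1 i _

/-- For a subdivision `φ : Δ' → Δ` and a cone `σ` of `Δ`, the preimage under `φ` of the smallest
open set containing `σ` (the fan of all faces of `σ`): the cones of `Δ'` contained in `σ`. -/
def preimage (Δ' : RationalFan n) {Δ : RationalFan n} (σ : Δ.Cone) : LowerSet Δ'.Cone where
  carrier := {τ | τ.1 ≤ σ.1}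
  lower' a b h (ha : a.1 ≤ σ.1) := le_trans (show b.1 ≤ a.1 from h) ha

theorem le_of_preimage {Δ' : RationalFan n} {σ : Δ.Cone} (τ : {τ // τ ∈ preimage Δ' σ}) :
    τ.1.1 ≤ σ.1 :=
  τ.2

theorem preimage_mono {Δ' : RationalFan n} {σ τ : Δ.Cone} (h : τ ≤ σ) :
    preimage Δ' τ ≤ preimage Δ' σ :=
  fun ρ (hρ : ρ.1 ≤ τ.1) => (le_trans hρ h : ρ.1 ≤ σ.1)

/-- Polynomial functions on `σ` act on the sections over the cones contained in `σ` through
restriction. -/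
instance preimageModule {Δ' : RationalFan n} (F : GradedSheaf Δ') (σ : Δ.Cone) :
    Module (polyFun σ.1) (F.sections (preimage Δ' σ)) where
  smul f s := ⟨fun τ => polyRes (le_of_preimage τ) f • s.1 τ, fun τ ρ h => by
    rw [F.res_smul, s.2 τ ρ h]
    rfl⟩
  one_smul s := Subtype.ext (funext fun τ => by
    show polyRes (le_of_preimage τ) 1 • s.1 τ = s.1 τ
    rw [map_one, one_smul])
  mul_smul f g s := Subtype.ext (funext fun τ => by
    show polyRes (le_of_preimage τ) (f * g) • s.1 τ = _ • _ • s.1 τ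
    rw [map_mul, mul_smul])
  smul_zero f := Subtype.ext (funext fun τ => smul_zero _)
  smul_add f s t := Subtype.ext (funext fun τ => smul_add _ _ _)
  add_smul f g s := Subtype.ext (funext fun τ => by
    show polyRes (le_of_preimage τ) (f + g) • s.1 τ = _ • s.1 τ + _ • s.1 τ
    rw [map_add, add_smul])
  zero_smul s := Subtype.ext (funext fun τ => by
    show polyRes (le_of_preimage τ) 0 • s.1 τ = 0
    rw [map_zero, zero_smul])

/-- The push-forward `φ_* F` of a sheaf along a subdivision `φ : Δ' → Δ`. Its stalk at `σ` is the
space of sections of `F` over the subfan of `Δ'` subdividing `σ`. -/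
def pushforward {Δ' : RationalFan n} (F : GradedSheaf Δ') (Δ : RationalFan n) :
    GradedSheaf Δ where
  stalk σ := F.sections (preimage Δ' σ)
  isScalarTower σ := ⟨fun c f s => Subtype.ext (funext fun τ => by
    show polyRes (le_of_preimage τ) (c • f) • s.1 τ =
      c • (polyRes (le_of_preimage τ) f • s.1 τ)
    rw [map_smul, smul_assoc])⟩
  res {σ τ} h :=
    { toFun := fun s => ⟨fun ρ => s.1 ⟨ρ.1, preimage_mono h ρ.2⟩,
        fun ρ ρ' h' => s.2 ⟨ρ.1, preimage_mono h ρ.2⟩ ⟨ρ'.1, preimage_mono h ρ'.2⟩ h'⟩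
      map_add' := fun _ _ => rfl
      map_smul' := fun _ _ => rfl }
  res_self _ _ := rfl
  res_res _ _ _ := rfl
  res_smul _ _ _ := rfl
  deg σ k := F.sectionsDeg (preimage Δ' σ) k
  isInternal σ := F.sectionsDeg_isInternal _
  smul_mem_deg _ _ _ _ _ hf hs τ :=
    F.smul_mem_deg τ.1 (polyRes_mem_polyDeg _ hf) (hs τ)
  res_mem_deg h _ _ hs ρ := hs ⟨ρ.1, preimage_mono h ρ.2⟩

end GradedSheaf

/-! ### The sheaf with basis the lattice points of the boxes -/

section BoxSheaf

/-- The free `𝒜_σ`-module with basis `Box(σ)`. -/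
def BoxModule {n : ℕ} (σ : PointedCone ℝ (Fin n → ℝ)) : Type := Box σ →₀ polyFun σ

variable {n : ℕ}

instance (σ : PointedCone ℝ (Fin n → ℝ)) : AddCommGroup (BoxModule σ) :=
  inferInstanceAs (AddCommGroup (Box σ →₀ polyFun σ))

instance (σ : PointedCone ℝ (Fin n → ℝ)) : Module (polyFun σ) (BoxModule σ) :=
  inferInstanceAs (Module (polyFun σ) (Box σ →₀ polyFun σ))

instance (σ : PointedCone ℝ (Fin n → ℝ)) : Module ℝ (BoxModule σ) :=
  inferInstanceAs (Module ℝ (Box σ →₀ polyFun σ))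

instance (σ : PointedCone ℝ (Fin n → ℝ)) : IsScalarTower ℝ (polyFun σ) (BoxModule σ) :=
  inferInstanceAs (IsScalarTower ℝ (polyFun σ) (Box σ →₀ polyFun σ))

/-- The coefficient of the basis element `v ∈ Box(σ)`. -/
def boxCoeff {σ : PointedCone ℝ (Fin n → ℝ)} (v : Box σ) : BoxModule σ →ₗ[ℝ] polyFun σ where
  toFun f := (show Box σ →₀ polyFun σ from f) v
  map_add' _ _ := rfl
  map_smul' _ _ := rfl

theorem boxCoeff_smul {σ : PointedCone ℝ (Fin n → ℝ)} (v : Box σ) (f : polyFun σ)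
    (s : BoxModule σ) : boxCoeff v (f • s) = f * boxCoeff v s := rfl

theorem boxModule_ext {σ : PointedCone ℝ (Fin n → ℝ)} {s t : BoxModule σ}
    (h : ∀ v, boxCoeff v s = boxCoeff v t) : s = t :=
  Finsupp.ext h

/-- The element `a • v` of the free module with basis `Box(σ)`. -/
def boxSingle {σ : PointedCone ℝ (Fin n → ℝ)} (v : Box σ) : polyFun σ →+ BoxModule σ :=
  Finsupp.singleAddHom v

theorem boxCoeff_single_self {σ : PointedCone ℝ (Fin n → ℝ)} (v : Box σ) (a : polyFun σ) :
    boxCoeff v (boxSingle v a) = a :=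
  Finsupp.single_eq_same

theorem boxCoeff_single_of_ne {σ : PointedCone ℝ (Fin n → ℝ)} {v w : Box σ} (h : v ≠ w)
    (a : polyFun σ) : boxCoeff w (boxSingle v a) = 0 :=
  Finsupp.single_eq_of_ne h.symm

theorem boxModule_induction {σ : PointedCone ℝ (Fin n → ℝ)} {p : BoxModule σ → Prop}
    (s : BoxModule σ) (h0 : p 0) (hadd : ∀ s t, p s → p t → p (s + t))
    (hsingle : ∀ v a, p (boxSingle v a)) : p s :=
  Finsupp.induction_linear s h0 hadd hsingle

variable (Δ : RationalFan n) (K : (Fin n → ℝ) → ℝ)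

/-- The degree `k` part of the free `𝒜_σ`-module with basis `Box(σ)`, where `v ∈ Box(σ)` has
degree `K v`: the coefficient of `v` is homogeneous of degree `k - K v`
(and it is zero if `k - K v` is negative). -/
def boxDeg (σ : PointedCone ℝ (Fin n → ℝ)) (k : ℕ) : Submodule ℝ (BoxModule σ) where
  carrier := {f | ∀ v : Box σ,
    boxCoeff v f = 0 ∨ ∃ j : ℕ, K v.1 + j = k ∧ boxCoeff v f ∈ polyDeg σ j}
  add_mem' {f g} hf hg v := by
    rw [map_add]
    rcases hf v with h | ⟨j, hj, h⟩
    · rw [h, zero_add]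
      exact hg v
    · rcases hg v with h' | ⟨j', hj', h'⟩
      · rw [h', add_zero]
        exact Or.inr ⟨j, hj, h⟩
      · have : j' = j := by
          have : (j' : ℝ) = j := by linarith
          exact_mod_cast this
        subst this
        exact Or.inr ⟨j', hj, Submodule.add_mem _ h h'⟩
  zero_mem' v := Or.inl (map_zero _)
  smul_mem' c f hf v := by
    rw [map_smul]
    rcases hf v with h | ⟨j, hj, h⟩
    · exact Or.inl (by rw [h, smul_zero])
    · exact Or.inr ⟨j, hj, Submodule.smul_mem _ c h⟩

theorem mem_boxDeg {σ : PointedCone ℝ (Fin n → ℝ)} {k : ℕ} {f : BoxModule σ} :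
    f ∈ boxDeg K σ k ↔
      ∀ v : Box σ, boxCoeff v f = 0 ∨ ∃ j : ℕ, K v.1 + j = k ∧ boxCoeff v f ∈ polyDeg σ j :=
  Iff.rfl

/-- The restriction map from the free `𝒜_σ`-module on `Box(σ)` to the free `𝒜_τ`-module on
`Box(τ)`: it restricts the coefficients to `τ`, and sends the basis element `v` to `v` if
`v ∈ Box(τ)`, and to zero otherwise. -/
def boxRes {σ τ : PointedCone ℝ (Fin n → ℝ)} (h : τ.IsFaceOf σ) :
    BoxModule σ →ₗ[ℝ] BoxModule τ where
  toFun f := ((show Box σ →₀ polyFun σ from f).comapDomain (Set.inclusion (box_mono h))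
    (Set.inclusion_injective _).injOn).mapRange (polyRes h.le) (map_zero _)
  map_add' _ _ := Finsupp.ext fun _ => rfl
  map_smul' _ _ := Finsupp.ext fun _ => rfl

theorem boxCoeff_boxRes {σ τ : PointedCone ℝ (Fin n → ℝ)} (h : τ.IsFaceOf σ)
    (f : BoxModule σ) (v : Box τ) :
    boxCoeff v (boxRes h f) = polyRes h.le (boxCoeff ⟨v.1, box_mono h v.2⟩ f) := rfl

theorem boxDeg_isInternal (hK : Δ.IsGorensteinFunction K) (σ : Δ.Cone) :
    DirectSum.IsInternal (boxDeg K σ.1) := by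
  classical
  have hp := polyDeg_isInternal σ.1
  refine isInternal_of (boxDeg K σ.1) ?_ ?_
  · intro s f hf hsum i hi
    refine boxModule_ext fun v => ?_
    rw [map_zero]
    obtain ⟨m, hm⟩ := hK.exists_nat_of_mem_box σ v.2
    have h0 : ∑ j ∈ s, boxCoeff v (f j) = 0 := by
      rw [← map_sum, hsum, map_zero]
    have hlt : ∀ j, j < m → boxCoeff v (f j) = 0 := by
      intro j hj
      rcases (mem_boxDeg K).1 (hf j) v with h | ⟨l, hl, -⟩
      · exact h
      · exfalso
        rw [hm] at hl
        have : m + l = j := by exact_mod_cast hl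
        omega
    have hge : ∀ l, boxCoeff v (f (m + l)) ∈ polyDeg σ.1 l := by
      intro l
      rcases (mem_boxDeg K).1 (hf (m + l)) v with h | ⟨l', hl', h⟩
      · rw [h]
        exact Submodule.zero_mem _
      · rw [hm] at hl'
        have : m + l' = m + l := by exact_mod_cast hl'
        rwa [show l' = l by omega] at h
    obtain ⟨p, -, hp2, hp3, -⟩ := exists_proj hp
    by_cases him : i < m
    · exact hlt i him
    · have h1 := congrArg (p (i - m)) h0
      rw [map_sum, map_zero, Finset.sum_eq_single_of_mem i hi] at h1
      · have h2 := hge (i - m)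
        rw [show m + (i - m) = i by omega] at h2
        rw [hp2 _ _ h2] at h1
        exact h1
      · intro j _ hj
        by_cases hjm : j < m
        · rw [hlt j hjm, map_zero]
        · have h2 := hge (j - m)
          rw [show m + (j - m) = j by omega] at h2
          exact hp3 (j - m) (i - m) (by omega) _ h2
  · rw [eq_top_iff]
    rintro f -
    refine boxModule_induction f (Submodule.zero_mem _)
      (fun _ _ hs ht => Submodule.add_mem _ hs ht) fun v a => ?_
    obtain ⟨m, hm⟩ := hK.exists_nat_of_mem_box σ v.2
    obtain ⟨p, hp1, -, -, hp4⟩ := exists_proj hp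
    obtain ⟨N, hN⟩ := hp4 a
    rw [← hN N le_rfl, map_sum]
    refine Submodule.sum_mem _ fun j _ =>
      Submodule.mem_iSup_of_mem (m + j) ((mem_boxDeg K).2 fun w => ?_)
    by_cases hw : v = w
    · subst hw
      refine Or.inr ⟨j, by rw [hm]; push_cast; ring, ?_⟩
      rw [boxCoeff_single_self]
      exact hp1 j a
    · exact Or.inl (boxCoeff_single_of_ne hw _)

theorem smul_mem_boxDeg {σ : PointedCone ℝ (Fin n → ℝ)} {i j : ℕ} {f : polyFun σ}
    {s : BoxModule σ} (hf : f ∈ polyDeg σ i) (hs : s ∈ boxDeg K σ j) :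
    f • s ∈ boxDeg K σ (i + j) := by
  refine (mem_boxDeg K).2 fun v => ?_
  rw [boxCoeff_smul]
  rcases (mem_boxDeg K).1 hs v with h | ⟨l, hl, h⟩
  · exact Or.inl (by rw [h, mul_zero])
  · exact Or.inr ⟨i + l, by push_cast; rw [← hl]; ring, mul_mem_polyDeg hf h⟩

theorem boxRes_mem_boxDeg {σ τ : PointedCone ℝ (Fin n → ℝ)} (h : τ.IsFaceOf σ) {k : ℕ}
    {s : BoxModule σ} (hs : s ∈ boxDeg K σ k) : boxRes h s ∈ boxDeg K τ k := by
  refine (mem_boxDeg K).2 fun v => ?_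
  rw [boxCoeff_boxRes]
  rcases (mem_boxDeg K).1 hs ⟨v.1, box_mono h v.2⟩ with h0 | ⟨j, hj, h0⟩
  · exact Or.inl (by rw [h0, map_zero])
  · exact Or.inr ⟨j, hj, polyRes_mem_polyDeg h.le h0⟩

/-- The sheaf on a (simplicial) Gorenstein fan whose stalk at `σ` is the free `𝒜_σ`-module with
basis `Box(σ)`, a basis element `v` having degree `K_Δ(v)`. -/
def boxSheaf (hK : Δ.IsGorensteinFunction K) : GradedSheaf Δ where
  stalk σ := BoxModule σ.1
  res {σ τ} h := boxRes ((Δ.isFaceOf_iff_le τ σ).2 h)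
  res_self _ _ := boxModule_ext fun _ => rfl
  res_res _ _ _ := boxModule_ext fun _ => rfl
  res_smul h f s := boxModule_ext fun v => by
    rw [boxCoeff_boxRes, boxCoeff_smul, boxCoeff_smul, boxCoeff_boxRes, map_mul]
  deg σ k := boxDeg K σ.1 k
  isInternal σ := boxDeg_isInternal Δ K hK σ
  smul_mem_deg _ _ _ _ _ hf hs := smul_mem_boxDeg K hf hs
  res_mem_deg _ _ _ hs := boxRes_mem_boxDeg K _ hs

end BoxSheaf

end

end EhrhartFan

/-! Sections and lattice points. Let τ be a cone of the simplicial subdivision `Δ'`. A lattice point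
w of τ is uniquely v + ∑ aₚ p, where v is in the box, p runs over the primitive generators, and aₚ
is the integral part of the coordinate of w at p. The monomials with exponents aₚ times the basis
elements v thus form a real basis of the stalk at τ indexed by the lattice points of τ (`latBasis`),
the element of w having degree K(w). Restriction to a face keeps the basis elements of points of the
face and kills the others (`boxRes_latElt`). So a section over a subfan is a finitely supported
function on the lattice points of its support (`exists_coeff`). Such a function can be read on any
larger subfan, which is flabbiness. On a complete fan the sections of degree k are the functions on
the finite set of lattice points with K = k.

Existence of a subdivision. Give generic heights to all primitive generators of `Δ` and take, in
each cone, the lower faces of the lifted generators. Genericity makes the pieces simplicial, no new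
rays appear, so K does not change, and the pieces in different cones fit together because the
heights are chosen globally.

Local freeness is the substantial part. A section over the subdivision of σ is determined on the
cones of full dimension, and there it splits according to box points: the coefficients of v form a
piecewise polynomial function on the full-dimensional cones whose box contains v, which are the
cones containing the smallest cone around v. So the stalk is a retract of a finite product of
modules of piecewise polynomials on stars, and a star is pulled back from a simplicial fan with
convex support in a quotient space. It remains to see that piecewise polynomials on a simplicial fan
with convex support of full dimension form a finitely generated projective module
(`finiteProjective_pwPoly`). The grading then upgrades projective to free
(`free_of_graded_projective`).

For a fan carrying a strictly convex piecewise linear function, the maximal cones are ordered by the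
values at a generic point of the corresponding linear functions; adding them in this order adds one
free summand of rank one at a time (`finiteProjective_of_shelling`). In general, subdividing an edge
embeds the piecewise polynomials of the old fan into those of the new one, with integration along
the subdivision as a left inverse (`exists_pushforward`), so projectivity descends. Subdividing
edges until no cone crosses a facet hyperplane of the original fan produces a regular fan
(`RelRegular.exists_isRegular`). -/

namespace EhrhartFan

/-! ### Polynomial functions on a real vector space -/

section PolyOn

variable {V : Type*} [AddCommGroup V] [Module ℝ V]

variable (V) in
/-- The ring of polynomial functions on a real vector space. -/
def PolyOn : Subalgebra ℝ (V → ℝ) :=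
  Algebra.adjoin ℝ (Set.range fun l : V →ₗ[ℝ] ℝ => (l : V → ℝ))

instance : CommRing (PolyOn V) := inferInstance

instance : Module (PolyOn V) (PolyOn V) := Semiring.toModule

/-- A linear functional as a polynomial function. -/
def PolyOn.lin (l : V →ₗ[ℝ] ℝ) : PolyOn V :=
  ⟨l, Algebra.subset_adjoin ⟨l, rfl⟩⟩

namespace PolyOn

@[simp] theorem lin_apply (l : V →ₗ[ℝ] ℝ) (y : V) : (lin l).1 y = l y := rfl

@[simp] theorem add_apply (f g : PolyOn V) (y : V) : (f + g).1 y = f.1 y + g.1 y := rfl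
@[simp] theorem sub_apply (f g : PolyOn V) (y : V) : (f - g).1 y = f.1 y - g.1 y := rfl
@[simp] theorem mul_apply (f g : PolyOn V) (y : V) : (f * g).1 y = f.1 y * g.1 y := rfl
@[simp] theorem zero_apply (y : V) : (0 : PolyOn V).1 y = 0 := rfl

@[simp] theorem prod_apply {ι : Type*} (s : Finset ι) (f : ι → PolyOn V) (y : V) :
    (∏ i ∈ s, f i).1 y = ∏ i ∈ s, (f i).1 y := by
  classical
  induction s using Finset.induction_on with
  | empty => simp
  | insert i s hi ih => rw [Finset.prod_insert hi, Finset.prod_insert hi, mul_apply, ih]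

theorem ext {f g : PolyOn V} (h : ∀ y, f.1 y = g.1 y) : f = g := Subtype.ext (funext h)

/-- Functionals are affine along a line, and they generate all polynomial functions. This moves
questions of vanishing to `Polynomial ℝ`. -/
theorem exists_line (f : PolyOn V) (x y : V) :
    ∃ P : Polynomial ℝ, ∀ t : ℝ, P.eval t = f.1 (x + t • y) := by
  obtain ⟨f, hf⟩ := f
  induction hf using Algebra.adjoin_induction with
  | mem f hf =>
    obtain ⟨l, rfl⟩ := hf
    exact ⟨Polynomial.C (l x) + Polynomial.X * Polynomial.C (l y), fun t => by simp; ring⟩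
  | algebraMap r => exact ⟨Polynomial.C r, fun t => by simp⟩
  | add f g _ _ hf hg =>
    obtain ⟨P, hP⟩ := hf
    obtain ⟨Q, hQ⟩ := hg
    exact ⟨P + Q, fun t => by simp [hP, hQ]⟩
  | mul f g _ _ hf hg =>
    obtain ⟨P, hP⟩ := hf
    obtain ⟨Q, hQ⟩ := hg
    exact ⟨P * Q, fun t => by simp [hP, hQ]⟩

/-- A polynomial function that vanishes at infinitely many points of a line vanishes on it. -/
theorem eq_zero_of_line (f : PolyOn V) (x y : V) (s : Set ℝ) (hs : s.Infinite)
    (h : ∀ t ∈ s, f.1 (x + t • y) = 0) (t : ℝ) : f.1 (x + t • y) = 0 := by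
  obtain ⟨P, hP⟩ := exists_line f x y
  have : P = 0 := Polynomial.eq_zero_of_infinite_isRoot P
    (hs.mono fun t ht => by simp [Polynomial.IsRoot, hP, h t ht])
  rw [← hP, this, Polynomial.eval_zero]

theorem eq_zero_of_punctured (f : PolyOn V) (x y : V)
    (h : ∀ t : ℝ, t ≠ 0 → f.1 (x + t • y) = 0) : f.1 x = 0 := by
  have := eq_zero_of_line f x y {0}ᶜ (Set.finite_singleton 0).infinite_compl
    (fun t ht => h t ht) 0
  simpa using this

/-- A polynomial function that vanishes on a cone vanishes on its span. -/
theorem eq_zero_of_cone (f : PolyOn V) {C : PointedCone ℝ V} (h : ∀ y ∈ C, f.1 y = 0) {y : V}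
    (hy : y ∈ Submodule.span ℝ (C : Set V)) : f.1 y = 0 := by
  have hdec : ∃ a ∈ C, ∃ b ∈ C, y = a - b := by
    induction hy using Submodule.span_induction with
    | mem x hx => exact ⟨x, hx, 0, C.zero_mem, by simp⟩
    | zero => exact ⟨0, C.zero_mem, 0, C.zero_mem, by simp⟩
    | add x y _ _ hx hy =>
      obtain ⟨a, ha, b, hb, rfl⟩ := hx
      obtain ⟨c, hc, d, hd, rfl⟩ := hy
      exact ⟨a + c, C.add_mem ha hc, b + d, C.add_mem hb hd, by abel⟩
    | smul r x _ hx =>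
      obtain ⟨a, ha, b, hb, rfl⟩ := hx
      rcases le_total 0 r with hr | hr
      · exact ⟨r • a, C.smul_mem hr ha, r • b, C.smul_mem hr hb, smul_sub _ _ _⟩
      · refine ⟨(-r) • b, C.smul_mem (by linarith) hb, (-r) • a, C.smul_mem (by linarith) ha, ?_⟩
        module
  obtain ⟨a, ha, b, hb, rfl⟩ := hdec
  -- The points a + t b with t ≥ 0 lie in `C`, and t = -1 gives a - b.
  have := eq_zero_of_line f a b (Set.Ici 0) (Set.Ici_infinite 0)
    (fun t ht => h _ (C.add_mem ha (C.smul_mem ht hb))) (-1)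
  simpa [sub_eq_add_neg] using this

/-- Substituting y - l(y) e for y changes f only by a multiple of l: clear for functionals, and
inherited by sums and products. When l(e) = 1 the substitution is the projection to the hyperplane.
-/
theorem exists_sub_mul (l : V →ₗ[ℝ] ℝ) (e : V) (f : PolyOn V) :
    ∃ f' g : PolyOn V, (∀ y, f'.1 y = f.1 (y - l y • e)) ∧ ∀ y, f.1 y = f'.1 y + l y * g.1 y := by
  obtain ⟨f, hf⟩ := f
  induction hf using Algebra.adjoin_induction with
  | mem f hf =>
    obtain ⟨m, rfl⟩ := hf
    refine ⟨lin (m - m e • l), algebraMap ℝ _ (m e), fun y => ?_, fun y => ?_⟩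
    · simp [mul_comm]
    · show m y = (m - m e • l) y + l y * m e
      simp [mul_comm]
  | algebraMap r =>
    exact ⟨algebraMap ℝ _ r, 0, fun y => rfl, fun y => by simp⟩
  | add f g _ _ hf hg =>
    obtain ⟨f', f2, h1, h2⟩ := hf
    obtain ⟨g', g2, h3, h4⟩ := hg
    refine ⟨f' + g', f2 + g2, fun y => ?_, fun y => ?_⟩
    · simp [h1, h3]
    · have := h2 y; have := h4 y; simp at *; linarith
  | mul f g _ _ hf hg =>
    obtain ⟨f', f2, h1, h2⟩ := hf
    obtain ⟨g', g2, h3, h4⟩ := hg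
    refine ⟨f' * g', f' * g2 + f2 * g' + lin l * f2 * g2, fun y => ?_, fun y => ?_⟩
    · simp [h1, h3]
    · have h5 := h2 y
      have h6 := h4 y
      simp only [Pi.mul_apply, mul_apply, add_apply, lin_apply] at *
      rw [h5, h6]; ring

/-- A polynomial function that vanishes on a hyperplane is divisible by its equation. -/
theorem exists_eq_lin_mul {l : V →ₗ[ℝ] ℝ} (hl : l ≠ 0) (f : PolyOn V)
    (h : ∀ y, l y = 0 → f.1 y = 0) : ∃ g, f = lin l * g := by
  obtain ⟨e, he⟩ : ∃ e, l e = 1 := by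
    obtain ⟨x, hx⟩ : ∃ x, l x ≠ 0 := by
      by_contra! hx
      exact hl (LinearMap.ext hx)
    exact ⟨(l x)⁻¹ • x, by simp [hx]⟩
  obtain ⟨f', g, h1, h2⟩ := exists_sub_mul l e f
  refine ⟨g, ext fun y => ?_⟩
  rw [h2, h1, h _ (by simp [he]), zero_add]
  rfl

/-- Off the hyperplane one cancels pointwise; a point on the hyperplane is reached along a
transversal line. -/
theorem lin_mul_cancel {l : V →ₗ[ℝ] ℝ} (hl : l ≠ 0) {f g : PolyOn V}
    (h : lin l * f = lin l * g) : f = g := by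
  obtain ⟨e, he⟩ : ∃ e, l e ≠ 0 := by
    by_contra! hx
    exact hl (LinearMap.ext hx)
  have key : ∀ y, l y ≠ 0 → (f - g).1 y = 0 := fun y hy => by
    have := congrArg (fun f => f.1 y) h
    simp only [mul_apply, lin_apply, sub_apply] at this ⊢
    rw [mul_left_cancel₀ hy this, sub_self]
  refine sub_eq_zero.1 (ext fun y => ?_)
  by_cases hy : l y = 0
  · exact eq_zero_of_punctured _ y e fun t ht => key _ (by simp [hy, ht, he])
  · exact key y hy

end PolyOn

end PolyOn

end EhrhartFan

namespace EhrhartFan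

/-! ### Finite projective modules -/

section FiniteProjective

variable {R M N : Type*} [CommRing R] [AddCommGroup M] [Module R M] [AddCommGroup N] [Module R N]

variable (R M) in
/-- Finitely generated projective modules. -/
def FiniteProjective : Prop := Module.Finite R M ∧ Module.Projective R M

/-- Projectivity, unlike freeness, visibly passes to retracts. It is therefore the property carried
through all the reductions, and freeness is extracted only at the end. -/
theorem FiniteProjective.of_retract (h : FiniteProjective R N) (i : M →ₗ[R] N) (s : N →ₗ[R] M)
    (hs : ∀ x, s (i x) = x) : FiniteProjective R M := by
  obtain ⟨h1, h2⟩ := h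
  exact ⟨Module.Finite.of_surjective s fun x => ⟨i x, hs x⟩,
    Module.Projective.of_split i s (LinearMap.ext hs)⟩

/-- Cancellation makes the quotient unique, hence linear. -/
theorem exists_linearMap_div (x : R) (hx : ∀ a b : R, x * a = x * b → a = b) (φ : M →ₗ[R] R)
    (h : ∀ m, ∃ a, φ m = x * a) : ∃ ψ : M →ₗ[R] R, ∀ m, φ m = x * ψ m := by
  choose ψ hψ using h
  exact ⟨{ toFun := ψ
           map_add' := fun a b => hx _ _ (by rw [← hψ, map_add, hψ, hψ, mul_add])
           map_smul' := fun r a => hx _ _ (by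
            rw [← hψ, map_smul, hψ, RingHom.id_apply, smul_eq_mul, smul_eq_mul]; ring) }, hψ⟩

end FiniteProjective

/-! ### Simplicial fans with convex support and their modules of piecewise polynomials -/

/-- A simplicial fan in `Q`, all of whose maximal cones have full dimension and whose support is
closed under addition. Its vertices are indexed by `ι`, the maximal cones are given by the index
sets of their generators, and `X T i` is the coordinate of the generator `v i` in the cone `T`. -/
structure SFan (ι Q : Type*) [AddCommGroup Q] [Module ℝ Q] where
  F : Finset (Finset ι)
  v : ι → Q
  X : Finset ι → ι → (Q →ₗ[ℝ] ℝ)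
  X_off : ∀ T ∈ F, ∀ i ∉ T, X T i = 0
  X_self : ∀ {T}, T ∈ F → ∀ {i}, i ∈ T → X T i (v i) = 1
  X_of_ne : ∀ {T}, T ∈ F → ∀ {i j}, j ∈ T → i ≠ j → X T i (v j) = 0
  sum_X : ∀ T ∈ F, ∀ x, ∑ i ∈ T, X T i x • v i = x
  glue : ∀ T ∈ F, ∀ T' ∈ F, ∀ x, (∀ i, 0 ≤ X T i x) → (∀ i, 0 ≤ X T' i x) →
    ∀ i, X T i x = X T' i x
  add : ∀ T ∈ F, ∀ T' ∈ F, ∀ x y, (∀ i, 0 ≤ X T i x) → (∀ i, 0 ≤ X T' i y) →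
    ∃ T'' ∈ F, ∀ i, 0 ≤ X T'' i (x + y)

namespace SFan

variable {ι Q V : Type*} [AddCommGroup Q] [Module ℝ Q] [AddCommGroup V] [Module ℝ V]
variable (S : SFan ι Q)

theorem X_ne_zero {T : Finset ι} (hT : T ∈ S.F) {i : ι} (hi : i ∈ T) : S.X T i ≠ 0 := fun h => by
  simpa [h] using S.X_self hT hi

theorem X_v_nonneg {T : Finset ι} (hT : T ∈ S.F) {j : ι} (hj : j ∈ T) (i : ι) :
    0 ≤ S.X T i (S.v j) := by
  by_cases hij : i = j
  · subst hij; rw [S.X_self hT hj]; exact zero_le_one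
  · rw [S.X_of_ne hT hj hij]

/-- A linear functional is determined by its values on the generators of a cone. -/
theorem functional_eq {T : Finset ι} (hT : T ∈ S.F) (m : Q →ₗ[ℝ] ℝ) (x : Q) :
    m x = ∑ i ∈ T, S.X T i x * m (S.v i) := by
  conv_lhs => rw [← S.sum_X T hT x]
  simp [map_sum]

/-- The generators of `T` already span, so the coordinate in `T'` of an additional generator would
vanish on everything. -/
theorem eq_of_subset {T T' : Finset ι} (hT : T ∈ S.F) (hT' : T' ∈ S.F) (h : T ⊆ T') :
    T = T' := by
  refine h.antisymm fun j hj => ?_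
  by_contra hjT
  have := S.functional_eq hT (S.X T' j) (S.v j)
  rw [S.X_self hT' hj, Finset.sum_eq_zero fun i hi => ?_] at this
  · exact one_ne_zero this
  · rw [S.X_of_ne hT' (h hi) (by rintro rfl; exact hjT hi), mul_zero]

/-- The span of the common generators of two cones. -/
def span (T T' : Finset ι) : Submodule ℝ Q := Submodule.span ℝ (S.v '' (T ∩ T' : Set ι))

theorem span_comm (T T' : Finset ι) : S.span T T' = S.span T' T := by
  rw [span, span, Set.inter_comm]

theorem X_eq_zero_of_span {T T' : Finset ι} (hT : T ∈ S.F) {x : Q} (hx : x ∈ S.span T T') {i : ι}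
    (hi : i ∉ T') : S.X T i x = 0 := by
  induction hx using Submodule.span_induction with
  | mem x hx =>
    obtain ⟨j, hj, rfl⟩ := hx
    exact S.X_of_ne hT hj.1 fun h => hi (h ▸ hj.2)
  | zero => simp
  | add x y _ _ hx hy => simp [hx, hy]
  | smul r x _ hx => simp [hx]

theorem X_eq_of_span {T T' : Finset ι} (hT : T ∈ S.F) (hT' : T' ∈ S.F) {x : Q}
    (hx : x ∈ S.span T T') (i : ι) : S.X T i x = S.X T' i x := by
  induction hx using Submodule.span_induction with
  | mem x hx =>
    obtain ⟨j, hj, rfl⟩ := hx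
    by_cases hij : i = j
    · subst hij; rw [S.X_self hT hj.1, S.X_self hT' hj.2]
    · rw [S.X_of_ne hT hj.1 hij, S.X_of_ne hT' hj.2 hij]
  | zero => simp
  | add x y _ _ hx hy => simp [hx, hy]
  | smul r x _ hx => simp [hx]

theorem mem_span_of {T T' : Finset ι} (hT : T ∈ S.F) {x : Q}
    (h : ∀ i ∈ T, i ∉ T' → S.X T i x = 0) : x ∈ S.span T T' := by
  rw [← S.sum_X T hT x]
  refine Submodule.sum_mem _ fun i hi => ?_
  by_cases hi' : i ∈ T'
  · exact Submodule.smul_mem _ _ (Submodule.subset_span ⟨i, ⟨hi, hi'⟩, rfl⟩)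
  · rw [h i hi hi', zero_smul]
    exact Submodule.zero_mem _

variable (q : V →ₗ[ℝ] Q)

/-- The piecewise polynomial functions on a fan (pulled back along a linear map `q`) which vanish
on the maximal cones outside a set `U` of maximal cones. -/
def pwPoly (U : Finset (Finset ι)) : Submodule (PolyOn V) (Finset ι → PolyOn V) where
  carrier := {f | (∀ T, T ∉ U → f T = 0) ∧
    ∀ T ∈ S.F, ∀ T' ∈ S.F, ∀ y, q y ∈ S.span T T' → (f T).1 y = (f T').1 y}
  add_mem' {f g} hf hg := ⟨fun T hT => by simp [hf.1 T hT, hg.1 T hT], fun T hT T' hT' y hy => by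
    simp [hf.2 T hT T' hT' y hy, hg.2 T hT T' hT' y hy]⟩
  zero_mem' := ⟨fun _ _ => rfl, fun _ _ _ _ _ _ => rfl⟩
  smul_mem' c f hf := ⟨fun T hT => by simp [hf.1 T hT], fun T hT T' hT' y hy => by
    simp [hf.2 T hT T' hT' y hy]⟩

instance (U : Finset (Finset ι)) : AddCommGroup (S.pwPoly q U) := Submodule.addCommGroup _

instance (U : Finset (Finset ι)) : Module (PolyOn V) (S.pwPoly q U) := Submodule.module _

/-- The coordinate functions of a cone, pulled back along `q`. -/
def XX (T : Finset ι) (i : ι) : PolyOn V := PolyOn.lin (S.X T i ∘ₗ q)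

@[simp] theorem XX_apply (T : Finset ι) (i : ι) (y : V) : (S.XX q T i).1 y = S.X T i (q y) := rfl

variable {q}

theorem comp_ne_zero (hq : Function.Surjective q) {m : Q →ₗ[ℝ] ℝ} (hm : m ≠ 0) : m ∘ₗ q ≠ 0 := by
  intro h
  refine hm (LinearMap.ext fun x => ?_)
  obtain ⟨y, rfl⟩ := hq x
  exact LinearMap.congr_fun h y

/-- A polynomial function vanishing on facet hyperplanes of a simplicial cone is divisible by the
product of their equations. -/
theorem exists_eq_prod_mul (hq : Function.Surjective q) {T : Finset ι} (hT : T ∈ S.F)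
    (G : Finset ι) (hG : G ⊆ T) (f : PolyOn V)
    (h : ∀ i ∈ G, ∀ y, S.X T i (q y) = 0 → f.1 y = 0) : ∃ g, f = (∏ i ∈ G, S.XX q T i) * g := by
  classical
  induction G using Finset.induction_on with
  | empty => exact ⟨f, by simp⟩
  | insert i G hi ih =>
    obtain ⟨g, rfl⟩ := ih ((Finset.subset_insert _ _).trans hG)
      fun j hj => h j (Finset.mem_insert_of_mem hj)
    have hiT := hG (Finset.mem_insert_self i G)
    obtain ⟨g', rfl⟩ := PolyOn.exists_eq_lin_mul (comp_ne_zero hq (S.X_ne_zero hT hiT)) g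
      (fun y hy => by
        -- A direction inside the hyperplane of i along which all coordinates in `G` increase at
        -- unit speed. Away from the hyperplanes of `G` the product is nonzero, so g vanishes there.
        obtain ⟨p, hp⟩ := hq (∑ j ∈ G, S.v j)
        have hpi : S.X T i (q p) = 0 := by
          rw [hp, map_sum]
          exact Finset.sum_eq_zero fun j hj => S.X_of_ne hT (hG (Finset.mem_insert_of_mem hj))
            fun h => hi (h ▸ hj)
        have hpj : ∀ j ∈ G, S.X T j (q p) = 1 := fun j hj => by
          have hjT := hG (Finset.mem_insert_of_mem hj)
          rw [hp, map_sum, Finset.sum_eq_single_of_mem j hj, S.X_self hT hjT]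
          exact fun k hk hkj => S.X_of_ne hT (hG (Finset.mem_insert_of_mem hk)) hkj.symm
        -- all but finitely many points of the line through `y` lie off the hyperplanes in `G`
        let Z : Set ℝ := ⋃ j ∈ G, {-S.X T j (q y)}
        have hZ : Z.Finite := G.finite_toSet.biUnion fun j _ => Set.finite_singleton _
        have := PolyOn.eq_zero_of_line g y p Zᶜ hZ.infinite_compl (fun t ht => by
          have h0 := h i (Finset.mem_insert_self i G) (y + t • p) (by
            have hy' : S.X T i (q y) = 0 := hy
            simp [hy', hpi])
          rw [PolyOn.mul_apply, PolyOn.prod_apply] at h0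
          refine (mul_eq_zero.1 h0).resolve_left (Finset.prod_ne_zero_iff.2 fun j hj h1 => ht ?_)
          simp only [XX_apply, map_add, map_smul, hpj j hj, smul_eq_mul, mul_one] at h1
          exact Set.mem_biUnion hj (by
            rw [Set.mem_singleton_iff]; linarith)) 0
        simpa using this)
    exact ⟨g', by rw [Finset.prod_insert hi]; unfold XX; ring⟩

theorem prod_XX_cancel (hq : Function.Surjective q) {T : Finset ι} (hT : T ∈ S.F)
    {G : Finset ι} (hG : G ⊆ T) {f g : PolyOn V}
    (h : (∏ i ∈ G, S.XX q T i) * f = (∏ i ∈ G, S.XX q T i) * g) : f = g := by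
  classical
  induction G using Finset.induction_on with
  | empty => simpa using h
  | insert i G hi ih =>
    rw [Finset.prod_insert hi, mul_assoc, mul_assoc] at h
    exact ih ((Finset.subset_insert _ _).trans hG) (PolyOn.lin_mul_cancel
      (comp_ne_zero hq (S.X_ne_zero hT (hG (Finset.mem_insert_self i G)))) h)

end SFan

end EhrhartFan

namespace EhrhartFan
namespace SFan

variable {ι Q V : Type*} [AddCommGroup Q] [Module ℝ Q] [AddCommGroup V] [Module ℝ V]
variable (S : SFan ι Q)

/-! ### Regular fans -/

/-- The height function `h` on the vertices defines a strictly convex piecewise linear function. -/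
def IsRegular (h : ι → ℝ) : Prop :=
  ∀ T ∈ S.F, ∀ T' ∈ S.F, ∀ j ∈ T', j ∉ T → ∑ i ∈ T, h i * S.X T i (S.v j) < h j

/-! ### Line shellings: ordering the maximal cones of a regular fan by a generic point. -/

section Shelling

variable {S} {h : ι → ℝ} (hreg : S.IsRegular h) {u : Q}
  (hu : ∀ T ∈ S.F, ∀ i ∈ T, S.X T i u ≠ 0) (hu' : ∃ T ∈ S.F, ∀ i, 0 ≤ S.X T i u)

-- Let ℓ_T be the linear function equal to h on the generators of T. Expanding u in T, ℓ_T'(u) is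
-- the sum of the X_T,i(u) ℓ_T'(v i). Here ℓ_T'(v i) equals h i for i ∈ T' and is smaller than h i
-- otherwise, and in the second case the coefficient of u is positive.
include hreg hu in
theorem key_lt {T T' : Finset ι} (hT : T ∈ S.F) (hT' : T' ∈ S.F) (hne : T ≠ T')
    (hG : ∀ i ∈ T, S.X T i u < 0 → i ∈ T') :
    ∑ i ∈ T', h i * S.X T' i u < ∑ i ∈ T, h i * S.X T i u := by
  have h1 := S.functional_eq hT (∑ i ∈ T', h i • S.X T' i) u
  simp only [LinearMap.sum_apply, LinearMap.smul_apply, smul_eq_mul] at h1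
  rw [h1]
  have h2 : ∀ i ∈ T, i ∈ T' → ∑ j ∈ T', h j * S.X T' j (S.v i) = h i := fun i _ hi' => by
    rw [Finset.sum_eq_single_of_mem i hi', S.X_self hT' hi', mul_one]
    exact fun j _ hj => by rw [S.X_of_ne hT' hi' hj, mul_zero]
  have h3 : ∀ i ∈ T, i ∉ T' →
      S.X T i u * ∑ j ∈ T', h j * S.X T' j (S.v i) < h i * S.X T i u := fun i hi hi' => by
    have hpos : 0 < S.X T i u := lt_of_le_of_ne
      (not_lt.1 fun hlt => hi' (hG i hi hlt)) (hu T hT i hi).symm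
    rw [mul_comm]
    exact mul_lt_mul_of_pos_right (hreg T' hT' T hT i hi hi') hpos
  obtain ⟨i, hi, hi'⟩ : ∃ i ∈ T, i ∉ T' := by
    by_contra! hc
    exact hne (S.eq_of_subset hT hT' hc)
  refine Finset.sum_lt_sum (fun i hi => ?_) ⟨i, hi, h3 i hi hi'⟩
  by_cases hi' : i ∈ T'
  · rw [h2 i hi hi', mul_comm]
  · exact (h3 i hi hi').le

-- This crosses the facet of T opposite to i. With p in the interior of the facet, convexity keeps N
-- p + u in the support for all N, and one cone T' contains it for infinitely many N. Dominance of N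
-- p forces T' to contain the facet; looking at u shows T' ≠ T and that u has nonnegative
-- T'-coordinates at generators outside T, so `key_lt` applies with the roles exchanged.
include hreg hu hu' in
theorem exists_neighbour {T : Finset ι} (hT : T ∈ S.F) {i : ι} (hi : i ∈ T)
    (hneg : S.X T i u < 0) : ∃ T' ∈ S.F, (∀ j ∈ T, j ≠ i → j ∈ T') ∧
      ∑ i ∈ T, h i * S.X T i u < ∑ i ∈ T', h i * S.X T' i u := by
  classical
  obtain ⟨T0, hT0, hu'⟩ := hu'
  let p := ∑ j ∈ T.erase i, S.v j
  have hpj : ∀ j ∈ T, j ≠ i → S.X T j p = 1 := fun j hj hji => by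
    have hj' : j ∈ T.erase i := Finset.mem_erase.2 ⟨hji, hj⟩
    rw [map_sum, Finset.sum_eq_single_of_mem j hj', S.X_self hT hj]
    exact fun k hk hkj => S.X_of_ne hT (Finset.mem_of_mem_erase hk) hkj.symm
  have hpj' : ∀ j, (j ∉ T ∨ j = i) → S.X T j p = 0 := fun j hj => by
    rw [map_sum]
    refine Finset.sum_eq_zero fun k hk => S.X_of_ne hT (Finset.mem_of_mem_erase hk) ?_
    rintro rfl
    rw [Finset.mem_erase] at hk
    tauto
  have hp0 : ∀ j, 0 ≤ S.X T j p := fun j => by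
    by_cases hj : j ∈ T ∧ j ≠ i
    · rw [hpj j hj.1 hj.2]; exact zero_le_one
    · rw [hpj' j (by tauto)]
  have hex : ∀ N : ℕ, ∃ T' : S.F, ∀ j, 0 ≤ S.X T' j ((N : ℝ) • p + u) := fun N => by
    obtain ⟨T', hT', h'⟩ := S.add T hT T0 hT0 ((N : ℝ) • p) u (fun j => by
      rw [map_smul, smul_eq_mul]; exact mul_nonneg (Nat.cast_nonneg _) (hp0 j)) hu'
    exact ⟨⟨T', hT'⟩, h'⟩
  choose t ht using hex
  obtain ⟨⟨T', hT'⟩, hinf⟩ := Finite.exists_infinite_fiber t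
  have hinf' : (t ⁻¹' {⟨T', hT'⟩}).Infinite := Set.infinite_coe_iff.1 hinf
  have hN : ∀ N0 : ℕ, ∃ N ≥ N0, ∀ j, 0 ≤ (N : ℝ) * S.X T' j p + S.X T' j u := fun N0 => by
    obtain ⟨N, hN, hN0⟩ := hinf'.exists_gt N0
    refine ⟨N, hN0.le, fun j => ?_⟩
    have := ht N j
    rw [show t N = ⟨T', hT'⟩ from hN] at this
    simpa using this
  have hp' : ∀ j, 0 ≤ S.X T' j p := fun j => by
    by_contra! hlt
    obtain ⟨N0, hN0⟩ := exists_nat_gt (S.X T' j u / (-S.X T' j p))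
    obtain ⟨N, hNN, hN⟩ := hN N0
    rw [div_lt_iff₀ (by linarith)] at hN0
    have h1 := hN j
    have h2 : (N0 : ℝ) ≤ N := Nat.cast_le.2 hNN
    nlinarith
  have hglue := S.glue T hT T' hT' p hp0 hp'
  have hmem : ∀ j ∈ T, j ≠ i → j ∈ T' := fun j hj hji => by
    by_contra hj'
    have := hglue j
    rw [hpj j hj hji, S.X_off T' hT' j hj'] at this
    exact one_ne_zero this
  obtain ⟨N, -, hN⟩ := hN 0
  have hne : T' ≠ T := by
    rintro rfl
    have := hN i
    rw [hpj' i (Or.inr rfl), mul_zero, zero_add] at this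
    linarith
  refine ⟨T', hT', hmem, key_lt hreg hu hT' hT hne fun j hj hjneg => ?_⟩
  by_contra hjT
  have := hN j
  rw [← hglue j, hpj' j (Or.inl hjT), mul_zero, zero_add] at this
  linarith

variable {q : V →ₗ[ℝ] Q} (hq : Function.Surjective q)

/-- The product of the coordinates of the generators in `G`, as a piecewise polynomial function. -/
theorem exists_courant (U G : Finset (ι)) (W : Finset (Finset ι))
    (hW : ∀ T ∈ S.F, G ⊆ T → T ∈ W) (hU : G ⊆ U) (hUF : U ∈ S.F) :
    ∃ b : PolyOn V →ₗ[PolyOn V] S.pwPoly q W, ∀ r, (b r).1 U = (∏ i ∈ G, S.XX q U i) * r := by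
  classical
  have hmem : (fun T => if T ∈ S.F ∧ G ⊆ T then ∏ i ∈ G, S.XX q T i else 0) ∈ S.pwPoly q W := by
    refine ⟨fun T hT => if_neg fun h => hT (hW T h.1 h.2), fun T hT T' hT' y hy => ?_⟩
    by_cases h1 : G ⊆ T <;> by_cases h2 : G ⊆ T'
    · simp only [hT, hT', h1, h2, and_self, if_true, PolyOn.prod_apply, XX_apply]
      exact Finset.prod_congr rfl fun i _ => S.X_eq_of_span hT hT' hy i
    -- A generator of `G` missing from one of the cones has a coordinate vanishing on the common
    -- span, so the product is already zero where it is cut off.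
    · obtain ⟨i, hi, hi'⟩ := Finset.not_subset.1 h2
      simp only [hT, hT', h1, h2, and_self, if_true, PolyOn.prod_apply, XX_apply, and_false,
        if_false, PolyOn.zero_apply]
      exact Finset.prod_eq_zero hi (S.X_eq_zero_of_span hT hy hi')
    · obtain ⟨i, hi, hi'⟩ := Finset.not_subset.1 h1
      simp only [hT, hT', h1, h2, and_self, if_true, PolyOn.prod_apply, XX_apply, and_false,
        if_false, PolyOn.zero_apply]
      exact (Finset.prod_eq_zero hi
        (S.X_eq_zero_of_span hT' (by rwa [S.span_comm]) hi')).symm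
    · simp [h1, h2]
  refine ⟨LinearMap.toSpanSingleton _ _ ⟨_, hmem⟩, fun r => ?_⟩
  simp [hUF, hU, mul_comm]

-- Induction on an initial segment U of the shelling with last cone T. Let G be the generators of T
-- at which u has negative coordinate. The values f T of functions supported on U are exactly the
-- multiples of the product of the coordinates in G, and the functions with f T = 0 belong to U
-- without T. Hence the module is a retract of the previous one plus a free summand of rank one.
include hreg hu hu' hq in
theorem finiteProjective_of_shelling (U : Finset (Finset ι)) (hUF : U ⊆ S.F)
    (hU : ∀ T ∈ U, ∀ T' ∈ S.F, ∑ i ∈ T', h i * S.X T' i u < ∑ i ∈ T, h i * S.X T i u → T' ∈ U) :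
    FiniteProjective (PolyOn V) (S.pwPoly q U) := by
  classical
  induction hn : U.card generalizing U with
  | zero =>
    rw [Finset.card_eq_zero] at hn
    subst hn
    have : Subsingleton (S.pwPoly q ∅) := ⟨fun f g => Subtype.ext (funext fun T => by
      rw [f.2.1 T (by simp), g.2.1 T (by simp)])⟩
    exact ⟨inferInstance, inferInstance⟩
  | succ n ih =>
    have hne : U.Nonempty := Finset.card_pos.1 (by omega)
    obtain ⟨T, hTU, hmax⟩ := U.exists_max_image (fun T => ∑ i ∈ T, h i * S.X T i u) hne
    have hT := hUF hTU
    obtain ⟨hf1, hf2⟩ := ih (U.erase T) ((U.erase_subset T).trans hUF)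
      (fun T1 hT1 T2 hT2 hlt => Finset.mem_erase.2 ⟨by
        rintro rfl
        exact absurd (hmax T1 (Finset.mem_of_mem_erase hT1)) (not_le.2 hlt),
        hU T1 (Finset.mem_of_mem_erase hT1) T2 hT2 hlt⟩)
      (by rw [Finset.card_erase_of_mem hTU, hn]; rfl)
    let G := T.filter fun i => S.X T i u < 0
    have hGT : G ⊆ T := Finset.filter_subset _ _
    -- All cones containing the face `G` precede `T`, so the Courant function of `G` is supported in
    -- `U`.
    obtain ⟨b, hb⟩ := exists_courant (S := S) (q := q) T G U (fun T' hT' hG' => by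
      by_cases hTT : T = T'
      · exact hTT ▸ hTU
      · exact hU T hTU T' hT' (key_lt hreg hu hT hT' hTT fun i hi hlt =>
          hG' (Finset.mem_filter.2 ⟨hi, hlt⟩))) hGT hT
    -- Across each facet opposite to a generator in `G` lies a cone with a larger value, hence
    -- outside `U`, where f is zero. So f T vanishes on these facets and is divisible by the
    -- product.
    obtain ⟨a, ha⟩ := exists_linearMap_div (∏ i ∈ G, S.XX q T i)
      (fun _ _ => S.prod_XX_cancel hq hT hGT)
      ((LinearMap.proj T).comp (S.pwPoly q U).subtype) (fun f =>
        S.exists_eq_prod_mul hq hT G hGT (f.1 T) fun i hi y hy => by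
          have hi' := Finset.mem_filter.1 hi
          obtain ⟨T', hT', hsub, hlt⟩ := exists_neighbour hreg hu hu' hT hi'.1 hi'.2
          have h0 : f.1 T' = 0 := f.2.1 T' fun hT'U => absurd (hmax T' hT'U) (not_le.2 hlt)
          rw [f.2.2 T hT T' hT' y (S.mem_span_of hT fun j hj hj' => ?_), h0, PolyOn.zero_apply]
          have : j = i := by by_contra hji; exact hj' (hsub j hj hji)
          rw [this, hy])
    have ha' : ∀ f : S.pwPoly q U, f.1 T = (∏ i ∈ G, S.XX q T i) * a f := ha
    have hker : ∀ f : S.pwPoly q U, (f - b (a f)).1 ∈ S.pwPoly q (U.erase T) := fun f => by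
      refine ⟨fun T' hT' => ?_, (f - b (a f)).2.2⟩
      by_cases hTT : T' = T
      · subst hTT
        show f.1 T' - (b (a f)).1 T' = 0
        rw [hb, ← ha', sub_self]
      · exact (f - b (a f)).2.1 T' fun hU' => hT' (Finset.mem_erase.2 ⟨hTT, hU'⟩)
    have hinc : S.pwPoly q (U.erase T) ≤ S.pwPoly q U := fun f hf =>
      ⟨fun T' hT' => hf.1 T' fun h' => hT' (Finset.mem_of_mem_erase h'), hf.2⟩
    refine FiniteProjective.of_retract (N := S.pwPoly q (U.erase T) × PolyOn V)
      ⟨inferInstance, inferInstance⟩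
      (LinearMap.prod (LinearMap.codRestrict _ ((S.pwPoly q U).subtype ∘ₗ
        (LinearMap.id - b ∘ₗ a)) hker) a)
      (LinearMap.coprod (Submodule.inclusion hinc) b) fun f => Subtype.ext ?_
    show (f.1 - (b (a f)).1) + (b (a f)).1 = f.1
    rw [sub_add_cancel]

include hreg hq in
/-- The piecewise polynomial functions on a regular fan form a projective module. -/
theorem IsRegular.finiteProjective (hne : S.F.Nonempty) :
    FiniteProjective (PolyOn V) (S.pwPoly q S.F) := by
  classical
  obtain ⟨u, hu, hu'⟩ : ∃ u, (∀ T ∈ S.F, ∀ i ∈ T, S.X T i u ≠ 0) ∧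
      ∃ T ∈ S.F, ∀ i, 0 ≤ S.X T i u := by
    obtain ⟨T0, hT0⟩ := hne
    let I : Type _ := Σ T : S.F, T.1
    obtain ⟨w, hw⟩ : ∃ w : Q, ∀ i : I, S.X i.1 i.2 w ≠ 0 := by
      exact Module.Dual.exists_forall_ne_zero_of_forall_exists (fun i : I => S.X i.1 i.2)
        fun i => ⟨_, by rw [S.X_self i.1.2 i.2.2]; exact one_ne_zero⟩
    -- The points N p + w lie in `T0` for large N and on a facet hyperplane of some cone for
    -- finitely many N only.
    let p := ∑ j ∈ T0, S.v j
    have hp : ∀ j ∈ T0, S.X T0 j p = 1 := fun j hj => by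
      rw [map_sum, Finset.sum_eq_single_of_mem j hj, S.X_self hT0 hj]
      exact fun k hk hkj => S.X_of_ne hT0 hk hkj.symm
    let bad : Set ℕ := ⋃ i : I, {N | (N : ℝ) * S.X i.1 i.2 p + S.X i.1 i.2 w = 0}
    have hbad : bad.Finite := Set.finite_iUnion fun i => by
      refine Set.Subsingleton.finite fun a ha b hb => ?_
      simp only [Set.mem_ofPred_eq] at ha hb
      have h1 : ((a : ℝ) - b) * S.X i.1 i.2 p = 0 := by linarith
      rcases mul_eq_zero.1 h1 with h1 | h1
      · exact_mod_cast sub_eq_zero.1 h1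
      · rw [h1, mul_zero, zero_add] at ha
        exact absurd ha (hw i)
    let N0 : ℕ := ∑ j ∈ T0, ⌈|S.X T0 j w|⌉₊
    obtain ⟨N, hN, hN0⟩ := hbad.infinite_compl.exists_gt N0
    refine ⟨(N : ℝ) • p + w, fun T hT i hi h0 => hN (Set.mem_iUnion.2 ⟨⟨⟨T, hT⟩, i, hi⟩, ?_⟩),
      T0, hT0, fun j => ?_⟩
    · simpa using h0
    · by_cases hj : j ∈ T0
      · rw [map_add, map_smul, hp j hj, smul_eq_mul, mul_one]
        have h1 : ⌈|S.X T0 j w|⌉₊ ≤ N0 :=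
          Finset.single_le_sum (f := fun j => ⌈|S.X T0 j w|⌉₊) (fun _ _ => Nat.zero_le _) hj
        have h2 : |S.X T0 j w| ≤ N := (Nat.le_ceil _).trans (Nat.cast_le.2 (h1.trans hN0.le))
        have := neg_abs_le (S.X T0 j w)
        linarith
      · rw [S.X_off T0 hT0 j hj, LinearMap.zero_apply]
  exact finiteProjective_of_shelling hreg hu hu' hq S.F subset_rfl fun _ _ T' hT' _ => hT'

end Shelling

end SFan
end EhrhartFan

namespace EhrhartFan
namespace SFan

variable {ι Q V : Type*} [AddCommGroup Q] [Module ℝ Q] [AddCommGroup V] [Module ℝ V]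
variable (S : SFan ι Q)

/-! ### Subdividing an edge -/

section Edge

variable [DecidableEq ι]

/-- The coordinates of the cone obtained by replacing the generator `b` by `α a + β b`, which gets
the index `k`. -/
noncomputable def halfCoord (x : ι → (Q →ₗ[ℝ] ℝ)) (a b : ι) (α β : ℝ) (k i : ι) : Q →ₗ[ℝ] ℝ :=
  if i = k then β⁻¹ • x b else if i = a then x a - (α / β) • x b else if i = b then 0 else x i

/-- The coordinates of a point after subdividing the edge `a b`, in terms of the coordinates
before. -/
noncomputable def edgeCoord (a b : ι) (α β : ℝ) (k : ι) (c : ι → ℝ) (i : ι) : ℝ :=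
  if i = k then min (c a / α) (c b / β) else if i = a then c a - α * min (c a / α) (c b / β)
  else if i = b then c b - β * min (c a / α) (c b / β) else c i

theorem edgeCoord_swap {a b : ι} (hab : a ≠ b) (α β : ℝ) (k : ι) (c : ι → ℝ) (i : ι) :
    edgeCoord b a β α k c i = edgeCoord a b α β k c i := by
  unfold edgeCoord
  rw [min_comm]
  split_ifs <;> first | rfl | (exfalso; subst_vars; exact hab rfl)

section Half

variable {S} {T : Finset ι} (hT : T ∈ S.F) {a b k : ι} (ha : a ∈ T) (hb : b ∈ T) (hab : a ≠ b)
  (hk : k ∉ T) {α β : ℝ} (hα : 0 < α) (hβ : 0 < β)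

include hT ha hab in
theorem halfCoord_off {i : ι} (hi : i ∉ insert k (T.erase b)) :
    halfCoord (S.X T) a b α β k i = 0 := by
  rw [Finset.mem_insert, Finset.mem_erase, not_or] at hi
  unfold halfCoord
  rw [if_neg hi.1]
  by_cases hib : i = b
  · rw [if_neg (by rintro rfl; exact hab hib), if_pos hib]
  · have hiT : i ∉ T := fun h => hi.2 ⟨hib, h⟩
    rw [S.X_off T hT i hiT, if_neg hib, if_neg (by rintro rfl; exact hiT ha)]

include hT ha hb hab hk hβ in
theorem halfCoord_self {i : ι} (hi : i ∈ insert k (T.erase b)) :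
    halfCoord (S.X T) a b α β k i
      (Function.update S.v k (α • S.v a + β • S.v b) i) = 1 := by
  rw [Finset.mem_insert, Finset.mem_erase] at hi
  unfold halfCoord
  by_cases hik : i = k
  · subst hik
    simp [S.X_of_ne hT ha hab.symm, S.X_self hT hb, hβ.ne']
  · obtain ⟨hib, hiT⟩ := hi.resolve_left hik
    rw [Function.update_of_ne hik, if_neg hik, if_neg hib]
    by_cases hia : i = a
    · subst hia
      simp [S.X_of_ne hT hiT hab.symm, S.X_self hT hiT]
    · rw [if_neg hia, S.X_self hT hiT]

include hT ha hb hab hk hβ in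
theorem halfCoord_of_ne {i j : ι} (hj : j ∈ insert k (T.erase b)) (hij : i ≠ j) :
    halfCoord (S.X T) a b α β k i
      (Function.update S.v k (α • S.v a + β • S.v b) j) = 0 := by
  rw [Finset.mem_insert, Finset.mem_erase] at hj
  unfold halfCoord
  by_cases hjk : j = k
  · subst hjk
    rw [if_neg hij, Function.update_self]
    by_cases hia : i = a
    · subst hia
      simp [S.X_of_ne hT ha hab.symm, S.X_of_ne hT hb hab, S.X_self hT hb, S.X_self hT ha, hβ.ne']
    · rw [if_neg hia]
      by_cases hib : i = b
      · simp [hib]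
      · simp [hib, S.X_of_ne hT ha hia, S.X_of_ne hT hb hib]
  · obtain ⟨hjb, hjT⟩ := hj.resolve_left hjk
    rw [Function.update_of_ne hjk]
    split_ifs with h1 h2 h3
    · simp [S.X_of_ne hT hjT (Ne.symm hjb)]
    · subst h2
      simp [S.X_of_ne hT hjT (Ne.symm hjb), S.X_of_ne hT hjT hij]
    · simp
    · exact S.X_of_ne hT hjT hij

include hT ha hb hab hk hβ in
theorem halfCoord_sum (x : Q) : ∑ i ∈ insert k (T.erase b), halfCoord (S.X T) a b α β k i x •
      Function.update S.v k (α • S.v a + β • S.v b) i = x := by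
  have hkb : k ∉ T.erase b := fun h => hk (Finset.mem_of_mem_erase h)
  have hka : k ≠ a := by rintro rfl; exact hk ha
  have hab' : a ∈ T.erase b := Finset.mem_erase.2 ⟨hab, ha⟩
  have hrest : ∀ i ∈ (T.erase b).erase a, halfCoord (S.X T) a b α β k i x •
      Function.update S.v k (α • S.v a + β • S.v b) i = S.X T i x • S.v i := fun i hi => by
    have hia := Finset.ne_of_mem_erase hi
    have hi' := Finset.mem_of_mem_erase hi
    have hik : i ≠ k := by rintro rfl; exact hkb hi'
    rw [Function.update_of_ne hik, halfCoord, if_neg hik, if_neg hia,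
      if_neg (Finset.ne_of_mem_erase hi')]
  rw [Finset.sum_insert hkb, ← Finset.add_sum_erase _ _ hab', Finset.sum_congr rfl hrest]
  conv_rhs => rw [← S.sum_X T hT x, ← Finset.add_sum_erase _ _ hb, ← Finset.add_sum_erase _ _ hab']
  rw [Function.update_self, Function.update_of_ne hka.symm, halfCoord, halfCoord, if_pos rfl,
    if_neg hka.symm, if_pos rfl, ← add_assoc, ← add_assoc]
  congr 1
  simp only [LinearMap.smul_apply, LinearMap.sub_apply, smul_eq_mul, smul_add, sub_smul, smul_smul]
  rw [show β⁻¹ * S.X T b x * α = α / β * S.X T b x by ring,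
    show β⁻¹ * S.X T b x * β = S.X T b x by field_simp]
  abel

-- The half cone is cut out of the cone by the wall through the new generator and the generators
-- other than a and b.
include hT ha hk hα hβ in
theorem halfCoord_nonneg_iff (x : Q) : (∀ i, 0 ≤ halfCoord (S.X T) a b α β k i x) ↔
    (∀ i, 0 ≤ S.X T i x) ∧ α * S.X T b x ≤ β * S.X T a x := by
  have hka : a ≠ k := by rintro rfl; exact hk ha
  have key : 0 ≤ S.X T a x - α / β * S.X T b x ↔ α * S.X T b x ≤ β * S.X T a x := by
    rw [sub_nonneg, div_mul_eq_mul_div, div_le_iff₀ hβ, mul_comm (S.X T a x)]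
  constructor
  · intro h
    have hb0 : 0 ≤ S.X T b x := by
      have := h k
      rw [halfCoord, if_pos rfl, LinearMap.smul_apply, smul_eq_mul] at this
      exact nonneg_of_mul_nonneg_right this (inv_pos.2 hβ)
    have ha0 := h a
    rw [halfCoord, if_neg hka, if_pos rfl] at ha0
    have ha1 : 0 ≤ S.X T a x - α / β * S.X T b x := by simpa using ha0
    refine ⟨fun i => ?_, key.1 ha1⟩
    by_cases hib : i = b
    · rwa [hib]
    by_cases hia : i = a
    · rw [hia]
      have : 0 ≤ α / β * S.X T b x := by positivity
      linarith
    by_cases hik : i = k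
    · rw [hik, S.X_off T hT k hk, LinearMap.zero_apply]
    · simpa [halfCoord, hia, hib, hik] using h i
  · rintro ⟨h, h'⟩ i
    unfold halfCoord
    split_ifs with h1 h2 h3
    · have := h b; rw [LinearMap.smul_apply, smul_eq_mul]; positivity
    · simpa using key.2 h'
    · simp
    · exact h i

theorem halfCoord_eq_edgeCoord (hα : 0 < α) (hβ : 0 < β) (x : Q)
    (h : α * S.X T b x ≤ β * S.X T a x) (i : ι) :
    halfCoord (S.X T) a b α β k i x = edgeCoord a b α β k (fun i => S.X T i x) i := by
  have hmin : min (S.X T a x / α) (S.X T b x / β) = S.X T b x / β := min_eq_right (by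
    rw [div_le_div_iff₀ hβ hα]; linarith)
  unfold halfCoord edgeCoord
  rw [hmin]
  split_ifs with h1 h2 h3
  · simp [div_eq_inv_mul]
  · simp; ring
  · simp; field_simp; simp
  · rfl

/-- In a cone missing a or b the minimum is zero, so the formula `edgeCoord` covers the cones that
are not split as well. -/
theorem edgeCoord_of_zero {c : ι → ℝ} (hα : 0 < α) (hβ : 0 < β) (hc : ∀ i, 0 ≤ c i) (hck : c k = 0)
    (h : c a = 0 ∨ c b = 0) (i : ι) : edgeCoord a b α β k c i = c i := by
  have hmin : min (c a / α) (c b / β) = 0 := by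
    rcases h with h | h
    · rw [h, zero_div]; exact min_eq_left (div_nonneg (hc b) hβ.le)
    · rw [h, zero_div]; exact min_eq_right (div_nonneg (hc a) hα.le)
  unfold edgeCoord
  rw [hmin]
  split_ifs with h1 h2 h3
  · rw [h1, hck]
  · rw [h2]; ring
  · rw [h3]; ring
  · rfl

end Half

/-- The data for subdividing an edge `a b` at the point `α a + β b`, with new index `k`. -/
structure EdgeData where
  a : ι
  b : ι
  k : ι
  α : ℝ
  β : ℝ
  hab : a ≠ b
  hα : 0 < α
  hβ : 0 < β
  hk : ∀ T ∈ S.F, k ∉ T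

variable {S} (e : S.EdgeData)

namespace EdgeData

/-- The maximal cones of the subdivision. -/
def newF : Finset (Finset ι) :=
  S.F.filter (fun T => ¬ (e.a ∈ T ∧ e.b ∈ T)) ∪
    ((S.F.filter fun T => e.a ∈ T ∧ e.b ∈ T).image (fun T => insert e.k (T.erase e.b)) ∪
      (S.F.filter fun T => e.a ∈ T ∧ e.b ∈ T).image (fun T => insert e.k (T.erase e.a)))

/-- The generators of the subdivision. -/
def newv : ι → Q := Function.update S.v e.k (e.α • S.v e.a + e.β • S.v e.b)

/-- The cone containing a cone of the subdivision. -/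
def orig (T : Finset ι) : Finset ι :=
  if e.k ∈ T then insert e.a (insert e.b (T.erase e.k)) else T

/-- The coordinates of the subdivision. -/
noncomputable def newX (T : Finset ι) : ι → (Q →ₗ[ℝ] ℝ) :=
  if e.k ∉ T then S.X T
  else if e.a ∈ T then halfCoord (S.X (e.orig T)) e.a e.b e.α e.β e.k
  else halfCoord (S.X (e.orig T)) e.b e.a e.β e.α e.k

theorem newv_of_mem {T : Finset ι} (hT : T ∈ S.F) {i : ι} (hi : i ∈ T) : e.newv i = S.v i :=
  Function.update_of_ne (by rintro rfl; exact e.hk T hT hi) _ _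

/-- The three types of cones of the subdivision. -/
theorem newF_cases {P : Finset ι → Prop} (h0 : ∀ T ∈ S.F, ¬ (e.a ∈ T ∧ e.b ∈ T) → P T)
    (h1 : ∀ T ∈ S.F, e.a ∈ T → e.b ∈ T → P (insert e.k (T.erase e.b)))
    (h2 : ∀ T ∈ S.F, e.a ∈ T → e.b ∈ T → P (insert e.k (T.erase e.a))) : ∀ T ∈ e.newF, P T := by
  intro T hT
  simp only [newF, Finset.mem_union, Finset.mem_filter, Finset.mem_image] at hT
  rcases hT with ⟨h, h'⟩ | ⟨T', ⟨h, h3, h4⟩, rfl⟩ | ⟨T', ⟨h, h3, h4⟩, rfl⟩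
  · exact h0 T h h'
  · exact h1 T' h h3 h4
  · exact h2 T' h h3 h4

theorem mem_newF_of_not {T : Finset ι} (hT : T ∈ S.F) (h : ¬ (e.a ∈ T ∧ e.b ∈ T)) :
    T ∈ e.newF := by
  exact Finset.mem_union_left _ (Finset.mem_filter.2 ⟨hT, h⟩)

theorem insert_mem_newF {T : Finset ι} (hT : T ∈ S.F) (ha : e.a ∈ T) (hb : e.b ∈ T) :
    insert e.k (T.erase e.b) ∈ e.newF := by
  refine Finset.mem_union_right _ (Finset.mem_union_left _ ?_)
  exact Finset.mem_image_of_mem _ (Finset.mem_filter.2 ⟨hT, ha, hb⟩)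

theorem insert_mem_newF' {T : Finset ι} (hT : T ∈ S.F) (ha : e.a ∈ T) (hb : e.b ∈ T) :
    insert e.k (T.erase e.a) ∈ e.newF := by
  refine Finset.mem_union_right _ (Finset.mem_union_right _ ?_)
  exact Finset.mem_image_of_mem _ (Finset.mem_filter.2 ⟨hT, ha, hb⟩)

theorem orig_of_mem {T : Finset ι} (hT : T ∈ S.F) : e.orig T = T := if_neg (e.hk T hT)

theorem orig_insert {T : Finset ι} (hT : T ∈ S.F) (ha : e.a ∈ T) (hb : e.b ∈ T) :
    e.orig (insert e.k (T.erase e.b)) = T := by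
  have hk := e.hk T hT
  rw [orig, if_pos (Finset.mem_insert_self _ _), Finset.erase_insert
    (fun h => hk (Finset.mem_of_mem_erase h)), Finset.insert_erase hb, Finset.insert_eq_of_mem ha]

theorem orig_insert' {T : Finset ι} (hT : T ∈ S.F) (ha : e.a ∈ T) (hb : e.b ∈ T) :
    e.orig (insert e.k (T.erase e.a)) = T := by
  have hk := e.hk T hT
  rw [orig, if_pos (Finset.mem_insert_self _ _), Finset.erase_insert
    (fun h => hk (Finset.mem_of_mem_erase h)), Finset.insert_comm, Finset.insert_erase ha,
    Finset.insert_eq_of_mem hb]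

theorem newX_of_mem {T : Finset ι} (hT : T ∈ S.F) : e.newX T = S.X T := if_pos (e.hk T hT)

theorem newX_insert {T : Finset ι} (hT : T ∈ S.F) (ha : e.a ∈ T) (hb : e.b ∈ T) :
    e.newX (insert e.k (T.erase e.b)) = halfCoord (S.X T) e.a e.b e.α e.β e.k := by
  rw [newX, if_neg (not_not.2 (Finset.mem_insert_self _ _)), if_pos (Finset.mem_insert_of_mem
    (Finset.mem_erase.2 ⟨e.hab, ha⟩)), e.orig_insert hT ha hb]

theorem newX_insert' {T : Finset ι} (hT : T ∈ S.F) (ha : e.a ∈ T) (hb : e.b ∈ T) :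
    e.newX (insert e.k (T.erase e.a)) = halfCoord (S.X T) e.b e.a e.β e.α e.k := by
  rw [newX, if_neg (not_not.2 (Finset.mem_insert_self _ _)), if_neg (fun h => ?_),
    e.orig_insert' hT ha hb]
  rcases Finset.mem_insert.1 h with h | h
  · exact e.hk T hT (h ▸ ha)
  · exact Finset.notMem_erase _ _ h

theorem orig_mem : ∀ T ∈ e.newF, e.orig T ∈ S.F :=
  e.newF_cases (fun T hT _ => by rwa [e.orig_of_mem hT])
    (fun T hT ha hb => by rwa [e.orig_insert hT ha hb])
    fun T hT ha hb => by rwa [e.orig_insert' hT ha hb]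

/-- The cones of the subdivision are contained in the original cones, and there is a uniform formula
for the new coordinates. -/
theorem newX_eq : ∀ T ∈ e.newF, ∀ x, (∀ i, 0 ≤ e.newX T i x) → (∀ i, 0 ≤ S.X (e.orig T) i x) ∧
    ∀ i, e.newX T i x = edgeCoord e.a e.b e.α e.β e.k (fun i => S.X (e.orig T) i x) i := by
  refine e.newF_cases (fun T hT h x hx => ?_) (fun T hT ha hb x hx => ?_)
    (fun T hT ha hb x hx => ?_)
  · rw [e.orig_of_mem hT]
    rw [e.newX_of_mem hT] at hx ⊢
    refine ⟨hx, fun i => (edgeCoord_of_zero e.hα e.hβ hx ?_ ?_ i).symm⟩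
    · rw [S.X_off T hT _ (e.hk T hT), LinearMap.zero_apply]
    · by_cases ha : e.a ∈ T
      · right; rw [S.X_off T hT _ (fun hb => h ⟨ha, hb⟩), LinearMap.zero_apply]
      · left; rw [S.X_off T hT _ ha, LinearMap.zero_apply]
  · rw [e.orig_insert hT ha hb]
    rw [e.newX_insert hT ha hb] at hx ⊢
    obtain ⟨h1, h2⟩ := (halfCoord_nonneg_iff hT ha (e.hk T hT) e.hα e.hβ x).1 hx
    exact ⟨h1, halfCoord_eq_edgeCoord e.hα e.hβ x h2⟩
  · rw [e.orig_insert' hT ha hb]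
    rw [e.newX_insert' hT ha hb] at hx ⊢
    obtain ⟨h1, h2⟩ := (halfCoord_nonneg_iff hT hb (e.hk T hT) e.hβ e.hα x).1 hx
    refine ⟨h1, fun i => ?_⟩
    rw [halfCoord_eq_edgeCoord e.hβ e.hα x h2, edgeCoord_swap e.hab]

theorem exists_newX_nonneg {T : Finset ι} (hT : T ∈ S.F) {x : Q} (hx : ∀ i, 0 ≤ S.X T i x) :
    ∃ T' ∈ e.newF, ∀ i, 0 ≤ e.newX T' i x := by
  by_cases h : e.a ∈ T ∧ e.b ∈ T
  · rcases le_total (e.α * S.X T e.b x) (e.β * S.X T e.a x) with h' | h'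
    · exact ⟨_, e.insert_mem_newF hT h.1 h.2, by
        rw [e.newX_insert hT h.1 h.2]
        exact (halfCoord_nonneg_iff hT h.1 (e.hk T hT) e.hα e.hβ x).2 ⟨hx, h'⟩⟩
    · exact ⟨_, e.insert_mem_newF' hT h.1 h.2, by
        rw [e.newX_insert' hT h.1 h.2]
        exact (halfCoord_nonneg_iff hT h.2 (e.hk T hT) e.hβ e.hα x).2 ⟨hx, h'⟩⟩
  · exact ⟨T, e.mem_newF_of_not hT h, by rwa [e.newX_of_mem hT]⟩

theorem newv_eq : e.newv = Function.update S.v e.k (e.β • S.v e.b + e.α • S.v e.a) := by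
  rw [newv, add_comm]

/-- The subdivision of a fan at a point of an edge. -/
noncomputable def subdivide : SFan ι Q where
  F := e.newF
  v := e.newv
  X := e.newX
  X_off := e.newF_cases (fun T hT _ i hi => by rw [e.newX_of_mem hT, S.X_off T hT i hi])
    (fun T hT ha hb i hi => by rw [e.newX_insert hT ha hb, halfCoord_off hT ha e.hab hi])
    (fun T hT ha hb i hi => by rw [e.newX_insert' hT ha hb, halfCoord_off hT hb e.hab.symm hi])
  X_self {T} hT {i} hi := by
    revert i
    suffices h : ∀ T ∈ e.newF, ∀ i ∈ T, e.newX T i (e.newv i) = 1 from fun {i} => h T hT i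
    refine e.newF_cases (fun T hT _ i hi => ?_) (fun T hT ha hb i hi => ?_)
      (fun T hT ha hb i hi => ?_)
    · rw [e.newX_of_mem hT, e.newv_of_mem hT hi, S.X_self hT hi]
    · rw [e.newX_insert hT ha hb]
      exact halfCoord_self hT ha hb e.hab (e.hk T hT) e.hβ hi
    · rw [e.newX_insert' hT ha hb, newv_eq]
      exact halfCoord_self hT hb ha e.hab.symm (e.hk T hT) e.hα hi
  X_of_ne {T} hT {i j} hj hij := by
    revert i j
    suffices h : ∀ T ∈ e.newF, ∀ i, ∀ j ∈ T, i ≠ j → e.newX T i (e.newv j) = 0 from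
      fun {i j} => h T hT i j
    refine e.newF_cases (fun T hT _ i j hj hij => ?_) (fun T hT ha hb i j hj hij => ?_)
      (fun T hT ha hb i j hj hij => ?_)
    · rw [e.newX_of_mem hT, e.newv_of_mem hT hj, S.X_of_ne hT hj hij]
    · rw [e.newX_insert hT ha hb]
      exact halfCoord_of_ne hT ha hb e.hab (e.hk T hT) e.hβ hj hij
    · rw [e.newX_insert' hT ha hb, newv_eq]
      exact halfCoord_of_ne hT hb ha e.hab.symm (e.hk T hT) e.hα hj hij
  sum_X := e.newF_cases
    (fun T hT _ x => by
      rw [e.newX_of_mem hT, Finset.sum_congr rfl fun i hi => by rw [e.newv_of_mem hT hi],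
        S.sum_X T hT])
    (fun T hT ha hb x => by
      rw [e.newX_insert hT ha hb]
      exact halfCoord_sum hT ha hb e.hab (e.hk T hT) e.hβ x)
    (fun T hT ha hb x => by
      rw [e.newX_insert' hT ha hb, newv_eq]
      exact halfCoord_sum hT hb ha e.hab.symm (e.hk T hT) e.hα x)
  glue T hT T' hT' x hx hx' i := by
    obtain ⟨h1, h2⟩ := e.newX_eq T hT x hx
    obtain ⟨h3, h4⟩ := e.newX_eq T' hT' x hx'
    -- The new coordinates are a function of the old ones, and those agree by gluing in `S`.
    rw [h2, h4]
    congr 1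
    exact funext (S.glue _ (e.orig_mem T hT) _ (e.orig_mem T' hT') x h1 h3)
  add T hT T' hT' x y hx hy := by
    obtain ⟨T'', hT'', h⟩ := S.add _ (e.orig_mem T hT) _ (e.orig_mem T' hT') x y
      (e.newX_eq T hT x hx).1 (e.newX_eq T' hT' y hy).1
    exact e.exists_newX_nonneg hT'' h

end EdgeData

end Edge
end SFan
end EhrhartFan

/-! ### Pullback and integration of piecewise polynomials along the subdivision of an edge. -/

namespace EhrhartFan
namespace SFan
namespace EdgeData

variable {ι Q V : Type*} [AddCommGroup Q] [Module ℝ Q] [AddCommGroup V] [Module ℝ V]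
variable [DecidableEq ι] {S : SFan ι Q} (e : S.EdgeData) {q : V →ₗ[ℝ] Q}

theorem mem_orig {T : Finset ι} {i : ι} (hi : i ∈ T) (hik : i ≠ e.k) : i ∈ e.orig T := by
  unfold orig
  split_ifs
  · simp [hi, hik]
  · exact hi

theorem span_subdivide_le (T T' : Finset ι) :
    e.subdivide.span T T' ≤ S.span (e.orig T) (e.orig T') := by
  refine Submodule.span_le.2 ?_
  rintro _ ⟨i, ⟨hi, hi'⟩, rfl⟩
  by_cases hik : i = e.k
  · subst hik
    have hi1 : e.k ∈ T := hi
    have hi2 : e.k ∈ T' := hi'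
    show e.newv e.k ∈ _
    rw [newv, Function.update_self]
    refine Submodule.add_mem _ (Submodule.smul_mem _ _ (Submodule.subset_span ⟨e.a, ?_, rfl⟩))
      (Submodule.smul_mem _ _ (Submodule.subset_span ⟨e.b, ?_, rfl⟩)) <;>
    simp [orig, hi1, hi2]
  · show e.newv i ∈ _
    rw [newv, Function.update_of_ne hik]
    exact Submodule.subset_span ⟨i, ⟨e.mem_orig hi hik, e.mem_orig hi' hik⟩, rfl⟩

theorem v_mem_span {T T' : Finset ι} {i : ι} (hik : i ≠ e.k) (hi : i ∈ T) (hi' : i ∈ T') :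
    S.v i ∈ e.subdivide.span T T' := by
  have : e.subdivide.v i = S.v i := Function.update_of_ne hik _ _
  rw [← this]
  exact Submodule.subset_span ⟨i, ⟨hi, hi'⟩, rfl⟩

omit [DecidableEq ι] in
theorem ne_k {T : Finset ι} (hT : T ∈ S.F) {i : ι} (hi : i ∈ T) : i ≠ e.k := by
  rintro rfl; exact e.hk T hT hi

/-- The removed generator b is a combination of the new generator and a, so the common span does not
shrink when passing to halves on the same side. -/
theorem span_le_of_mem {T T' T1 T1' : Finset ι} (hT : T ∈ S.F)
    (h : ∀ i ∈ T, i ∈ T' → i ≠ e.b → i ∈ T1 ∧ i ∈ T1') (hk : e.k ∈ T1) (hk' : e.k ∈ T1')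
    (ha : e.a ∈ T) (ha' : e.a ∈ T') :
    S.span T T' ≤ e.subdivide.span T1 T1' := by
  refine Submodule.span_le.2 ?_
  rintro _ ⟨i, ⟨hi, hi'⟩, rfl⟩
  by_cases hib : i = e.b
  · have hk1 : e.newv e.k ∈ e.subdivide.span T1 T1' := Submodule.subset_span ⟨e.k, ⟨hk, hk'⟩, rfl⟩
    obtain ⟨h1, h2⟩ := h e.a ha ha' e.hab
    have ha1 := e.v_mem_span (e.ne_k hT ha) h1 h2
    have : S.v e.b = e.β⁻¹ • (e.newv e.k - e.α • S.v e.a) := by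
      rw [newv, Function.update_self, add_sub_cancel_left, smul_smul, inv_mul_cancel₀ e.hβ.ne',
        one_smul]
    subst hib
    rw [SetLike.mem_coe, this]
    exact Submodule.smul_mem _ _ (Submodule.sub_mem _ hk1 (Submodule.smul_mem _ _ ha1))
  · obtain ⟨h1, h2⟩ := h i hi hi' hib
    exact e.v_mem_span (e.ne_k hT hi) h1 h2

theorem span_le_of_mem' {T T' T1 T1' : Finset ι} (hT : T ∈ S.F)
    (h : ∀ i ∈ T, i ∈ T' → i ≠ e.a → i ∈ T1 ∧ i ∈ T1') (hk : e.k ∈ T1) (hk' : e.k ∈ T1')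
    (hb : e.b ∈ T) (hb' : e.b ∈ T') :
    S.span T T' ≤ e.subdivide.span T1 T1' := by
  refine Submodule.span_le.2 ?_
  rintro _ ⟨i, ⟨hi, hi'⟩, rfl⟩
  by_cases hib : i = e.a
  · have hk1 : e.newv e.k ∈ e.subdivide.span T1 T1' := Submodule.subset_span ⟨e.k, ⟨hk, hk'⟩, rfl⟩
    obtain ⟨h1, h2⟩ := h e.b hb hb' e.hab.symm
    have hb1 := e.v_mem_span (e.ne_k hT hb) h1 h2
    have : S.v e.a = e.α⁻¹ • (e.newv e.k - e.β • S.v e.b) := by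
      rw [newv, Function.update_self, add_sub_cancel_right, smul_smul, inv_mul_cancel₀ e.hα.ne',
        one_smul]
    subst hib
    rw [SetLike.mem_coe, this]
    exact Submodule.smul_mem _ _ (Submodule.sub_mem _ hk1 (Submodule.smul_mem _ _ hb1))
  · obtain ⟨h1, h2⟩ := h i hi hi' hib
    exact e.v_mem_span (e.ne_k hT hi) h1 h2

/-- The functional separating the two halves of a subdivided cone. -/
noncomputable def sep (T : Finset ι) : Q →ₗ[ℝ] ℝ := e.β • S.X T e.a - e.α • S.X T e.b

omit [DecidableEq ι] in
theorem sep_a {T : Finset ι} (hT : T ∈ S.F) (ha : e.a ∈ T) : e.sep T (S.v e.a) = e.β := by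
  simp [sep, S.X_self hT ha, S.X_of_ne hT ha e.hab.symm]

omit [DecidableEq ι] in
theorem sep_ne_zero {T : Finset ι} (hT : T ∈ S.F) (ha : e.a ∈ T) : e.sep T ≠ 0 := fun h => by
  have := e.sep_a hT ha
  rw [h, LinearMap.zero_apply] at this
  exact e.hβ.ne this

/-- Restriction of piecewise polynomial functions to the subdivision. -/
theorem exists_pullback : ∃ φ : S.pwPoly q S.F →ₗ[PolyOn V] e.subdivide.pwPoly q e.newF,
    ∀ f, ∀ T ∈ e.newF, (φ f).1 T = f.1 (e.orig T) := by
  let Φ : (Finset ι → PolyOn V) →ₗ[PolyOn V] (Finset ι → PolyOn V) :=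
    LinearMap.pi fun T => if T ∈ e.newF then LinearMap.proj (e.orig T) else 0
  have h1 : ∀ f, ∀ T ∈ e.newF, Φ f T = f (e.orig T) := fun f T hT => by
    simp only [Φ, LinearMap.pi_apply, if_pos hT, LinearMap.proj_apply]
  have hmem : ∀ f : S.pwPoly q S.F, Φ f.1 ∈ e.subdivide.pwPoly q e.newF := fun f => by
    refine ⟨fun T hT => by simp [Φ, hT], fun T hT T' hT' y hy => ?_⟩
    rw [h1 _ T hT, h1 _ T' hT']
    exact f.2.2 _ (e.orig_mem T hT) _ (e.orig_mem T' hT') y (e.span_subdivide_le T T' hy)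
  exact ⟨LinearMap.codRestrict _ (Φ ∘ₗ (S.pwPoly q S.F).subtype) hmem, fun f T hT => h1 _ T hT⟩

variable (hq : Function.Surjective q)

-- The two halves share the wall on which `sep` vanishes, where f takes the same values.
include hq in
theorem exists_sub_eq {T : Finset ι} (hT : T ∈ S.F) (ha : e.a ∈ T) (hb : e.b ∈ T)
    (f : e.subdivide.pwPoly q e.newF) :
    ∃ g, f.1 (insert e.k (T.erase e.b)) - f.1 (insert e.k (T.erase e.a)) =
      PolyOn.lin (e.sep T ∘ₗ q) * g := by
  refine PolyOn.exists_eq_lin_mul (comp_ne_zero hq (e.sep_ne_zero hT ha)) _ fun y hy => ?_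
  have hm := e.insert_mem_newF hT ha hb
  rw [PolyOn.sub_apply, sub_eq_zero]
  refine f.2.2 _ hm _ (e.insert_mem_newF' hT ha hb) y (e.subdivide.mem_span_of hm fun i hi hi' => ?_)
  have hia : i = e.a := by
    simp only [Finset.mem_insert, Finset.mem_erase] at hi hi'
    tauto
  subst hia
  show e.newX _ _ _ = 0
  rw [e.newX_insert hT ha hb, halfCoord, if_neg (e.ne_k hT ha), if_pos rfl]
  have hy' : e.β * S.X T e.a (q y) - e.α * S.X T e.b (q y) = 0 := by simpa [sep] using hy
  have hβ := e.hβ.ne'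
  simp only [LinearMap.sub_apply, LinearMap.smul_apply, smul_eq_mul]
  field_simp
  linarith

include hq in
/-- Integration of piecewise polynomial functions along the subdivision. -/
theorem exists_pushforward : ∃ ρ : e.subdivide.pwPoly q e.newF →ₗ[PolyOn V] S.pwPoly q S.F,
    ∀ f, ∀ T ∈ S.F, (¬ (e.a ∈ T ∧ e.b ∈ T) → (ρ f).1 T = f.1 T) ∧
      (e.a ∈ T → e.b ∈ T → f.1 (insert e.k (T.erase e.b)) = f.1 (insert e.k (T.erase e.a)) →
        (ρ f).1 T = f.1 (insert e.k (T.erase e.b))) := by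
  -- Let f₁ and f₂ be the values on the halves containing a and b, and f₁ - f₂ = sep * g. The value
  -- f₁ + α X_b g is, off the wall, the quotient (β X_a f₁ - α X_b f₂) / (β X_a - α X_b). It equals
  -- f₁ where X_b = 0 and f₂ where X_a = 0, and it returns the common value when f₁ = f₂.
  have hex : ∀ T, ∃ ρ : e.subdivide.pwPoly q e.newF →ₗ[PolyOn V] PolyOn V, ∀ f,
      (T ∉ S.F → ρ f = 0) ∧ (T ∈ S.F → ¬ (e.a ∈ T ∧ e.b ∈ T) → ρ f = f.1 T) ∧
      (T ∈ S.F → e.a ∈ T → e.b ∈ T → ∃ g,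
        f.1 (insert e.k (T.erase e.b)) - f.1 (insert e.k (T.erase e.a)) =
          PolyOn.lin (e.sep T ∘ₗ q) * g ∧
        ρ f = f.1 (insert e.k (T.erase e.b)) + PolyOn.lin ((e.α • S.X T e.b) ∘ₗ q) * g) := by
    intro T
    by_cases hT : T ∈ S.F
    · by_cases h : e.a ∈ T ∧ e.b ∈ T
      · obtain ⟨ψ, hψ⟩ := exists_linearMap_div (PolyOn.lin (e.sep T ∘ₗ q))
          (fun _ _ => PolyOn.lin_mul_cancel (comp_ne_zero hq (e.sep_ne_zero hT h.1)))
          ((LinearMap.proj (R := PolyOn V) (φ := fun _ => PolyOn V) (insert e.k (T.erase e.b)) -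
            LinearMap.proj (insert e.k (T.erase e.a))).comp
              (e.subdivide.pwPoly q e.newF).subtype) (e.exists_sub_eq hq hT h.1 h.2)
        refine ⟨(LinearMap.proj (R := PolyOn V) (φ := fun _ => PolyOn V)
          (insert e.k (T.erase e.b))).comp (e.subdivide.pwPoly q e.newF).subtype +
          PolyOn.lin ((e.α • S.X T e.b) ∘ₗ q) • ψ, fun f => ⟨fun h' => absurd hT h',
          fun _ h' => absurd h h', fun _ _ _ => ⟨ψ f, hψ f, rfl⟩⟩⟩
      · exact ⟨(LinearMap.proj T).comp (e.subdivide.pwPoly q e.newF).subtype, fun f =>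
          ⟨fun h' => absurd hT h', fun _ _ => rfl, fun _ ha hb => absurd ⟨ha, hb⟩ h⟩⟩
    · exact ⟨0, fun f => ⟨fun _ => rfl, fun h => absurd h hT, fun h => absurd h hT⟩⟩
  choose ρ hρ using hex
  -- A split cone next to one that is not split: X_a or X_b vanishes on the common span, and the
  -- formula reduces to the value on a single half.
  have hmix : ∀ f, ∀ T ∈ S.F, ∀ T' ∈ S.F, e.a ∈ T → e.b ∈ T → ¬ (e.a ∈ T' ∧ e.b ∈ T') → ∀ y,
      q y ∈ S.span T T' → (ρ T f).1 y = (ρ T' f).1 y := by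
    intro f T hT T' hT' ha hb hn y hy
    obtain ⟨g, hg, hr⟩ := (hρ T f).2.2 hT ha hb
    rw [hr, (hρ T' f).2.1 hT' hn]
    have hT'm := e.mem_newF_of_not hT' hn
    have hgy : (f.1 (insert e.k (T.erase e.b))).1 y - (f.1 (insert e.k (T.erase e.a))).1 y =
        (e.β * S.X T e.a (q y) - e.α * S.X T e.b (q y)) * g.1 y :=
      congrArg (fun f => f.1 y) hg
    simp only [PolyOn.add_apply, PolyOn.mul_apply, PolyOn.lin_apply, LinearMap.comp_apply,
      LinearMap.smul_apply, smul_eq_mul]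
    by_cases hb' : e.b ∈ T'
    · have ha' : e.a ∉ T' := fun h => hn ⟨h, hb'⟩
      rw [S.X_eq_zero_of_span hT hy ha'] at hgy
      have : (f.1 (insert e.k (T.erase e.a))).1 y = (f.1 T').1 y := by
        refine f.2.2 _ (e.insert_mem_newF' hT ha hb) _ hT'm y
          ((Submodule.span_le.2 ?_ : S.span T T' ≤ _) hy)
        rintro _ ⟨i, ⟨hi, hi'⟩, rfl⟩
        refine e.v_mem_span (e.ne_k hT hi) (Finset.mem_insert_of_mem (Finset.mem_erase.2 ⟨?_, hi⟩))
          hi'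
        rintro rfl; exact ha' hi'
      rw [← this]
      linarith
    · rw [S.X_eq_zero_of_span hT hy hb', mul_zero, zero_mul, add_zero]
      refine f.2.2 _ (e.insert_mem_newF hT ha hb) _ hT'm y
          ((Submodule.span_le.2 ?_ : S.span T T' ≤ _) hy)
      rintro _ ⟨i, ⟨hi, hi'⟩, rfl⟩
      refine e.v_mem_span (e.ne_k hT hi) (Finset.mem_insert_of_mem (Finset.mem_erase.2 ⟨?_, hi⟩))
        hi'
      rintro rfl; exact hb' hi'
  have hmem : ∀ f, LinearMap.pi ρ f ∈ S.pwPoly q S.F := by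
    intro f
    refine ⟨fun T hT => (hρ T f).1 hT, fun T hT T' hT' y hy => ?_⟩
    simp only [LinearMap.pi_apply]
    by_cases h : e.a ∈ T ∧ e.b ∈ T <;> by_cases h' : e.a ∈ T' ∧ e.b ∈ T'
    · obtain ⟨g, hg, hr⟩ := (hρ T f).2.2 hT h.1 h.2
      obtain ⟨g', hg', hr'⟩ := (hρ T' f).2.2 hT' h'.1 h'.2
      have hf1 : ∀ z, q z ∈ S.span T T' → (f.1 (insert e.k (T.erase e.b))).1 z =
          (f.1 (insert e.k (T'.erase e.b))).1 z := fun z hz =>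
        f.2.2 _ (e.insert_mem_newF hT h.1 h.2) _ (e.insert_mem_newF hT' h'.1 h'.2) z
          (e.span_le_of_mem hT (fun i hi hi' hib => by simp [hi, hi', hib]) (by simp) (by simp)
            h.1 h'.1 hz)
      have hf2 : ∀ z, q z ∈ S.span T T' → (f.1 (insert e.k (T.erase e.a))).1 z =
          (f.1 (insert e.k (T'.erase e.a))).1 z := fun z hz =>
        f.2.2 _ (e.insert_mem_newF' hT h.1 h.2) _ (e.insert_mem_newF' hT' h'.1 h'.2) z
          (e.span_le_of_mem' hT (fun i hi hi' hib => by simp [hi, hi', hib]) (by simp) (by simp)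
            h.2 h'.2 hz)
      -- The quotients of two split cones are compared first off the wall, where `sep` can be
      -- cancelled.
      have hgg : ∀ z, q z ∈ S.span T T' → e.sep T (q z) ≠ 0 → (g - g').1 z = 0 := by
        intro z hz h0
        have h1 : (f.1 (insert e.k (T.erase e.b))).1 z - (f.1 (insert e.k (T.erase e.a))).1 z =
          e.sep T (q z) * g.1 z := congrArg (fun f => f.1 z) hg
        have h2 : (f.1 (insert e.k (T'.erase e.b))).1 z - (f.1 (insert e.k (T'.erase e.a))).1 z =
          e.sep T' (q z) * g'.1 z := congrArg (fun f => f.1 z) hg'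
        have h3 : e.sep T (q z) = e.sep T' (q z) := by
          simp [sep, S.X_eq_of_span hT hT' hz]
        rw [hf1 z hz, hf2 z hz, h2, ← h3] at h1
        rw [PolyOn.sub_apply, mul_left_cancel₀ h0 h1, sub_self]
      have hgy : g.1 y = g'.1 y := by
        rw [← sub_eq_zero, ← PolyOn.sub_apply]
        by_cases h0 : e.sep T (q y) = 0
        -- A point on the wall is left in the direction of a, which stays in the common span and
        -- changes `sep` at the rate β ≠ 0.
        · obtain ⟨p, hp⟩ := hq (S.v e.a)
          refine PolyOn.eq_zero_of_punctured _ y p fun t ht => hgg _ ?_ ?_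
          · rw [map_add, map_smul, hp]
            exact Submodule.add_mem _ hy (Submodule.smul_mem _ _
              (Submodule.subset_span ⟨e.a, ⟨h.1, h'.1⟩, rfl⟩))
          · rw [map_add, map_add, h0, zero_add, map_smul, map_smul, hp, e.sep_a hT h.1]
            exact mul_ne_zero ht e.hβ.ne'
        · exact hgg y hy h0
      rw [hr, hr']
      simp [hf1 y hy, hgy, S.X_eq_of_span hT hT' hy]
    · exact hmix f T hT T' hT' h.1 h.2 h' y hy
    · exact (hmix f T' hT' T hT h'.1 h'.2 h y (by rwa [S.span_comm])).symm
    · rw [(hρ T f).2.1 hT h, (hρ T' f).2.1 hT' h']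
      exact f.2.2 _ (e.mem_newF_of_not hT h) _ (e.mem_newF_of_not hT' h') y
        ((Submodule.span_le.2 (by
          rintro _ ⟨i, ⟨hi, hi'⟩, rfl⟩
          exact e.v_mem_span (e.ne_k hT hi) hi hi') : S.span T T' ≤ _) hy)
  refine ⟨LinearMap.codRestrict _ (LinearMap.pi ρ) hmem, fun f T hT =>
    ⟨fun h => (hρ T f).2.1 hT h, fun ha hb heq => ?_⟩⟩
  obtain ⟨g, hg, hr⟩ := (hρ T f).2.2 hT ha hb
  rw [heq, sub_self] at hg
  have hg0 : g = 0 := PolyOn.lin_mul_cancel (comp_ne_zero hq (e.sep_ne_zero hT ha))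
    (by rw [← hg, mul_zero])
  show ρ T f = _
  rw [hr, hg0, mul_zero, add_zero]

include hq in
/-- Projectivity descends along the subdivision of an edge. -/
theorem finiteProjective_of_subdivide
    (h : FiniteProjective (PolyOn V) (e.subdivide.pwPoly q e.newF)) :
    FiniteProjective (PolyOn V) (S.pwPoly q S.F) := by
  obtain ⟨φ, hφ⟩ := e.exists_pullback (q := q)
  obtain ⟨ρ, hρ⟩ := e.exists_pushforward hq
  refine FiniteProjective.of_retract h φ ρ fun f => Subtype.ext (funext fun T => ?_)
  by_cases hT : T ∈ S.F
  · obtain ⟨h1, h2⟩ := hρ (φ f) T hT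
    by_cases hab : e.a ∈ T ∧ e.b ∈ T
    · have h3 := hφ f _ (e.insert_mem_newF hT hab.1 hab.2)
      have h4 := hφ f _ (e.insert_mem_newF' hT hab.1 hab.2)
      rw [e.orig_insert hT hab.1 hab.2] at h3
      rw [e.orig_insert' hT hab.1 hab.2] at h4
      rw [h2 hab.1 hab.2 (h3.trans h4.symm), h3]
    · rw [h1 hab, hφ f _ (e.mem_newF_of_not hT hab), e.orig_of_mem hT]
  · rw [f.2.1 T hT, (ρ (φ f)).2.1 T hT]

end EdgeData
end SFan
end EhrhartFan

namespace EhrhartFan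
namespace SFan

variable {ι Q V : Type*} [AddCommGroup Q] [Module ℝ Q] [AddCommGroup V] [Module ℝ V]

open Filter Topology

/-! ### Regular subdivisions -/

/-- The point `x` lies in the cone `T`. -/
def InCone (S : SFan ι Q) (T : Finset ι) (x : Q) : Prop := ∀ i, 0 ≤ S.X T i x

/-- Cones meet in common faces: by gluing, the coordinates of x + y at generators outside T' vanish,
and being nonnegative so do those of x. -/
theorem inCone_of_add {S : SFan ι Q} {T T' : Finset ι} (hT : T ∈ S.F) (hT' : T' ∈ S.F) {x y : Q}
    (hx : S.InCone T x) (hy : S.InCone T y) (hxy : S.InCone T' (x + y)) : S.InCone T' x := by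
  have hg := S.glue T hT T' hT' (x + y)
    (fun i => by rw [map_add]; exact add_nonneg (hx i) (hy i)) hxy
  have hsp : x ∈ S.span T T' := S.mem_span_of hT fun i _ hi' => by
    have h1 := hg i
    rw [S.X_off T' hT' i hi', LinearMap.zero_apply, map_add] at h1
    linarith [hx i, hy i]
  intro i
  rw [← S.X_eq_of_span hT hT' hsp]
  exact hx i

/-- `S` subdivides `S₀`, and `δ` restricts to a strictly convex piecewise linear function on each
cone of `S₀`. -/
structure RelRegular (S₀ S : SFan ι Q) (δ : ι → ℝ) : Prop where
  refine : ∀ T ∈ S.F, ∃ T₀ ∈ S₀.F, ∀ j ∈ T, S₀.InCone T₀ (S.v j)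
  convex : ∀ T ∈ S.F, ∀ T' ∈ S.F, ∀ j ∈ T', j ∉ T → ∀ T₀ ∈ S₀.F,
    (∀ i ∈ T, S₀.InCone T₀ (S.v i)) → S₀.InCone T₀ (S.v j) →
    ∑ i ∈ T, δ i * S.X T i (S.v j) < δ j

/-- The convexity condition is empty: a maximal cone inside T₀ is T₀ itself, and a generator lying
in T₀ belongs to it. -/
theorem RelRegular.refl (S : SFan ι Q) : RelRegular S S 0 where
  refine T hT := ⟨T, hT, fun _ hj i => S.X_v_nonneg hT hj i⟩
  convex T hT T' hT' j hj hjT T₀ hT₀ h1 h2 := by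
    exfalso
    have key : ∀ T ∈ S.F, (∀ i ∈ T, S.InCone T₀ (S.v i)) → T = T₀ := fun T hT h =>
      S.eq_of_subset hT hT₀ fun i hi => by
        by_contra hi'
        have := S.glue T hT T₀ hT₀ (S.v i) (S.X_v_nonneg hT hi) (h i hi) i
        rw [S.X_self hT hi, S.X_off T₀ hT₀ i hi'] at this
        exact one_ne_zero this
    have hT1 := key T hT h1
    subst hT1
    have := S.glue T' hT' T hT₀ (S.v j) (S.X_v_nonneg hT' hj) h2 j
    rw [S.X_self hT' hj, S.X_off T hT₀ j hjT] at this
    exact one_ne_zero this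

theorem sum_height_eq [DecidableEq ι] (S : SFan ι Q) {T : Finset ι} (hT : T ∈ S.F) (h : ι → ℝ)
    {i : ι} (hi : i ∈ T) : ∑ j ∈ T, h j * S.X T j (S.v i) = h i := by
  rw [Finset.sum_eq_single_of_mem i hi, S.X_self hT hi, mul_one]
  exact fun j _ hj => by rw [S.X_of_ne hT hi hj, mul_zero]

variable [DecidableEq ι] {S₀ S : SFan ι Q} {δ : ι → ℝ}

theorem EdgeData.orig_v {e : S.EdgeData} {T : Finset ι} {i : ι} (hi : i ∈ T) (hik : i ≠ e.k) :
    i ∈ e.orig T ∧ e.newv i = S.v i :=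
  ⟨e.mem_orig hi hik, Function.update_of_ne hik _ _⟩

/-- The heights on a subdivided half of a cone. -/
theorem EdgeData.sum_half (e : S.EdgeData) {T T' : Finset ι} (hT : T ∈ S.F) (hT' : T' ∈ e.newF)
    (ha : e.a ∈ T) (hb : e.b ∈ T) {c : ι} (hTT : T' = insert e.k (T.erase c)) (ε γ : ℝ)
    (hγ : S.X T c (e.newv e.k) = γ) (hγ0 : 0 < γ) (x : Q) :
    ∑ i ∈ T', Function.update δ e.k (e.α * δ e.a + e.β * δ e.b - ε) i * e.newX T' i x =
      ∑ i ∈ T, δ i * S.X T i x - ε / γ * S.X T c x := by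
  -- Both sides are linear in x, so it suffices to compare them on the generators of the half cone.
  have h := e.subdivide.functional_eq hT' (∑ i ∈ T, δ i • S.X T i - (ε / γ) • S.X T c) x
  simp only [LinearMap.sub_apply, LinearMap.sum_apply, LinearMap.smul_apply, smul_eq_mul] at h
  rw [h]
  refine Finset.sum_congr rfl fun i hi => ?_
  rw [mul_comm]
  show e.newX T' i x * _ = e.newX T' i x * (_ - _ * S.X T c (e.newv i))
  congr 1
  by_cases hik : i = e.k
  · subst hik
    rw [Function.update_self, hγ, div_mul_cancel₀ _ hγ0.ne']
    congr 1
    show _ = ∑ i ∈ T, δ i * S.X T i (e.newv e.k)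
    have hn : e.newv e.k = e.α • S.v e.a + e.β • S.v e.b := Function.update_self _ _ _
    have h1 := S.sum_height_eq hT δ ha
    have h2 := S.sum_height_eq hT δ hb
    rw [← h1, ← h2, hn, Finset.mul_sum, Finset.mul_sum, ← Finset.sum_add_distrib]
    refine Finset.sum_congr rfl fun i _ => ?_
    simp only [map_add, map_smul, smul_eq_mul]
    ring
  · have hv : e.newv i = S.v i := Function.update_of_ne hik _ _
    have hi' : i ≠ c ∧ i ∈ T := by
      rw [hTT, Finset.mem_insert, Finset.mem_erase] at hi
      exact hi.resolve_left hik
    rw [Function.update_of_ne hik]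
    show δ i = ∑ l ∈ T, δ l * S.X T l (e.newv i) - _
    rw [hv, S.sum_height_eq hT δ hi'.2, S.X_of_ne hT hi'.2 hi'.1.symm, mul_zero, sub_zero]

/-- The new vertex gets the height obtained by interpolating along the edge, lowered by a small ε >
0. Old strict inequalities survive because they are finitely many open conditions, and lowering
makes the inequalities between the two halves of a cone strict. -/
theorem RelRegular.subdivide (h : RelRegular S₀ S δ) (e : S.EdgeData) {U : Finset ι}
    (hU : U ∈ S.F) (haU : e.a ∈ U) (hbU : e.b ∈ U) : ∃ δ', RelRegular S₀ e.subdivide δ' := by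
  have hnk : e.newv e.k = e.α • S.v e.a + e.β • S.v e.b := Function.update_self _ _ _
  obtain ⟨U₀, hU₀, hUU⟩ := h.refine U hU
  have hsm : ∀ {T₀ : Finset ι} {x : Q} {t : ℝ}, 0 < t → S₀.InCone T₀ (t • x) → S₀.InCone T₀ x :=
    fun {T₀ x t} ht hx i => by
      have := hx i
      rw [map_smul, smul_eq_mul] at this
      exact nonneg_of_mul_nonneg_right this ht
  have hsm' : ∀ {T₀ : Finset ι} {x : Q} {t : ℝ}, 0 < t → S₀.InCone T₀ x → S₀.InCone T₀ (t • x) :=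
    fun {T₀ x t} ht hx i => by
      rw [map_smul, smul_eq_mul]
      exact mul_nonneg ht.le (hx i)
  -- As a and b lie in one cone of `S₀`, every cone of `S₀` containing the new vertex contains both
  -- of them.
  have hend : ∀ T₀ ∈ S₀.F, S₀.InCone T₀ (e.newv e.k) →
      S₀.InCone T₀ (S.v e.a) ∧ S₀.InCone T₀ (S.v e.b) := fun T₀ hT₀ hk => by
    rw [hnk] at hk
    have ha := hsm' e.hα (hUU e.a haU)
    have hb := hsm' e.hβ (hUU e.b hbU)
    exact ⟨hsm e.hα (inCone_of_add hU₀ hT₀ ha hb hk),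
      hsm e.hβ (inCone_of_add hU₀ hT₀ hb ha (by rwa [add_comm]))⟩
  let δ' : ℝ → ι → ℝ := fun ε => Function.update δ e.k (e.α * δ e.a + e.β * δ e.b - ε)
  have hhalf : ∀ T ∈ S.F, e.a ∈ T → e.b ∈ T → ∀ c, (c = e.a ∨ c = e.b) →
      insert e.k (T.erase c) ∈ e.newF → ∀ T' ∈ e.newF, ∀ j ∈ T', j ∉ insert e.k (T.erase c) →
      ∀ T₀ ∈ S₀.F, (∀ i ∈ insert e.k (T.erase c), S₀.InCone T₀ (e.newv i)) →
      S₀.InCone T₀ (e.newv j) → ∀ᶠ ε in 𝓝[>] (0 : ℝ),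
      ∑ i ∈ insert e.k (T.erase c), δ' ε i * e.newX (insert e.k (T.erase c)) i (e.newv j) <
        δ' ε j := by
    intro T hT ha hb c hc hTc T' hT' j hj hjT T₀ hT₀ hin hjn
    have hjk : j ≠ e.k := fun hjk => hjT (hjk ▸ Finset.mem_insert_self _ _)
    obtain ⟨hj', hvj⟩ := EdgeData.orig_v hj hjk
    obtain ⟨γ, hγ0, hγ⟩ : ∃ γ, 0 < γ ∧ S.X T c (e.newv e.k) = γ := by
      rcases hc with rfl | rfl
      · exact ⟨e.α, e.hα, by simp [hnk, S.X_self hT ha, S.X_of_ne hT hb e.hab]⟩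
      · exact ⟨e.β, e.hβ, by simp [hnk, S.X_self hT hb, S.X_of_ne hT ha e.hab.symm]⟩
    have hcT : c ∈ T := by rcases hc with rfl | rfl <;> assumption
    have hsum := fun ε => e.sum_half (δ := δ) hT hTc ha hb rfl ε γ hγ hγ0 (S.v j)
    simp only [δ', hvj, Function.update_of_ne hjk, hsum]
    -- At the removed generator c the inequality is won by the amount ε / γ. Any other j was outside
    -- T before, and the old inequality persists for small ε.
    by_cases hjc : j = c
    · subst hjc
      filter_upwards [self_mem_nhdsWithin] with ε hε
      rw [S.sum_height_eq hT δ hcT, S.X_self hT hcT, mul_one]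
      have : 0 < ε / γ := div_pos hε hγ0
      linarith
    · have hjT' : j ∉ T := fun h' =>
        hjT (Finset.mem_insert_of_mem (Finset.mem_erase.2 ⟨hjc, h'⟩))
      obtain ⟨hina, hinb⟩ := hend T₀ hT₀ (hin e.k (Finset.mem_insert_self _ _))
      have hlt := h.convex T hT _ (e.orig_mem T' hT') j hj' hjT' T₀ hT₀ (fun i hi => by
        by_cases hic : i = c
        · rcases hc with rfl | rfl
          · rwa [hic]
          · rwa [hic]
        · have := hin i (Finset.mem_insert_of_mem (Finset.mem_erase.2 ⟨hic, hi⟩))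
          rwa [e.newv_of_mem hT hi] at this) (by rwa [hvj] at hjn)
      have hcont : Tendsto (fun ε : ℝ => ∑ i ∈ T, δ i * S.X T i (S.v j) - ε / γ * S.X T c (S.v j))
          (𝓝[>] 0) (𝓝 (∑ i ∈ T, δ i * S.X T i (S.v j) - 0 / γ * S.X T c (S.v j))) := by
        refine Tendsto.mono_left (Continuous.tendsto ?_ 0) nhdsWithin_le_nhds
        fun_prop
      rw [zero_div, zero_mul, sub_zero] at hcont
      exact hcont.eventually_lt_const hlt
  have hall : ∀ T ∈ e.newF, ∀ T' ∈ e.newF, ∀ j ∈ T', j ∉ T → ∀ T₀ ∈ S₀.F,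
      (∀ i ∈ T, S₀.InCone T₀ (e.newv i)) → S₀.InCone T₀ (e.newv j) →
      ∀ᶠ ε in 𝓝[>] (0 : ℝ), ∑ i ∈ T, δ' ε i * e.newX T i (e.newv j) < δ' ε j := by
    refine e.newF_cases (fun T hT hn T' hT' j hj hjT T₀ hT₀ hin hjn => ?_)
      (fun T hT ha hb => hhalf T hT ha hb _ (Or.inr rfl) (e.insert_mem_newF hT ha hb))
      (fun T hT ha hb => hhalf T hT ha hb _ (Or.inl rfl) (e.insert_mem_newF' hT ha hb))
    rw [e.newX_of_mem hT]
    have hsum : ∀ ε, ∑ i ∈ T, δ' ε i * S.X T i (e.newv j) = ∑ i ∈ T, δ i * S.X T i (e.newv j) :=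
      fun ε => Finset.sum_congr rfl fun i hi => by
        simp only [δ', Function.update_of_ne (e.ne_k hT hi)]
    simp only [hsum]
    have hin' : ∀ i ∈ T, S₀.InCone T₀ (S.v i) := fun i hi => by
      rw [← e.newv_of_mem hT hi]; exact hin i hi
    by_cases hjk : j = e.k
    · subst hjk
      obtain ⟨hina, hinb⟩ := hend T₀ hT₀ hjn
      have hle : ∀ l ∈ U, S₀.InCone T₀ (S.v l) → ∑ i ∈ T, δ i * S.X T i (S.v l) ≤ δ l ∧
          (l ∉ T → ∑ i ∈ T, δ i * S.X T i (S.v l) < δ l) := fun l hl hlin => by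
        by_cases hlT : l ∈ T
        · exact ⟨(S.sum_height_eq hT δ hlT).le, fun h' => absurd hlT h'⟩
        · have := h.convex T hT U hU l hl hlT T₀ hT₀ hin' hlin
          exact ⟨this.le, fun _ => this⟩
      obtain ⟨ha1, ha2⟩ := hle e.a haU hina
      obtain ⟨hb1, hb2⟩ := hle e.b hbU hinb
      have hα := e.hα
      have hβ := e.hβ
      -- A cone that is not split misses a or b, so one of the two inequalities at the end points is
      -- strict.
      have hlt : ∑ i ∈ T, δ i * S.X T i (e.newv e.k) < e.α * δ e.a + e.β * δ e.b := by
        have heq : ∑ i ∈ T, δ i * S.X T i (e.newv e.k) =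
            e.α * ∑ i ∈ T, δ i * S.X T i (S.v e.a) + e.β * ∑ i ∈ T, δ i * S.X T i (S.v e.b) := by
          rw [Finset.mul_sum, Finset.mul_sum, ← Finset.sum_add_distrib, hnk]
          refine Finset.sum_congr rfl fun i _ => ?_
          simp only [map_add, map_smul, smul_eq_mul]
          ring
        rw [heq]
        by_cases haT : e.a ∈ T
        · have := mul_lt_mul_of_pos_left (hb2 fun hbT => hn ⟨haT, hbT⟩) hβ
          have := mul_le_mul_of_nonneg_left ha1 hα.le
          linarith
        · have := mul_lt_mul_of_pos_left (ha2 haT) hα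
          have := mul_le_mul_of_nonneg_left hb1 hβ.le
          linarith
      have hcont : Tendsto (fun ε : ℝ => e.α * δ e.a + e.β * δ e.b - ε) (𝓝[>] 0)
          (𝓝 (e.α * δ e.a + e.β * δ e.b - 0)) := by
        refine Tendsto.mono_left (Continuous.tendsto ?_ 0) nhdsWithin_le_nhds
        fun_prop
      rw [sub_zero] at hcont
      simp only [δ', Function.update_self]
      exact hcont.eventually_const_lt hlt
    · obtain ⟨hj', hvj⟩ := EdgeData.orig_v hj hjk
      refine Eventually.of_forall fun ε => ?_
      simp only [δ', Function.update_of_ne hjk]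
      rw [hvj] at hjn ⊢
      exact h.convex T hT _ (e.orig_mem T' hT') j hj' hjT T₀ hT₀ hin' hjn
  have hev : ∀ᶠ ε in 𝓝[>] (0 : ℝ), ∀ T ∈ e.newF, ∀ T' ∈ e.newF, ∀ j ∈ T', ∀ T₀ ∈ S₀.F, j ∉ T →
      (∀ i ∈ T, S₀.InCone T₀ (e.newv i)) → S₀.InCone T₀ (e.newv j) →
      ∑ i ∈ T, δ' ε i * e.newX T i (e.newv j) < δ' ε j := by
    simp only [Filter.eventually_all_finset]
    intro T hT T' hT' j hj T₀ hT₀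
    simp only [Filter.eventually_imp_distrib_left]
    exact fun hjT => hall T hT T' hT' j hj hjT T₀ hT₀
  obtain ⟨ε, hε⟩ := hev.exists
  refine ⟨δ' ε, ⟨fun T hT => ?_, fun T hT T' hT' j hj hjT T₀ hT₀ =>
    hε T hT T' hT' j hj T₀ hT₀ hjT⟩⟩
  obtain ⟨T₀, hT₀, hsub⟩ := h.refine _ (e.orig_mem T hT)
  refine ⟨T₀, hT₀, fun j hj => ?_⟩
  show S₀.InCone T₀ (e.newv j)
  by_cases hjk : j = e.k
  · subst hjk
    have ha : e.a ∈ e.orig T := by simp [EdgeData.orig, hj]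
    have hb : e.b ∈ e.orig T := by simp [EdgeData.orig, hj]
    intro i
    rw [hnk, map_add]
    exact add_nonneg (hsm' e.hα (hsub _ ha) i) (hsm' e.hβ (hsub _ hb) i)
  · obtain ⟨hj', hvj⟩ := EdgeData.orig_v hj hjk
    rw [hvj]
    exact hsub j hj'

end SFan
end EhrhartFan

/-! ### Removing crossings with hyperplanes, and regularity of the resulting fan. -/

namespace EhrhartFan
namespace SFan

variable {ι Q V : Type*} [AddCommGroup Q] [Module ℝ Q] [AddCommGroup V] [Module ℝ V]

open Filter Topology

/-- No cone of the fan has generators strictly on both sides of the hyperplane `H = 0`. -/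
def NoCrossing (S : SFan ι Q) (H : Q →ₗ[ℝ] ℝ) : Prop :=
  ∀ T ∈ S.F, (∀ i ∈ T, 0 ≤ H (S.v i)) ∨ ∀ i ∈ T, H (S.v i) ≤ 0

variable [DecidableEq ι] {S₀ S : SFan ι Q} {δ : ι → ℝ}

theorem NoCrossing.subdivide {H : Q →ₗ[ℝ] ℝ} (h : S.NoCrossing H) (e : S.EdgeData) :
    e.subdivide.NoCrossing H := by
  intro T hT
  have key : ∀ P : ℝ → Prop, (∀ x y, P x → P y → P (e.α * x + e.β * y)) →
      (∀ i ∈ e.orig T, P (H (S.v i))) → ∀ i ∈ T, P (H (e.newv i)) := by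
    intro P hP hall i hi
    by_cases hik : i = e.k
    · subst hik
      have ha : e.a ∈ e.orig T := by simp [EdgeData.orig, hi]
      have hb : e.b ∈ e.orig T := by simp [EdgeData.orig, hi]
      have hnk : e.newv e.k = e.α • S.v e.a + e.β • S.v e.b := Function.update_self _ _ _
      rw [hnk]
      simpa using hP _ _ (hall _ ha) (hall _ hb)
    · obtain ⟨hi', hv⟩ := EdgeData.orig_v hi hik
      rw [hv]
      exact hall i hi'
  have hα := e.hα
  have hβ := e.hβ
  rcases h _ (e.orig_mem T hT) with h' | h'
  · exact Or.inl (key (fun x => 0 ≤ x) (fun x y hx hy => by positivity) h')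
  · exact Or.inr (key (fun x => x ≤ 0) (fun x y hx hy => by
      have h1 := mul_nonneg hα.le (neg_nonneg.2 hx)
      have h2 := mul_nonneg hβ.le (neg_nonneg.2 hy)
      linarith) h')

open scoped Classical in
/-- The pairs of generators of a common cone on different sides of a hyperplane. -/
noncomputable def crossing (S : SFan ι Q) (H : Q →ₗ[ℝ] ℝ) : Finset (ι × ι) :=
  ((S.F.biUnion id) ×ˢ (S.F.biUnion id)).filter fun p =>
    (∃ T ∈ S.F, p.1 ∈ T ∧ p.2 ∈ T) ∧ 0 < H (S.v p.1) ∧ H (S.v p.2) < 0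

theorem mem_crossing {H : Q →ₗ[ℝ] ℝ} {p : ι × ι} : p ∈ S.crossing H ↔
    (∃ T ∈ S.F, p.1 ∈ T ∧ p.2 ∈ T) ∧ 0 < H (S.v p.1) ∧ H (S.v p.2) < 0 := by
  simp only [crossing, Finset.mem_filter, Finset.mem_product, Finset.mem_biUnion, id]
  exact ⟨fun h => h.2, fun h => ⟨⟨⟨h.1.choose, h.1.choose_spec.1, h.1.choose_spec.2.1⟩,
    ⟨h.1.choose, h.1.choose_spec.1, h.1.choose_spec.2.2⟩⟩, h⟩⟩

variable {q : V →ₗ[ℝ] Q} (hq : Function.Surjective q) (hι : Nontrivial Q → Infinite ι)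

-- Each crossing pair spanning an edge is separated by subdividing that edge where it meets the
-- hyperplane. This lowers the number of crossing pairs, keeps relative regularity and earlier
-- non-crossing, and lets projectivity descend. An infinite index set supplies new names for
-- vertices.
include hq hι in
theorem exists_noCrossing (H : Q →ₗ[ℝ] ℝ) (L : Set (Q →ₗ[ℝ] ℝ)) (h : RelRegular S₀ S δ)
    (hL : ∀ H' ∈ L, S.NoCrossing H') : ∃ (S' : SFan ι Q) (δ' : ι → ℝ), RelRegular S₀ S' δ' ∧
      (∀ H' ∈ L, S'.NoCrossing H') ∧ S'.NoCrossing H ∧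
      (FiniteProjective (PolyOn V) (S'.pwPoly q S'.F) →
        FiniteProjective (PolyOn V) (S.pwPoly q S.F)) := by
  induction hn : (S.crossing H).card using Nat.strong_induction_on generalizing S δ with
  | _ n ih =>
  by_cases hc : S.NoCrossing H
  · exact ⟨S, δ, h, hL, hc, id⟩
  unfold NoCrossing at hc
  push Not at hc
  obtain ⟨T, hT, ⟨b, hb, hbH⟩, a, ha, haH⟩ := hc
  have : Infinite ι := hι ⟨S.v a, 0, by rintro h0; simp [h0] at haH⟩
  obtain ⟨k, hk⟩ := Infinite.exists_notMem_finset (S.F.biUnion id)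
  -- The weights are chosen such that H vanishes at the new vertex.
  let e : S.EdgeData :=
    { a := a, b := b, k := k, α := -H (S.v b), β := H (S.v a)
      hab := by rintro rfl; linarith
      hα := by linarith
      hβ := haH
      hk := fun T hT hkT => hk (Finset.mem_biUnion.2 ⟨T, hT, hkT⟩) }
  obtain ⟨δ', h'⟩ := h.subdivide e hT ha hb
  have hnk : H (e.newv k) = 0 := by
    have : e.newv k = e.α • S.v e.a + e.β • S.v e.b := Function.update_self _ _ _
    rw [this]
    simp only [map_add, map_smul, smul_eq_mul, e]
    ring
  have hlt : (e.subdivide.crossing H).card < n := by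
    rw [← hn]
    -- The new vertex, lying on H = 0, occurs in no crossing pair, and no cone of the subdivision
    -- contains both a and b.
    refine Finset.card_lt_card ⟨fun p hp => ?_, fun hsub => ?_⟩
    · obtain ⟨⟨T', hT', h1, h2⟩, h3, h4⟩ := mem_crossing.1 hp
      have hv : ∀ i, i ∈ T' → H (e.newv i) ≠ 0 → i ∈ e.orig T' ∧ e.newv i = S.v i :=
        fun i hi h0 => EdgeData.orig_v hi (by rintro rfl; exact h0 hnk)
      obtain ⟨h5, h6⟩ := hv _ h1 h3.ne'
      obtain ⟨h7, h8⟩ := hv _ h2 h4.ne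
      exact mem_crossing.2 ⟨⟨_, e.orig_mem T' hT', h5, h7⟩, by rw [← h6]; exact h3,
        by rw [← h8]; exact h4⟩
    · have hmem := hsub (mem_crossing.2 ⟨⟨T, hT, ha, hb⟩, haH, hbH⟩ : (a, b) ∈ S.crossing H)
      obtain ⟨⟨T', hT', h1, h2⟩, -, -⟩ := mem_crossing.1 hmem
      revert h1 h2
      refine e.newF_cases (P := fun T' => a ∈ T' → b ∈ T' → False) (fun T' _ h => fun h1 h2 =>
        h ⟨h1, h2⟩) (fun T' hT' _ _ _ h2 => ?_) (fun T' hT' _ _ h1 _ => ?_) T' hT'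
      · rcases Finset.mem_insert.1 h2 with h2 | h2
        · exact e.ne_k hT hb h2
        · exact Finset.notMem_erase _ _ h2
      · rcases Finset.mem_insert.1 h1 with h2 | h2
        · exact e.ne_k hT ha h2
        · exact Finset.notMem_erase _ _ h2
  obtain ⟨S', δ'', h1, h2, h3, h4⟩ := ih _ hlt h' (fun H' hH' => (hL H' hH').subdivide e) rfl
  exact ⟨S', δ'', h1, h2, h3, fun h5 => e.finiteProjective_of_subdivide hq (h4 h5)⟩

include hq hι in
theorem exists_noCrossing_finset (L : Finset (Q →ₗ[ℝ] ℝ)) :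
    ∃ (S' : SFan ι Q) (δ' : ι → ℝ), RelRegular S S' δ' ∧
      (∀ H' ∈ L, S'.NoCrossing H') ∧
      (FiniteProjective (PolyOn V) (S'.pwPoly q S'.F) →
        FiniteProjective (PolyOn V) (S.pwPoly q S.F)) := by
  classical
  induction L using Finset.induction_on with
  | empty => exact ⟨S, 0, RelRegular.refl S, by simp, id⟩
  | insert H L _ ih =>
    obtain ⟨S', δ', h1, h2, h3⟩ := ih
    obtain ⟨S'', δ'', h4, h5, h6, h7⟩ := exists_noCrossing hq hι H L h1 h2
    refine ⟨S'', δ'', h4, fun H' hH' => ?_, h3 ∘ h7⟩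
    rcases Finset.mem_insert.1 hH' with rfl | hH'
    · exact h6
    · exact h5 H' hH'

-- On a cone that H does not cross, |H| is linear, equal to H or to -H; either of these is at most
-- |H| everywhere.
omit [DecidableEq ι] in
theorem NoCrossing.sum_abs {H : Q →ₗ[ℝ] ℝ} (h : S.NoCrossing H) {T : Finset ι} (hT : T ∈ S.F)
    (x : Q) : ∑ i ∈ T, |H (S.v i)| * S.X T i x ≤ |H x| ∧
      ((∀ i ∈ T, 0 ≤ H (S.v i)) → ∑ i ∈ T, |H (S.v i)| * S.X T i x = H x) := by
  have hpos : (∀ i ∈ T, 0 ≤ H (S.v i)) → ∑ i ∈ T, |H (S.v i)| * S.X T i x = H x := fun h' => by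
    rw [S.functional_eq hT H x]
    exact Finset.sum_congr rfl fun i hi => by rw [abs_of_nonneg (h' i hi), mul_comm]
  refine ⟨?_, hpos⟩
  rcases h T hT with h' | h'
  · rw [hpos h']
    exact le_abs_self _
  · refine le_trans (le_of_eq ?_) (neg_le_abs _)
    rw [S.functional_eq hT H x, ← Finset.sum_neg_distrib]
    exact Finset.sum_congr rfl fun i hi => by rw [abs_of_nonpos (h' i hi)]; ring

/-- A subdivision in which no cone crosses the facet hyperplanes of the original fan is regular. -/
theorem RelRegular.exists_isRegular (h : RelRegular S₀ S δ)
    (hH : ∀ T ∈ S₀.F, ∀ i ∈ T, S.NoCrossing (S₀.X T i)) : ∃ h, S.IsRegular h := by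
  -- ψ is convex and linear on every cone of `S`. Its convexity is strict except towards generators
  -- in a common cone of `S₀`, where δ is strictly convex; so N ψ + δ works for large N.
  let ψ : Q → ℝ := fun x => ∑ T₀ ∈ S₀.F, ∑ i ∈ T₀, |S₀.X T₀ i x|
  have hdic : ∀ T ∈ S.F, ∀ T' ∈ S.F, ∀ j ∈ T', j ∉ T →
      ∑ i ∈ T, ψ (S.v i) * S.X T i (S.v j) ≤ ψ (S.v j) ∧
      (∑ i ∈ T, ψ (S.v i) * S.X T i (S.v j) < ψ (S.v j) ∨
        ∑ i ∈ T, δ i * S.X T i (S.v j) < δ j) := by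
    intro T hT T' hT' j hj hjT
    have hswap : ∑ i ∈ T, ψ (S.v i) * S.X T i (S.v j) = ∑ T₀ ∈ S₀.F, ∑ l ∈ T₀,
        ∑ i ∈ T, |S₀.X T₀ l (S.v i)| * S.X T i (S.v j) := by
      simp only [ψ, Finset.sum_mul]
      rw [Finset.sum_comm]
      exact Finset.sum_congr rfl fun T₀ _ => Finset.sum_comm
    have hle : ∀ T₀ ∈ S₀.F, ∀ l ∈ T₀,
        ∑ i ∈ T, |S₀.X T₀ l (S.v i)| * S.X T i (S.v j) ≤ |S₀.X T₀ l (S.v j)| :=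
      fun T₀ hT₀ l hl => ((hH T₀ hT₀ l hl).sum_abs hT (S.v j)).1
    have hle' : ∑ i ∈ T, ψ (S.v i) * S.X T i (S.v j) ≤ ψ (S.v j) := by
      rw [hswap]
      exact Finset.sum_le_sum fun T₀ hT₀ => Finset.sum_le_sum fun l hl => hle T₀ hT₀ l hl
    refine ⟨hle', ?_⟩
    by_cases hlt : ∑ i ∈ T, ψ (S.v i) * S.X T i (S.v j) < ψ (S.v j)
    · exact Or.inl hlt
    · right
      -- Equality for the sum forces equality for each facet functional. If T lies in T₀, this makes
      -- the T₀-coordinates of v j nonnegative.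
      have heq := hle'.antisymm (not_lt.1 hlt)
      rw [hswap] at heq
      obtain ⟨T₀, hT₀, hsub⟩ := h.refine T hT
      refine h.convex T hT T' hT' j hj hjT T₀ hT₀ hsub fun l => ?_
      by_cases hl : l ∈ T₀
      · have h1 := (Finset.sum_eq_sum_iff_of_le fun T₀ hT₀ =>
          Finset.sum_le_sum fun l hl => hle T₀ hT₀ l hl).1 heq T₀ hT₀
        have h2 := (Finset.sum_eq_sum_iff_of_le fun l hl => hle T₀ hT₀ l hl).1 h1 l hl
        rw [((hH T₀ hT₀ l hl).sum_abs hT (S.v j)).2 fun i hi => hsub i hi l] at h2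
        rw [h2]
        exact abs_nonneg _
      · rw [S₀.X_off T₀ hT₀ l hl, LinearMap.zero_apply]
  have hev : ∀ᶠ N : ℝ in atTop, ∀ T ∈ S.F, ∀ T' ∈ S.F, ∀ j ∈ T', j ∉ T →
      ∑ i ∈ T, (N * ψ (S.v i) + δ i) * S.X T i (S.v j) < N * ψ (S.v j) + δ j := by
    simp only [Filter.eventually_all_finset]
    intro T hT T' hT' j hj
    rw [Filter.eventually_imp_distrib_left]
    intro hjT
    obtain ⟨h1, h2⟩ := hdic T hT T' hT' j hj hjT
    have hsplit : ∀ N : ℝ, ∑ i ∈ T, (N * ψ (S.v i) + δ i) * S.X T i (S.v j) =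
        N * ∑ i ∈ T, ψ (S.v i) * S.X T i (S.v j) + ∑ i ∈ T, δ i * S.X T i (S.v j) := fun N => by
      rw [Finset.mul_sum, ← Finset.sum_add_distrib]
      exact Finset.sum_congr rfl fun i _ => by ring
    simp only [hsplit]
    rcases h2 with h2 | h2
    · filter_upwards [eventually_gt_atTop ((∑ i ∈ T, δ i * S.X T i (S.v j) - δ j) /
        (ψ (S.v j) - ∑ i ∈ T, ψ (S.v i) * S.X T i (S.v j)))] with N hN
      rw [div_lt_iff₀ (by linarith)] at hN
      linarith
    · filter_upwards [eventually_ge_atTop 0] with N hN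
      have := mul_le_mul_of_nonneg_left h1 hN
      linarith
  obtain ⟨N, hN⟩ := hev.exists
  exact ⟨fun i => N * ψ (S.v i) + δ i, fun T hT T' hT' j hj hjT => hN T hT T' hT' j hj hjT⟩

include hq hι in
omit [DecidableEq ι] in
/-- The piecewise polynomial functions on a simplicial fan with convex support form a finitely
generated projective module over the polynomial functions. -/
theorem finiteProjective_pwPoly : FiniteProjective (PolyOn V) (S.pwPoly q S.F) := by
  classical
  obtain ⟨S', δ, h1, h2, h3⟩ := exists_noCrossing_finset (S := S) hq hι
    (S.F.biUnion fun T => T.image (S.X T))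
  refine h3 ?_
  obtain ⟨h, hreg⟩ := h1.exists_isRegular fun T hT i hi => h2 _
    (Finset.mem_biUnion.2 ⟨T, hT, Finset.mem_image_of_mem _ hi⟩)
  rcases S'.F.eq_empty_or_nonempty with h0 | h0
  · have : Subsingleton (S'.pwPoly q S'.F) := ⟨fun f g => Subtype.ext (funext fun T => by
      rw [f.2.1 T (by simp [h0]), g.2.1 T (by simp [h0])])⟩
    exact ⟨inferInstance, inferInstance⟩
  · exact hreg.finiteProjective hq h0

end SFan
end EhrhartFan

namespace EhrhartFan

/-! ### Graded projective modules are free -/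

/-- A finitely generated projective graded module over a connected graded domain is free. -/
theorem free_of_graded_projective {A E : Type*} [CommRing A] [IsDomain A] [Algebra ℝ A]
    [AddCommGroup E] [Module ℝ E] [Module A E] [IsScalarTower ℝ A E]
    {𝒜 : ℕ → Submodule ℝ A} (h𝒜 : DirectSum.IsInternal 𝒜)
    {deg : ℕ → Submodule ℝ E} (hdeg : DirectSum.IsInternal deg)
    (hsmul : ∀ {i j : ℕ} {a : A} {x : E}, a ∈ 𝒜 i → x ∈ deg j → a • x ∈ deg (i + j))
    (ε : A →ₐ[ℝ] ℝ) (hε : ∀ k ≠ 0, ∀ a ∈ 𝒜 k, ε a = 0) (hε0 : ∀ a ∈ 𝒜 0, ε a = 0 → a = 0)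
    [Module.Finite A E] [Module.Projective A E] : Module.Free A E := by
  classical
  let m : Ideal A := RingHom.ker ε
  let mE : Submodule A E := m • ⊤
  let π : E →ₗ[ℝ] (E ⧸ mE) := mE.mkQ.restrictScalars ℝ
  have hπ : ∀ (a : A) (x : E), π (a • x) = ε a • π x := by
    intro a x
    have h1 : a - algebraMap ℝ A (ε a) ∈ m := by simp [m, RingHom.mem_ker]
    have h2 : (a - algebraMap ℝ A (ε a)) • x ∈ mE := Submodule.smul_mem_smul h1 trivial
    rw [sub_smul, algebraMap_smul] at h2
    rw [← map_smul]
    exact (Submodule.Quotient.eq mE).2 h2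
  have hπs : Function.Surjective π := mE.mkQ_surjective
  have hπ0 : ∀ x, π x = 0 → x ∈ mE := fun x hx => (Submodule.Quotient.mk_eq_zero mE).1 hx
  have hfin : Module.Finite ℝ (E ⧸ mE) := by
    obtain ⟨s, hs⟩ := (Module.Finite.fg_top : (⊤ : Submodule A E).FG)
    refine ⟨⟨s.image π, ?_⟩⟩
    rw [eq_top_iff]
    rintro y -
    obtain ⟨x, rfl⟩ := hπs y
    have hx : x ∈ Submodule.span A (s : Set E) := by rw [hs]; trivial
    induction hx using Submodule.span_induction with
    | mem x hx => exact Submodule.subset_span (by simpa using ⟨x, hx, rfl⟩)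
    | zero => simp
    | add x y _ _ hx hy => rw [map_add]; exact Submodule.add_mem _ hx hy
    | smul a x _ hx => rw [hπ]; exact Submodule.smul_mem _ _ hx
  let H : Set E := {x | ∃ k, x ∈ deg k}
  have hH : Submodule.span ℝ (π '' H) = ⊤ := by
    rw [← Submodule.map_span, eq_top_iff, ← LinearMap.range_eq_top.2 hπs, ← Submodule.map_top]
    refine Submodule.map_mono ?_
    rw [← hdeg.submodule_iSup_eq_top]
    exact iSup_le fun k x hx => Submodule.subset_span ⟨k, hx⟩
  -- Graded Nakayama: a basis of E / mE consisting of classes of homogeneous elements, whose lifts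
  -- will be a basis of E.
  obtain ⟨b, hbH, hbspan, hbli⟩ := exists_linearIndependent ℝ (π '' H)
  rw [hH] at hbspan
  have hbfin : Finite b := hbli.finite
  have : Fintype b := Fintype.ofFinite b
  choose e heH he using fun i : b => hbH i.2
  choose d hd using heH
  let N₀ : Submodule A E := Submodule.span A (Set.range e)
  obtain ⟨p, hp1, hp2, hp3, -⟩ := exists_proj hdeg
  obtain ⟨r, hr1, hr2, hr3, hr4⟩ := exists_proj h𝒜
  have hp : ∀ {i k : ℕ} {x : E}, x ∈ deg i → (i = k → x ∈ N₀) → p k x ∈ N₀ := by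
    intro i k x hx h
    by_cases hik : i = k
    · subst hik
      rw [hp2 _ _ hx]
      exact h rfl
    · rw [hp3 _ _ hik _ hx]
      exact N₀.zero_mem
  have hN₀p : ∀ k, ∀ x ∈ N₀, p k x ∈ N₀ := by
    intro k x hx
    obtain ⟨c, rfl⟩ := (Submodule.mem_span_range_iff_exists_fun A).1 hx
    rw [map_sum]
    refine N₀.sum_mem fun i _ => ?_
    obtain ⟨M, hM⟩ := hr4 (c i)
    rw [← hM M le_rfl, Finset.sum_smul, map_sum]
    exact N₀.sum_mem fun j _ => hp (hsmul (hr1 j _) (hd i)) fun _ =>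
      N₀.smul_mem _ (Submodule.subset_span ⟨i, rfl⟩)
  have hm : ∀ a ∈ m, r 0 a = 0 := by
    intro a ha
    refine hε0 _ (hr1 0 a) ?_
    obtain ⟨M, hM⟩ := hr4 a
    have h1 := hM (M + 1) (Nat.le_succ M)
    have h2 : ε a = ε (r 0 a) := by
      conv_lhs => rw [← h1]
      rw [map_sum, Finset.sum_eq_single_of_mem 0 (by simp)]
      exact fun i _ hi => hε i hi _ (hr1 i a)
    rw [← h2]
    exact ha
  -- Modulo mE, an element of degree k lies in `N₀`. Since m has no part of degree zero, the degree
  -- k part of mE involves only elements of E of degree below k, which are in `N₀` by induction.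
  have hdegN : ∀ k, ∀ x ∈ deg k, x ∈ N₀ := by
    intro k
    induction k using Nat.strong_induction_on with
    | _ k ih =>
    intro x hx
    have hz : ∀ z ∈ mE, p k z ∈ N₀ := by
      intro z hz
      induction hz using Submodule.smul_induction_on' with
      | add x _ y _ hx hy => rw [map_add]; exact N₀.add_mem hx hy
      | smul a ha y _ =>
        have hy' : y ∈ ⨆ j, deg j := by rw [hdeg.submodule_iSup_eq_top]; trivial
        clear * - hy' hp hr1 hm ha hsmul ih hr4
        induction hy' using Submodule.iSup_induction' with
        | zero => rw [smul_zero, map_zero]; exact N₀.zero_mem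
        | add y y' _ _ hy hy' => rw [smul_add, map_add]; exact N₀.add_mem hy hy'
        | mem j y hy =>
          obtain ⟨M, hM⟩ := hr4 a
          rw [← hM M le_rfl, Finset.sum_smul, map_sum]
          refine Submodule.sum_mem _ fun i _ => ?_
          by_cases hi : i = 0
          · rw [hi, hm a ha, zero_smul, map_zero]
            exact N₀.zero_mem
          · exact hp (hsmul (hr1 i a) hy) fun hij => N₀.smul_mem _ (ih j (by omega) y hy)
    have hπx : π x ∈ Submodule.span ℝ b := by rw [hbspan]; trivial
    obtain ⟨n, hn, hxn⟩ : ∃ n ∈ N₀, π x = π n := by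
      have : ∀ y ∈ Submodule.span ℝ b, ∃ n ∈ N₀, y = π n := by
        intro y hy
        induction hy using Submodule.span_induction with
        | mem y hy => exact ⟨e ⟨y, hy⟩, Submodule.subset_span ⟨_, rfl⟩, (he ⟨y, hy⟩).symm⟩
        | zero => exact ⟨0, N₀.zero_mem, (map_zero π).symm⟩
        | add y y' _ _ hy hy' =>
          obtain ⟨n, hn, rfl⟩ := hy
          obtain ⟨n', hn', rfl⟩ := hy'
          exact ⟨n + n', N₀.add_mem hn hn', (map_add π _ _).symm⟩
        | smul c y _ hy =>
          obtain ⟨n, hn, rfl⟩ := hy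
          refine ⟨c • n, ?_, (map_smul π _ _).symm⟩
          rw [← algebraMap_smul A c n]
          exact N₀.smul_mem _ hn
      exact this _ hπx
    have hxn' : x - n ∈ mE := hπ0 _ (by rw [map_sub, hxn, sub_self])
    have h1 := N₀.add_mem (hz _ hxn') (hN₀p k n hn)
    rwa [← map_add, sub_add_cancel, hp2 k x hx] at h1
  let f : (b →₀ A) →ₗ[A] E := Finsupp.linearCombination A e
  have hf : Function.Surjective f := by
    rw [← LinearMap.range_eq_top, Finsupp.range_linearCombination, eq_top_iff]
    rintro x -
    have hx : x ∈ ⨆ j, deg j := by rw [hdeg.submodule_iSup_eq_top]; trivial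
    induction hx using Submodule.iSup_induction' with
    | zero => exact N₀.zero_mem
    | add x y _ _ hx hy => exact N₀.add_mem hx hy
    | mem j x hx => exact hdegN j x hx
  obtain ⟨s, hs⟩ := Module.projective_lifting_property f LinearMap.id hf
  have hs' : ∀ x, f (s x) = x := fun x => LinearMap.congr_fun hs x
  let g : (b →₀ A) →ₗ[A] (b →₀ A) := LinearMap.id - s ∘ₗ f
  have hg : ∀ x, g x = x - s (f x) := fun x => rfl
  have hgker : ∀ x, g x ∈ LinearMap.ker f := fun x => by
    rw [LinearMap.mem_ker, hg, map_sub, hs', sub_self]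
  have hgid : ∀ x ∈ LinearMap.ker f, g x = x := fun x hx => by
    rw [hg, LinearMap.mem_ker.1 hx, map_zero, sub_zero]
  have hfg : (LinearMap.ker f).FG := by
    have : LinearMap.ker f = LinearMap.range g := by
      ext x
      exact ⟨fun hx => ⟨x, hgid x hx⟩, fun ⟨y, hy⟩ => hy ▸ hgker y⟩
    rw [this, ← Submodule.map_top]
    exact Submodule.FG.map g Module.Finite.fg_top
  have hle : LinearMap.ker f ≤ m • LinearMap.ker f := by
    intro x hx
    have hxm : ∀ i, x i ∈ m := by
      have h1 : π (f x) = 0 := by rw [LinearMap.mem_ker.1 hx, map_zero]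
      rw [Finsupp.linearCombination_apply, Finsupp.sum_fintype _ _ (fun i => by simp), map_sum] at h1
      simp only [hπ, he] at h1
      exact fun i => Fintype.linearIndependent_iff.1 hbli (fun i => ε (x i)) h1 i
    rw [← hgid x hx]
    have hx' : x = ∑ i, x i • Finsupp.single i (1 : A) := by
      ext j
      simp
    rw [hx', map_sum]
    refine Submodule.sum_mem _ fun i _ => ?_
    rw [map_smul]
    exact Submodule.smul_mem_smul (hxm i) (hgker _)
  obtain ⟨a, ha1, ha2⟩ :=
    Submodule.exists_sub_one_mem_and_smul_eq_zero_of_fg_of_le_smul m _ hfg hle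
  have ha0 : a ≠ 0 := by
    rintro rfl
    have : ε (0 - 1) = 0 := ha1
    simp at this
  have hinj : Function.Injective f := by
    rw [← LinearMap.ker_eq_bot, eq_bot_iff]
    intro x hx
    exact (smul_eq_zero.1 (ha2 x hx)).resolve_left ha0
  exact Module.Free.of_equiv (LinearEquiv.ofBijective f ⟨hinj, hf⟩)

end EhrhartFan

namespace EhrhartFan

/-! ### Lattice points -/

section Lattice

variable {n : ℕ} {v w : Fin n → ℝ}

theorem IsLatticePoint.zero : IsLatticePoint (0 : Fin n → ℝ) := fun _ => ⟨0, by simp⟩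

theorem IsLatticePoint.add (hv : IsLatticePoint v) (hw : IsLatticePoint w) :
    IsLatticePoint (v + w) := fun i => by
  obtain ⟨a, ha⟩ := hv i
  obtain ⟨b, hb⟩ := hw i
  exact ⟨a + b, by simp [ha, hb]⟩

theorem IsLatticePoint.sub (hv : IsLatticePoint v) (hw : IsLatticePoint w) :
    IsLatticePoint (v - w) := fun i => by
  obtain ⟨a, ha⟩ := hv i
  obtain ⟨b, hb⟩ := hw i
  exact ⟨a - b, by simp [ha, hb]⟩

theorem IsLatticePoint.nsmul (hv : IsLatticePoint v) (m : ℕ) : IsLatticePoint (m • v) := fun i => by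
  obtain ⟨a, ha⟩ := hv i
  exact ⟨m * a, by simp [ha]⟩

theorem IsLatticePoint.sum {α : Type*} (s : Finset α) (f : α → Fin n → ℝ)
    (h : ∀ i ∈ s, IsLatticePoint (f i)) : IsLatticePoint (∑ i ∈ s, f i) :=
  Finset.sum_induction _ _ (fun _ _ => IsLatticePoint.add) IsLatticePoint.zero h

theorem IsPrimitive.ne_zero (h : IsPrimitive v) : v ≠ 0 := by
  rintro rfl
  exact absurd (h.2 0 IsLatticePoint.zero 0 (by simp)) (by norm_num)

/-- Divide by the largest m for which v is m times a lattice point; such m are bounded by any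
nonzero coordinate. -/
theorem IsLatticePoint.exists_primitive (hv : IsLatticePoint v) (h0 : v ≠ 0) :
    ∃ p, IsPrimitive p ∧ ∃ m : ℕ, 0 < m ∧ v = (m : ℝ) • p := by
  classical
  obtain ⟨i, hi⟩ : ∃ i, v i ≠ 0 := by
    by_contra! h
    exact h0 (funext h)
  obtain ⟨z, hz⟩ := hv i
  have hz0 : z ≠ 0 := by rintro rfl; exact hi (by simpa using hz)
  let P : ℕ → Prop := fun m => ∃ w : Fin n → ℝ, IsLatticePoint w ∧ v = m • w
  have hb : ∀ m, P m → m ≤ z.natAbs := by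
    rintro m ⟨w, hw, rfl⟩
    obtain ⟨a, ha⟩ := hw i
    have : z = m * a := by
      have : (m : ℝ) * a = z := by rw [← hz, ← ha]; simp
      exact_mod_cast this.symm
    exact Nat.le_of_dvd (Int.natAbs_pos.2 hz0) (by rw [this, Int.natAbs_mul]; simp)
  have hP1 : P 1 := ⟨v, hv, by simp⟩
  have h1 := Nat.findGreatest_spec (P := P) (hb 1 hP1) hP1
  have h2 : ∀ k, P k → k ≤ Nat.findGreatest P z.natAbs := fun k hk =>
    Nat.le_findGreatest (hb k hk) hk
  set m := Nat.findGreatest P z.natAbs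
  obtain ⟨w, hw, hvw⟩ := h1
  have hm : 0 < m := h2 1 hP1
  refine ⟨w, ⟨hw, fun u hu k hk => ?_⟩, m, hm, by rw [hvw, Nat.cast_smul_eq_nsmul]⟩
  have h3 := h2 (m * k) ⟨u, hu, by rw [hvw, hk, mul_smul]⟩
  have h4 : k ≤ 1 := by
    by_contra! h
    nlinarith
  have : k ≠ 0 := by rintro rfl; exact h0 (by rw [hvw, hk]; simp)
  omega

/-- The ratio is a rational number N / D in lowest terms. Coprimality makes D divide all coordinates
of w, so D = 1, and then N = 1. -/
theorem IsPrimitive.eq_of_smul (hv : IsPrimitive v) (hw : IsPrimitive w) {r : ℝ} (hr : 0 < r)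
    (h : v = r • w) : v = w := by
  obtain ⟨i, hi⟩ : ∃ i, w i ≠ 0 := by
    by_contra! h
    exact hw.ne_zero (funext h)
  obtain ⟨a, ha⟩ := hv.1 i
  obtain ⟨b, hb⟩ := hw.1 i
  have hb0 : (b : ℝ) ≠ 0 := by rwa [← hb]
  obtain ⟨q, hq⟩ : ∃ q : ℚ, r = q := ⟨a / b, by
    have : (a : ℝ) = r * b := by rw [← ha, ← hb, h]; simp
    push_cast
    rw [this]; field_simp⟩
  have hq0 : 0 < q := by exact_mod_cast hq ▸ hr
  have hden : (q.den : ℝ) ≠ 0 := by exact_mod_cast q.den_ne_zero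
  obtain ⟨N, hN⟩ := Int.eq_ofNat_of_zero_le (Rat.num_nonneg.2 hq0.le)
  have hqr : r = N / q.den := by
    rw [hq, ← Int.cast_natCast, ← hN]
    exact_mod_cast (Rat.num_div_den q).symm
  have hcop : Nat.Coprime N q.den := by
    have := q.reduced
    rwa [hN, Int.natAbs_natCast] at this
  have key : ∀ i, ∃ z : ℤ, w i = q.den * z := by
    intro i
    obtain ⟨a, ha⟩ := hv.1 i
    obtain ⟨b, hb⟩ := hw.1 i
    have h1 : (q.den : ℝ) * a = N * b := by
      rw [← ha, ← hb, h, hqr]; simp; field_simp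
    have h2 : (q.den : ℤ) * a = N * b := by exact_mod_cast h1
    have h3 : (q.den : ℤ) ∣ b := by
      refine IsCoprime.dvd_of_dvd_mul_left (Nat.isCoprime_iff_coprime.2 hcop.symm) ⟨a, h2.symm⟩
    obtain ⟨c, rfl⟩ := h3
    exact ⟨c, by rw [hb]; push_cast; rfl⟩
  choose z hz using key
  have hd := hw.2 (fun i => z i) (fun i => ⟨z i, rfl⟩) q.den (funext fun i => by simp [hz])
  have hN1 := hv.2 w hw.1 N (by
    rw [h, hqr, hd, ← Nat.cast_smul_eq_nsmul ℝ]; simp)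
  rw [h, hqr, hd, hN1]; simp

end Lattice

/-! ### Finitely generated cones -/

section Cones

variable {V : Type*} [AddCommGroup V] [Module ℝ V]

theorem mem_hull_finset {s : Finset V} {x : V} : x ∈ PointedCone.hull ℝ (s : Set V) ↔
    ∃ c : V → ℝ, (∀ p, 0 ≤ c p) ∧ ∑ p ∈ s, c p • p = x := by
  classical
  rw [PointedCone.mem_hull_set]
  constructor
  · rintro ⟨c, hc, hc0, rfl⟩
    exact ⟨c, hc0, (Finset.sum_subset (by exact_mod_cast hc) fun p _ hp => by
      simp [Finsupp.notMem_support_iff.1 hp]).symm⟩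
  · rintro ⟨c, hc, rfl⟩
    refine ⟨Finsupp.onFinset s (fun p => if p ∈ s then c p else 0) (by intro a; simp; tauto),
      ?_, fun p => ?_, ?_⟩
    · exact_mod_cast Finsupp.support_onFinset_subset
    · simp only [Finsupp.onFinset_apply]; split_ifs <;> simp [hc]
    · rw [Finsupp.onFinset_sum _ (by simp)]
      exact Finset.sum_congr rfl fun p hp => by simp [hp]

theorem mem_hull_singleton {p x : V} :
    x ∈ PointedCone.hull ℝ {p} ↔ ∃ r : ℝ, 0 ≤ r ∧ x = r • p := by
  have := mem_hull_finset (s := {p}) (x := x)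
  rw [Finset.coe_singleton] at this
  rw [this]
  constructor
  · rintro ⟨c, hc, h⟩
    exact ⟨c p, hc p, by simpa using h.symm⟩
  · rintro ⟨r, hr, rfl⟩
    exact ⟨fun _ => r, fun _ => hr, by simp⟩

/-- Farkas' lemma: a point outside of a finitely generated cone is separated from it by a linear
functional. -/
theorem exists_separating {ι : Type*} (s : Finset ι) (f : ι → V) (z : V)
    (hz : ∀ c : ι → ℝ, (∀ i, 0 ≤ c i) → ∑ i ∈ s, c i • f i ≠ z) :
    ∃ m : V →ₗ[ℝ] ℝ, (∀ i ∈ s, 0 ≤ m (f i)) ∧ m z < 0 := by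
  classical
  induction s using Finset.induction_on generalizing f z with
  | empty =>
    have hz0 : z ≠ 0 := fun h => hz (fun _ => 0) (fun _ => le_rfl) (by simp [h])
    obtain ⟨m, hm⟩ := Module.exists_dual_forall_apply_ne_zero (K := ℝ) (fun _ : Unit => z)
      fun _ => hz0
    have hm : m z ≠ 0 := hm ()
    rcases lt_or_gt_of_ne hm with h | h
    · exact ⟨m, by simp, h⟩
    · exact ⟨-m, by simp, by simpa using h⟩
  | insert a s ha ih =>
    obtain ⟨m, hm, hmz⟩ := ih f z fun c hc h => hz (fun i => if i = a then 0 else c i)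
      (fun i => by split_ifs <;> simp [hc]) (by
        rw [Finset.sum_insert ha, if_pos rfl, zero_smul, zero_add, ← h]
        exact Finset.sum_congr rfl fun i hi => by rw [if_neg (by rintro rfl; exact ha hi)])
    rcases le_or_gt 0 (m (f a)) with h0 | h0
    · refine ⟨m, fun i hi => ?_, hmz⟩
      rcases Finset.mem_insert.1 hi with rfl | hi
      · exact h0
      · exact hm i hi
    -- Now m is negative at f a. Everything is projected along f a into the kernel of m and
    -- separated there; the correction by a multiple of m below makes the functional vanish at f a.
    obtain ⟨m', hm', hmz'⟩ := ih (fun i => f i - (m (f i) / m (f a)) • f a)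
      (z - (m z / m (f a)) • f a) fun c hc h => by
        refine hz (fun i => if i = a then m z / m (f a) + ∑ j ∈ s, c j * -(m (f j) / m (f a))
          else c i) (fun i => ?_) ?_
        · split_ifs
          · refine add_nonneg (div_nonneg_of_nonpos hmz.le h0.le) (Finset.sum_nonneg fun j hj =>
              mul_nonneg (hc j) (neg_nonneg.2 (div_nonpos_of_nonneg_of_nonpos (hm j hj) h0.le)))
          · exact hc i
        · rw [Finset.sum_insert ha, if_pos rfl]
          have : ∑ i ∈ s, (if i = a then m z / m (f a) + ∑ j ∈ s, c j * -(m (f j) / m (f a))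
              else c i) • f i = ∑ i ∈ s, c i • f i :=
            Finset.sum_congr rfl fun i hi => by rw [if_neg (by rintro rfl; exact ha hi)]
          rw [this]
          rw [← sub_eq_zero] at h ⊢
          rw [← h, add_smul, Finset.sum_smul]
          simp only [smul_sub, Finset.sum_sub_distrib, smul_smul, mul_neg, neg_smul,
            Finset.sum_neg_distrib]
          abel
    refine ⟨m' - (m' (f a) / m (f a)) • m, fun i hi => ?_, ?_⟩
    · rcases Finset.mem_insert.1 hi with rfl | hi
      · simp [h0.ne]
      · have := hm' i hi
        simp only [map_sub, map_smul, smul_eq_mul, LinearMap.sub_apply, LinearMap.smul_apply]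
          at this ⊢
        convert this using 1
        ring
    · simp only [map_sub, map_smul, smul_eq_mul, LinearMap.sub_apply, LinearMap.smul_apply]
        at hmz' ⊢
      convert hmz' using 1
      ring

theorem Salient.eq_zero {C : PointedCone ℝ V} (hC : (C : ConvexCone ℝ V).Salient) {x : V}
    (hx : x ∈ C) (hx' : -x ∈ C) : x = 0 := by
  by_contra h
  exact hC x hx h hx'

theorem Salient.eq_zero_of_sum {C : PointedCone ℝ V} (hC : (C : ConvexCone ℝ V).Salient)
    {ι : Type*} {s : Finset ι} {f : ι → V} (hf : ∀ i ∈ s, f i ∈ C) (h : ∑ i ∈ s, f i = 0) :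
    ∀ i ∈ s, f i = 0 := by
  classical
  intro i hi
  refine Salient.eq_zero hC (hf i hi) ?_
  rw [← Finset.add_sum_erase _ _ hi, add_eq_zero_iff_neg_eq] at h
  rw [h]
  exact C.sum_mem fun j hj => hf j (Finset.mem_of_mem_erase hj)

/-- A finitely generated cone containing no line is generated by vectors spanning its edges. -/
theorem exists_edge_generators (s : Finset V)
    (hC : (PointedCone.hull ℝ (s : Set V) : ConvexCone ℝ V).Salient) :
    ∃ t ⊆ s, PointedCone.hull ℝ (t : Set V) = PointedCone.hull ℝ (s : Set V) ∧
      ∀ w ∈ t, w ≠ 0 ∧ (PointedCone.hull ℝ {w}).IsFaceOf (PointedCone.hull ℝ (s : Set V)) := by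
  classical
  -- In a generating subset of least size no element is generated by the others.
  obtain ⟨t, ht, htmin⟩ := Finset.exists_min_image
    (s.powerset.filter fun t : Finset V => PointedCone.hull ℝ (t : Set V) = PointedCone.hull ℝ (s : Set V))
    Finset.card ⟨s, by simp⟩
  simp only [Finset.mem_filter, Finset.mem_powerset] at ht htmin
  obtain ⟨hts, hull⟩ := ht
  have hmin : ∀ w ∈ t, w ∉ PointedCone.hull ℝ ((t.erase w : Finset V) : Set V) := by
    intro w hw h
    have := htmin (t.erase w) ⟨(Finset.erase_subset _ _).trans hts, by
      rw [← hull]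
      refine le_antisymm (Submodule.span_mono (by simp)) (Submodule.span_le.2 fun x hx => ?_)
      by_cases hxw : x = w
      · rw [hxw]; exact h
      · exact Submodule.subset_span (by simpa [hxw] using hx)⟩
    have h2 := Finset.card_erase_lt_of_mem hw
    omega
  refine ⟨t, hts, hull, fun w hw => ⟨?_, ?_⟩⟩
  · rintro rfl
    exact hmin _ hw (Submodule.zero_mem _)
  rw [← hull] at hC ⊢
  have hmem : ∀ u ∈ t, ∀ r : ℝ, 0 ≤ r → r • u ∈ PointedCone.hull ℝ (t : Set V) :=
    fun u hu r hr => PointedCone.smul_mem _ hr (Submodule.subset_span hu)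
  refine PointedCone.IsFaceOf.of_mem_of_add_mem_left
    (Submodule.span_mono (by simpa using hw)) fun {x y} hx hy hxy => ?_
  obtain ⟨a, ha, rfl⟩ := mem_hull_finset.1 hx
  obtain ⟨b, hb, rfl⟩ := mem_hull_finset.1 hy
  obtain ⟨r, hr, h⟩ := mem_hull_singleton.1 hxy
  have hsum : ∑ u ∈ t.erase w, (a u + b u) • u = (r - (a w + b w)) • w := by
    rw [← Finset.sum_add_distrib, ← Finset.add_sum_erase _ _ hw] at h
    simp only [add_smul, sub_smul]
    rw [← h]; abel
  -- If the coefficients of w do not add up to r, then w is generated by the others. Otherwise a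
  -- nonnegative combination of generators is zero, and as the cone contains no line, all terms
  -- other than w vanish.
  rcases lt_or_ge (a w + b w) r with hlt | hge
  · refine absurd ?_ (hmin w hw)
    refine mem_hull_finset.2 ⟨fun u => (r - (a w + b w))⁻¹ * (a u + b u), fun u =>
      mul_nonneg (inv_nonneg.2 (by linarith)) (add_nonneg (ha u) (hb u)), ?_⟩
    simp only [mul_smul, ← Finset.smul_sum]
    rw [hsum, smul_smul, inv_mul_cancel₀ (by linarith), one_smul]
  · have h0 : ∑ u ∈ t, (if u = w then a w + b w - r else a u + b u) • u = 0 := by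
      rw [← Finset.add_sum_erase _ _ hw, if_pos rfl, Finset.sum_congr rfl
        (g := fun u => (a u + b u) • u) (fun u hu => by rw [if_neg (Finset.ne_of_mem_erase hu)]),
        hsum, ← add_smul]
      simp
    have h1 := Salient.eq_zero_of_sum hC (fun u hu => hmem u hu _ (by
      split_ifs
      · linarith
      · exact add_nonneg (ha u) (hb u))) h0
    refine mem_hull_singleton.2 ⟨a w, ha w, ?_⟩
    refine Finset.sum_eq_single_of_mem w hw fun u hu huw => ?_
    have := h1 u hu
    rw [if_neg huw] at this
    rcases smul_eq_zero.1 this with h | h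
    · rw [show a u = 0 by linarith [ha u, hb u], zero_smul]
    · rw [h, smul_zero]

/-- The generators occurring in a point of a face lie in the face. -/
theorem IsFaceOf.mem_of_sum {C F : PointedCone ℝ V} (hF : F.IsFaceOf C) {ι : Type*}
    {s : Finset ι} {f : ι → V} {c : ι → ℝ} (hf : ∀ i ∈ s, f i ∈ C) (hc : ∀ i ∈ s, 0 ≤ c i)
    (h : ∑ i ∈ s, c i • f i ∈ F) {i : ι} (hi : i ∈ s) (hci : 0 < c i) : f i ∈ F := by
  classical
  rw [← Finset.add_sum_erase _ _ hi] at h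
  exact hF.mem_of_smul_add_mem (hf i hi) (C.sum_mem fun j hj => PointedCone.smul_mem C
    (hc j (Finset.mem_of_mem_erase hj)) (hf j (Finset.mem_of_mem_erase hj))) hci h

end Cones

/-! ### The primitive generators of a rational cone -/

section PrimGens

variable {n : ℕ} {σ τ : PointedCone ℝ (Fin n → ℝ)}

theorem primGens_subset : primGens σ ⊆ σ := fun _ hp => hp.2.le (Submodule.subset_span rfl)

/-- Among finitely many generators of a cone there is a positive multiple of each of its primitive
generators. -/
theorem exists_pos_smul_of_mem_primGens {s : Finset (Fin n → ℝ)}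
    (hs : PointedCone.hull ℝ (s : Set (Fin n → ℝ)) = σ) {p : Fin n → ℝ} (hp : p ∈ primGens σ) :
    ∃ u ∈ s, ∃ r : ℝ, 0 < r ∧ u = r • p := by
  have hpσ := primGens_subset hp
  rw [SetLike.mem_coe, ← hs] at hpσ
  obtain ⟨c, hc, hsum⟩ := mem_hull_finset.1 hpσ
  have : ∃ u ∈ s, c u • u ≠ 0 := by
    by_contra! h
    exact hp.1.ne_zero (by rw [← hsum, Finset.sum_eq_zero h])
  obtain ⟨u, hu, hu0⟩ := this
  have hcu : 0 < c u := lt_of_le_of_ne (hc u) fun h => hu0 (by rw [← h, zero_smul])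
  have h1 : u ∈ PointedCone.hull ℝ {p} := IsFaceOf.mem_of_sum hp.2 (f := id) (c := c)
    (fun i hi => by rw [← hs]; exact Submodule.subset_span hi) (fun i _ => hc i)
    (by show ∑ i ∈ s, c i • i ∈ _; rw [hsum]; exact Submodule.subset_span rfl) hu hcu
  obtain ⟨r, hr, rfl⟩ := mem_hull_singleton.1 h1
  refine ⟨_, hu, r, lt_of_le_of_ne hr ?_, rfl⟩
  rintro rfl
  exact hu0 (by simp)

theorem eq_of_pos_smul {p q u : Fin n → ℝ} (hp : IsPrimitive p) (hq : IsPrimitive q) {r t : ℝ}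
    (hr : 0 < r) (ht : 0 < t) (h1 : u = r • p) (h2 : u = t • q) : p = q := by
  refine hp.eq_of_smul hq (r := r⁻¹ * t) (by positivity) ?_
  rw [mul_smul, ← h2, h1, smul_smul, inv_mul_cancel₀ hr.ne', one_smul]

theorem primGens_finite_of {s : Finset (Fin n → ℝ)}
    (hs : PointedCone.hull ℝ (s : Set (Fin n → ℝ)) = σ) : (primGens σ).Finite := by
  classical
  choose! f hf r hr hfr using fun p (hp : p ∈ primGens σ) => exists_pos_smul_of_mem_primGens hs hp
  refine Set.Finite.of_finite_image (f := f) (s.finite_toSet.subset ?_) ?_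
  · rintro _ ⟨p, hp, rfl⟩
    exact hf p hp
  · intro p hp q hq h
    exact eq_of_pos_smul hp.1 hq.1 (hr p hp) (hr q hq) (hfr p hp) (h ▸ hfr q hq)

theorem IsRationalCone.primGens_finite (h : IsRationalCone σ) : (primGens σ).Finite := by
  obtain ⟨s, hs, -, h⟩ := h
  exact primGens_finite_of (s := hs.toFinset) (by simpa using h)

/-- The lattice generators that span edges suffice, and each is a positive multiple of a primitive
point on the same edge. -/
theorem IsRationalCone.hull_primGens (h : IsRationalCone σ)
    (hσ : (σ : ConvexCone ℝ (Fin n → ℝ)).Salient) : PointedCone.hull ℝ (primGens σ) = σ := by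
  obtain ⟨s, hs, hlat, rfl⟩ := h
  lift s to Finset (Fin n → ℝ) using hs
  obtain ⟨t, hts, ht, hface⟩ := exists_edge_generators s hσ
  refine le_antisymm (Submodule.span_le.2 primGens_subset) ?_
  conv_lhs => rw [← ht]
  refine Submodule.span_le.2 fun w hw => ?_
  obtain ⟨p, hp, m, hm, rfl⟩ := (hlat w (hts hw)).exists_primitive (hface w hw).1
  have hm' : (0 : ℝ) < m := by exact_mod_cast hm
  refine PointedCone.smul_mem _ hm'.le (Submodule.subset_span ⟨hp, ?_⟩)
  have : PointedCone.hull ℝ {p} = PointedCone.hull ℝ {(m : ℝ) • p} := by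
    refine le_antisymm ?_ ?_ <;> rw [Submodule.span_le, Set.singleton_subset_iff]
    · exact mem_hull_singleton.2 ⟨(m : ℝ)⁻¹, by positivity, by
        rw [smul_smul, inv_mul_cancel₀ hm'.ne', one_smul]⟩
    · exact mem_hull_singleton.2 ⟨m, hm'.le, rfl⟩
  rw [this]
  exact (hface _ hw).2

/-- The primitive generators of a simplicial cone are linearly independent. -/
theorem linearIndepOn_primGens (h : σ.IsSimplicial) : LinearIndepOn ℝ id (primGens σ) := by
  classical
  obtain ⟨s, hs, hli, h⟩ := h
  lift s to Finset (Fin n → ℝ) using hs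
  choose! f hf r hr hfr using fun p (hp : p ∈ primGens σ) => exists_pos_smul_of_mem_primGens h hp
  let g : primGens σ → (s : Set (Fin n → ℝ)) := fun p => ⟨f p, hf p p.2⟩
  have hg : Function.Injective g := fun p q h => Subtype.ext (eq_of_pos_smul p.2.1 q.2.1 (hr p p.2)
    (hr q q.2) (hfr p p.2) ((congrArg Subtype.val h : f p = f q).trans (hfr q q.2)))
  have h1 := (hli.comp g hg).units_smul fun p => (Units.mk0 (r p) (hr p p.2).ne')⁻¹
  show LinearIndependent ℝ (fun p : primGens σ => (p : Fin n → ℝ))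
  suffices e : (fun p : primGens σ => (p : Fin n → ℝ)) = (fun p : primGens σ =>
      (Units.mk0 (r p) (hr p p.2).ne')⁻¹) • (fun x : (s : Set (Fin n → ℝ)) => id x.1) ∘ g by
    rw [e]; exact h1
  funext p
  show (p : Fin n → ℝ) = (Units.mk0 (r p) (hr p p.2).ne')⁻¹ • f p
  rw [hfr p p.2, Units.smul_def, smul_smul]
  simp [(hr p p.2).ne']

theorem mem_primGens_of_face (hτ : τ.IsFaceOf σ) {p : Fin n → ℝ} (hp : p ∈ primGens σ)
    (hpτ : p ∈ τ) : p ∈ primGens τ :=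
  ⟨hp.1, (hp.2.isFaceOf_iff_le hτ).2 (Submodule.span_le.2 (by simpa using hpτ))⟩

end PrimGens

end EhrhartFan

namespace EhrhartFan

/-! ### Simplicial cones -/

section SimplicialCones

variable {V : Type*} [AddCommGroup V] [Module ℝ V] {T : Finset V}

theorem exists_coord (hT : LinearIndepOn ℝ id (T : Set V)) :
    ∃ X : V → (V →ₗ[ℝ] ℝ), (∀ p ∉ T, X p = 0) ∧ (∀ p ∈ T, X p p = 1) ∧
      ∀ p, ∀ q ∈ T, p ≠ q → X p q = 0 := by
  classical
  have hT' : LinearIndependent ℝ (fun p : (T : Set V) => (p : V)) := hT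
  have : ∀ p : (T : Set V), ∃ X : V →ₗ[ℝ] ℝ, ∀ q : (T : Set V), X q = if p = q then 1 else 0 := by
    intro p
    obtain ⟨X, hX⟩ := LinearMap.exists_extend (Finsupp.lapply p ∘ₗ hT'.repr)
    refine ⟨X, fun q => ?_⟩
    have h1 := LinearMap.congr_fun hX ⟨q, Submodule.subset_span ⟨q, rfl⟩⟩
    refine h1.trans ?_
    simp only [LinearMap.comp_apply, Finsupp.lapply_apply]
    rw [hT'.repr_eq_single q _ rfl, Finsupp.single_apply]
    simp only [eq_comm]
  choose X hX using this
  refine ⟨fun p => if hp : p ∈ T then X ⟨p, hp⟩ else 0, fun p hp => dif_neg hp,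
    fun p hp => ?_, fun p q hq hpq => ?_⟩
  · have := hX ⟨p, hp⟩ ⟨p, hp⟩
    simp only [hp, dif_pos]
    simpa using this
  · by_cases hp : p ∈ T
    · have := hX ⟨p, hp⟩ ⟨q, hq⟩
      simp only [hp, dif_pos]
      simpa [hpq] using this
    · simp [hp]

open Classical in
/-- The coordinates of a vector with respect to a linearly independent set (linear functionals,
extended arbitrarily to the whole space). -/
noncomputable def coord (T : Finset V) : V → (V →ₗ[ℝ] ℝ) :=
  if h : LinearIndepOn ℝ id (T : Set V) then (exists_coord h).choose else 0

theorem coord_off {p : V} (hp : p ∉ T) : coord T p = 0 := by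
  unfold coord
  split_ifs with h
  · exact (exists_coord h).choose_spec.1 p hp
  · rfl

variable (hT : LinearIndepOn ℝ id (T : Set V))
include hT

theorem coord_self {p : V} (hp : p ∈ T) : coord T p p = 1 := by
  unfold coord
  rw [dif_pos hT]
  exact (exists_coord hT).choose_spec.2.1 p hp

theorem coord_of_ne {p q : V} (hq : q ∈ T) (hpq : p ≠ q) : coord T p q = 0 := by
  unfold coord
  rw [dif_pos hT]
  exact (exists_coord hT).choose_spec.2.2 p q hq hpq

theorem coord_sum (c : V → ℝ) {p : V} (hp : p ∈ T) : coord T p (∑ q ∈ T, c q • q) = c p := by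
  rw [map_sum, Finset.sum_eq_single_of_mem p hp]
  · simp [coord_self hT hp]
  · intro q hq hqp
    simp [coord_of_ne hT hq hqp.symm]

theorem sum_coord {x : V} (hx : x ∈ Submodule.span ℝ (T : Set V)) :
    ∑ p ∈ T, coord T p x • p = x := by
  induction hx using Submodule.span_induction with
  | mem x hx =>
    rw [Finset.sum_eq_single_of_mem x hx]
    · simp [coord_self hT hx]
    · intro q hq hqx
      simp [coord_of_ne hT hx hqx]
  | zero => simp
  | add x y _ _ hx hy => simp only [map_add, add_smul, Finset.sum_add_distrib, hx, hy]
  | smul r x _ hx =>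
    conv_rhs => rw [← hx]
    simp only [map_smul, Finset.smul_sum, smul_assoc]

theorem mem_hull_iff_coord {x : V} : x ∈ PointedCone.hull ℝ (T : Set V) ↔
    x ∈ Submodule.span ℝ (T : Set V) ∧ ∀ p, 0 ≤ coord T p x := by
  constructor
  · intro h
    refine ⟨PointedCone.hull_le_span ℝ _ h, fun p => ?_⟩
    by_cases hp : p ∈ T
    · obtain ⟨c, hc, rfl⟩ := mem_hull_finset.1 h
      rw [coord_sum hT c hp]
      exact hc p
    · simp [coord_off hp]
  · rintro ⟨h1, h2⟩
    exact mem_hull_finset.2 ⟨_, h2, sum_coord hT h1⟩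

theorem coord_nonneg {x : V} (hx : x ∈ PointedCone.hull ℝ (T : Set V)) (p : V) :
    0 ≤ coord T p x := ((mem_hull_iff_coord hT).1 hx).2 p

theorem sum_coord_hull {x : V} (hx : x ∈ PointedCone.hull ℝ (T : Set V)) :
    ∑ p ∈ T, coord T p x • p = x := sum_coord hT ((mem_hull_iff_coord hT).1 hx).1

/-- A point of a simplicial cone lies in the face generated by the generators having positive
coefficients. -/
theorem mem_hull_of_coord {S : Set V} {x : V} (hx : x ∈ PointedCone.hull ℝ (T : Set V))
    (h : ∀ p ∈ T, 0 < coord T p x → p ∈ S) : x ∈ PointedCone.hull ℝ S := by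
  rw [← sum_coord_hull hT hx]
  refine Submodule.sum_mem _ fun p hp => ?_
  rcases (coord_nonneg hT hx p).eq_or_lt with h0 | h0
  · rw [← h0, zero_smul]; exact Submodule.zero_mem _
  · exact PointedCone.smul_mem _ h0.le (Submodule.subset_span (h p hp h0))

theorem coord_eq_zero_of_mem_hull {S : Finset V} (hS : S ⊆ T) {x : V}
    (hx : x ∈ PointedCone.hull ℝ (S : Set V)) {p : V} (hp : p ∉ S) : coord T p x = 0 := by
  obtain ⟨c, hc, rfl⟩ := mem_hull_finset.1 hx
  rw [map_sum]
  refine Finset.sum_eq_zero fun q hq => ?_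
  rw [map_smul, coord_of_ne hT (hS hq) (by rintro rfl; exact hp hq), smul_zero]

theorem hull_isFaceOf {S : Finset V} (hS : S ⊆ T) :
    (PointedCone.hull ℝ (S : Set V)).IsFaceOf (PointedCone.hull ℝ (T : Set V)) := by
  refine PointedCone.IsFaceOf.of_mem_of_add_mem_left (Submodule.span_mono (by exact_mod_cast hS))
    fun {x y} hx hy hxy => mem_hull_of_coord hT hx fun p hp hpx => ?_
  by_contra hpS
  have h1 := coord_eq_zero_of_mem_hull hT hS hxy hpS
  rw [map_add] at h1
  linarith [coord_nonneg hT hy p]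

theorem eq_hull_of_isFaceOf {F : PointedCone ℝ V}
    (hF : F.IsFaceOf (PointedCone.hull ℝ (T : Set V))) :
    F = PointedCone.hull ℝ ((T : Set V) ∩ F) := by
  refine le_antisymm (fun x hx => mem_hull_of_coord hT (hF.le hx) fun p hp hpx =>
    Set.mem_inter hp ?_)
    (Submodule.span_le.2 Set.inter_subset_right)
  refine IsFaceOf.mem_of_sum hF (s := T) (f := id) (c := fun p => coord T p x)
    (fun p hp => Submodule.subset_span hp) (fun p _ => coord_nonneg hT (hF.le hx) p) ?_ hp hpx
  show ∑ p ∈ T, coord T p x • p ∈ F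
  rwa [sum_coord_hull hT (hF.le hx)]

end SimplicialCones

section

variable {n : ℕ}

theorem primGens_hull {T : Finset (Fin n → ℝ)} (hT : LinearIndepOn ℝ id (T : Set (Fin n → ℝ)))
    (h : ∀ p ∈ T, IsPrimitive p) : primGens (PointedCone.hull ℝ (T : Set (Fin n → ℝ))) = T := by
  ext p
  constructor
  · intro hp
    obtain ⟨u, hu, r, hr, hur⟩ := exists_pos_smul_of_mem_primGens rfl hp
    rw [(h u hu).eq_of_smul hp.1 hr hur] at hu
    exact hu
  · intro hp
    refine ⟨h p hp, ?_⟩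
    have := hull_isFaceOf hT (S := {p}) (by simpa using hp)
    simpa using this

end

/-! ### Existence of a crepant simplicial subdivision -/

section Existence

open Filter Topology

variable {V : Type*} [AddCommGroup V] [Module ℝ V]

/-- Heights for which lifted dependent sets are not contained in the graph of a functional. -/
theorem exists_generic_heights (G : Finset V) : ∃ h : V → ℝ, ∀ T ⊆ G, ∀ m : V →ₗ[ℝ] ℝ,
    (∀ p ∈ T, m p = h p) → LinearIndepOn ℝ id (T : Set V) := by
  classical
  let D := {T : Finset V // T ∈ G.powerset ∧ ¬ LinearIndepOn ℝ id (T : Set V)}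
  have : Finite D := (G.powerset.finite_toSet.subset fun T hT => hT.1 :
    {T : Finset V | T ∈ G.powerset ∧ ¬ LinearIndepOn ℝ id (T : Set V)}.Finite).to_subtype
  have hD : ∀ T : D, ∃ l : V →₀ ℝ, (l.support ⊆ T.1) ∧ l.sum (fun p r => r • p) = 0 ∧ l ≠ 0 := by
    rintro ⟨T, -, hT⟩
    rw [linearIndepOn_iff] at hT
    push Not at hT
    obtain ⟨l, hl, h0, hne⟩ := hT
    exact ⟨l, by exact_mod_cast (Finsupp.mem_supported _ _).1 hl, by
      simpa [Finsupp.linearCombination_apply] using h0, hne⟩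
  choose l hl1 hl2 hl3 using hD
  -- One relation is fixed for each dependent set, and φ is nonzero at all of them. If m agreed with
  -- the heights φ(e_p) on a dependent set, then φ of its relation would be m of zero.
  obtain ⟨φ, hφ⟩ := Module.exists_dual_forall_apply_ne_zero (K := ℝ) l hl3
  refine ⟨fun p => φ (Finsupp.single p 1), fun T hT m hm => ?_⟩
  by_contra hdep
  let T' : D := ⟨T, Finset.mem_powerset.2 hT, hdep⟩
  refine hφ T' ?_
  have h1 : φ (l T') = (l T').sum fun p r => r * m p := by
    conv_lhs => rw [← Finsupp.sum_single (l T')]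
    rw [Finsupp.sum, map_sum]
    refine Finset.sum_congr rfl fun p hp => ?_
    show _ = l T' p * m p
    rw [hm p (hl1 T' hp), ← smul_eq_mul, ← map_smul, Finsupp.smul_single, smul_eq_mul, mul_one]
  rw [h1, ← map_zero m, ← hl2 T', Finsupp.sum, Finsupp.sum, map_sum]
  simp

/-- A set `T` of points of `G` is the lower set of a linear functional with respect to the
heights `h`. -/
def IsLowerFace (h : V → ℝ) (G T : Finset V) : Prop :=
  T ⊆ G ∧ ∃ m : V →ₗ[ℝ] ℝ, ∀ p ∈ G, m p ≤ h p ∧ (m p = h p ↔ p ∈ T)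

/-- Tilt m: subtract a small multiple of a functional that is 1 on T \ S and 0 on S. The points
outside T stay strictly above. -/
theorem IsLowerFace.subset {h : V → ℝ} {G T S : Finset V} (hL : IsLowerFace h G T)
    (hT : LinearIndepOn ℝ id (T : Set V)) (hS : S ⊆ T) : IsLowerFace h G S := by
  classical
  obtain ⟨hTG, m, hm⟩ := hL
  let X : V →ₗ[ℝ] ℝ := ∑ p ∈ T \ S, coord T p
  have hX : ∀ p ∈ T, X p = if p ∈ S then 0 else 1 := by
    intro p hp
    simp only [X, LinearMap.sum_apply]
    split_ifs with h
    · refine Finset.sum_eq_zero fun q hq => coord_of_ne hT hp ?_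
      rintro rfl
      exact (Finset.mem_sdiff.1 hq).2 h
    · rw [Finset.sum_eq_single_of_mem p (by simp [hp, h])]
      · exact coord_self hT hp
      · intro q _ hqp
        exact coord_of_ne hT hp hqp
  have hev : ∀ᶠ ε : ℝ in 𝓝[>] 0, ∀ p ∈ G, p ∉ T → m p - ε * X p < h p := by
    rw [Filter.eventually_all_finset]
    intro p hp
    by_cases hpT : p ∈ T
    · simp [hpT]
    · have h1 : m p < h p := lt_of_le_of_ne (hm p hp).1 fun h => hpT ((hm p hp).2.1 h)
      have h2 : Tendsto (fun ε : ℝ => m p - ε * X p) (𝓝[>] 0) (𝓝 (m p - 0 * X p)) :=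
        (Continuous.tendsto (by fun_prop) 0).mono_left nhdsWithin_le_nhds
      rw [zero_mul, sub_zero] at h2
      filter_upwards [h2.eventually_lt_const h1] with ε hε _
      exact hε
  obtain ⟨ε, hε, hpos⟩ := (hev.and self_mem_nhdsWithin).exists
  have hpos : 0 < ε := hpos
  refine ⟨hS.trans hTG, m - ε • X, fun p hp => ?_⟩
  simp only [LinearMap.sub_apply, LinearMap.smul_apply, smul_eq_mul]
  by_cases hpT : p ∈ T
  · rw [hX p hpT, (hm p hp).2.2 hpT]
    split_ifs with h
    · simp [h]
    · constructor
      · linarith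
      · simp [h, hpos.ne']
  · have := hε p hp hpT
    exact ⟨this.le, iff_of_false this.ne fun h => hpT (hS h)⟩

end Existence

/-! ### Lower faces cover each cone and fit together to a fan. -/

section

open Filter Topology

variable {n : ℕ}

/-- Every point of a cone lies over a lower face. -/
theorem exists_isLowerFace (h : (Fin n → ℝ) → ℝ) (G : Finset (Fin n → ℝ))
    (L : (Fin n → ℝ) →ₗ[ℝ] ℝ) (hL : ∀ p ∈ G, L p = 1) {x : Fin n → ℝ}
    (hx : x ∈ PointedCone.hull ℝ (G : Set (Fin n → ℝ))) :
    ∃ T, IsLowerFace h G T ∧ x ∈ PointedCone.hull ℝ (T : Set (Fin n → ℝ)) := by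
  classical
  -- The functional L bounds the coefficients, so the representations of x form a compact set and
  -- the lowest height μ over x is attained.
  have hsumL : ∀ c : G → ℝ, ∑ p, c p • (p : Fin n → ℝ) = x → ∑ p, c p = L x := by
    rintro c rfl
    simp [hL]
  let C : Set (G → ℝ) := {c | (∀ p, 0 ≤ c p) ∧ ∑ p, c p • (p : Fin n → ℝ) = x}
  have hC : IsCompact C := by
    refine (isCompact_Icc (a := (0 : G → ℝ)) (b := fun _ => L x)).of_isClosed_subset ?_ ?_
    · refine IsClosed.and ?_ ?_
      · simp only [Set.ofPred_forall]
        exact isClosed_iInter fun p => isClosed_le continuous_const (continuous_apply p)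
      · exact isClosed_eq (by fun_prop) continuous_const
    · intro c hc
      refine ⟨hc.1, fun p => ?_⟩
      rw [← hsumL c hc.2]
      exact Finset.single_le_sum (f := c) (fun q _ => hc.1 q) (Finset.mem_univ p)
  have hCne : C.Nonempty := by
    obtain ⟨c, hc, hsum⟩ := mem_hull_finset.1 hx
    exact ⟨fun p => c p, fun p => hc p, by
      rw [← hsum, ← Finset.sum_coe_sort G (fun p => c p • p)]⟩
  obtain ⟨c, ⟨hc0, hcx⟩, hmin⟩ := hC.exists_isMinOn hCne
    (f := fun c => ∑ p, c p * h p) (Continuous.continuousOn (by fun_prop))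
  let μ := ∑ p, c p * h p
  have hmin' : ∀ c' ∈ C, μ ≤ ∑ p, c' p * h p := fun c' hc' => hmin hc'
  -- Linear programming duality: by minimality of μ, the vector (0, -1) is not in the cone generated
  -- by (-x, -μ) and the lifted points. Dividing the separating functional by its last coefficient b
  -- > 0 gives m with m ≤ h on `G` and μ ≤ m x.
  obtain ⟨M, hM, hMz⟩ := exists_separating (Finset.univ : Finset (Option G))
    (fun o => o.elim (-x, -μ) (fun p => ((p : Fin n → ℝ), h p)))
    ((0, -1) : (Fin n → ℝ) × ℝ) (by
      intro a ha hsum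
      rw [Fintype.sum_option] at hsum
      simp only [Option.elim] at hsum
      have h1 := congrArg Prod.fst hsum
      have h2 := congrArg Prod.snd hsum
      simp only [Prod.fst_add, Prod.snd_add, Prod.smul_fst, Prod.smul_snd, Prod.fst_sum,
        Prod.snd_sum, smul_eq_mul, smul_neg] at h1 h2
      have h1' : ∑ p : G, a (some p) • (p : Fin n → ℝ) = a none • x := by
        rw [← sub_eq_zero, ← h1]; abel
      rcases (ha none).eq_or_lt with h0 | h0
      · rw [← h0, zero_smul] at h1'
        have h3 : ∑ p : G, a (some p) = 0 := by
          have := congrArg L h1'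
          simpa [hL] using this
        have h4 : ∀ p : G, a (some p) = 0 := fun p =>
          (Finset.sum_eq_zero_iff_of_nonneg fun p _ => ha _).1 h3 p (Finset.mem_univ p)
        simp [h4, ← h0] at h2
      · have h5 := hmin' (fun p => (a none)⁻¹ * a (some p))
          ⟨fun p => mul_nonneg (inv_nonneg.2 h0.le) (ha _), by
            simp only [mul_smul, ← Finset.smul_sum]
            rw [h1', smul_smul, inv_mul_cancel₀ h0.ne', one_smul]⟩
        simp only [mul_assoc, ← Finset.mul_sum] at h5
        rw [le_inv_mul_iff₀ h0] at h5
        linarith)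
  let b := M (0, 1)
  have hb : 0 < b := by
    have : M (0, -1) = -b := by
      rw [show ((0, -1) : (Fin n → ℝ) × ℝ) = -(0, 1) by simp, map_neg]
    linarith
  have hMdec : ∀ y r, M (y, r) = M (y, 0) + r * b := by
    intro y r
    rw [show ((y, r) : (Fin n → ℝ) × ℝ) = (y, 0) + r • (0, 1) by simp, map_add, map_smul,
      smul_eq_mul]
  let m : (Fin n → ℝ) →ₗ[ℝ] ℝ := -b⁻¹ • M ∘ₗ LinearMap.inl ℝ _ _
  have hmdef : ∀ y, M (y, 0) = -b * m y := fun y => by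
    simp only [m, LinearMap.smul_apply, LinearMap.comp_apply, LinearMap.inl_apply, smul_eq_mul]
    field_simp
  have hm1 : ∀ p ∈ G, m p ≤ h p := by
    intro p hp
    have := hM (some ⟨p, hp⟩) (Finset.mem_univ _)
    simp only [Option.elim] at this
    rw [hMdec, hmdef] at this
    nlinarith
  have hm2 : μ ≤ m x := by
    have := hM none (Finset.mem_univ _)
    simp only [Option.elim] at this
    rw [hMdec, hmdef, map_neg] at this
    nlinarith
  -- Complementary slackness: the nonnegative terms c p (h p - m p) have a sum at most zero.
  have hm3 : ∀ p : G, 0 < c p → m p = h p := by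
    intro p hp
    have h1 : m x = ∑ p : G, c p * m p := by
      rw [← hcx]; simp
    have h2 : ∑ p : G, c p * (h p - m p) ≤ 0 := by
      simp only [mul_sub, Finset.sum_sub_distrib]
      rw [← h1]; linarith
    have h3 : ∀ p ∈ (Finset.univ : Finset G), 0 ≤ c p * (h p - m p) := fun p _ =>
      mul_nonneg (hc0 p) (sub_nonneg.2 (hm1 p p.2))
    have h4 := (Finset.sum_eq_zero_iff_of_nonneg h3).1 (le_antisymm h2 (Finset.sum_nonneg h3)) p
      (Finset.mem_univ p)
    rcases mul_eq_zero.1 h4 with h | h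
    · exact absurd h hp.ne'
    · linarith
  refine ⟨G.filter fun p => m p = h p, ⟨Finset.filter_subset _ _, m, fun p hp =>
    ⟨hm1 p hp, by simp [hp]⟩⟩, ?_⟩
  rw [← hcx]
  refine Submodule.sum_mem _ fun p _ => ?_
  rcases (hc0 p).eq_or_lt with h0 | h0
  · rw [← h0, zero_smul]; exact Submodule.zero_mem _
  · exact PointedCone.smul_mem _ h0.le (Submodule.subset_span (by simp [hm3 p h0]))

namespace RationalFan

variable (Δ : RationalFan n)

theorem finite_primGens {σ : PointedCone ℝ (Fin n → ℝ)} (hσ : σ ∈ Δ.cones) :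
    (primGens σ).Finite := (Δ.rational σ hσ).primGens_finite

theorem hull_primGens {σ : PointedCone ℝ (Fin n → ℝ)} (hσ : σ ∈ Δ.cones) :
    PointedCone.hull ℝ (primGens σ) = σ := (Δ.rational σ hσ).hull_primGens (Δ.salient σ hσ)

/-- A Gorenstein fan has a crepant simplicial subdivision. -/
theorem exists_crepantSimplicialSubdivision {K : (Fin n → ℝ) → ℝ}
    (hK : Δ.IsGorensteinFunction K) :
    ∃ Δ' : RationalFan n, Δ'.IsCrepantSimplicialSubdivision Δ K := by
  classical
  have hfin : (⋃ σ ∈ Δ.cones, primGens σ).Finite :=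
    Δ.finite.biUnion fun σ hσ => Δ.finite_primGens hσ
  obtain ⟨h, hh⟩ := exists_generic_heights hfin.toFinset
  let G : PointedCone ℝ (Fin n → ℝ) → Finset (Fin n → ℝ) := fun σ =>
    hfin.toFinset.filter (· ∈ primGens σ)
  have hG : ∀ σ p, p ∈ G σ → p ∈ primGens σ := fun σ p hp => (Finset.mem_filter.1 hp).2
  have hGc : ∀ σ (hσ : σ ∈ Δ.cones), (G σ : Set (Fin n → ℝ)) = primGens σ := fun σ hσ => by
    ext p
    simp only [G, Finset.coe_filter, Set.Finite.mem_toFinset, Set.mem_iUnion]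
    exact ⟨fun h => h.2, fun h => ⟨⟨σ, hσ, h⟩, h⟩⟩
  have hGsub : ∀ σ, G σ ⊆ hfin.toFinset := fun σ => Finset.filter_subset _ _
  have hindep : ∀ {σ T}, IsLowerFace h (G σ) T →
      LinearIndepOn ℝ id (T : Set (Fin n → ℝ)) := by
    rintro σ T ⟨hT, m, hm⟩
    exact hh T (hT.trans (hGsub σ)) m fun p hp => (hm p (hT hp)).2.2 hp
  have hprim : ∀ {σ T}, IsLowerFace h (G σ) T →
      primGens (PointedCone.hull ℝ (T : Set (Fin n → ℝ))) = T := fun hT =>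
    primGens_hull (hindep hT) fun p hp => (hG _ p (hT.1 hp)).1
  have hle : ∀ {σ T}, IsLowerFace h (G σ) T →
      PointedCone.hull ℝ (T : Set (Fin n → ℝ)) ≤ σ := fun hT =>
    Submodule.span_le.2 fun p hp => primGens_subset (hG _ p (hT.1 hp))
  have hcap : ∀ {σ₁} (_ : σ₁ ∈ Δ.cones) {T₁} (_ : IsLowerFace h (G σ₁) T₁) {σ₂}
      (_ : σ₂ ∈ Δ.cones) {T₂} (_ : IsLowerFace h (G σ₂) T₂),
      PointedCone.hull ℝ (T₁ : Set (Fin n → ℝ)) ⊓ PointedCone.hull ℝ (T₂ : Set (Fin n → ℝ)) =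
        PointedCone.hull ℝ ((T₁ ∩ T₂ : Finset (Fin n → ℝ)) : Set (Fin n → ℝ)) := by
    intro σ₁ hσ₁ T₁ h1 σ₂ hσ₂ T₂ h2
    -- the generators of `T₂` with positive coefficients lie in `σ₁`
    have key : ∀ {σ₁} (_ : σ₁ ∈ Δ.cones) {T₁} (_ : IsLowerFace h (G σ₁) T₁) {σ₂}
      (_ : σ₂ ∈ Δ.cones) {T₂} (_ : IsLowerFace h (G σ₂) T₂), ∀ x,
      x ∈ PointedCone.hull ℝ (T₁ : Set (Fin n → ℝ)) →
      x ∈ PointedCone.hull ℝ (T₂ : Set (Fin n → ℝ)) →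
      ∀ p ∈ T₂, 0 < coord T₂ p x → p ∈ G σ₁ := by
      intro σ₁ hσ₁ T₁ h1 σ₂ hσ₂ T₂ h2 x hx1 hx2 p hp hpx
      have hface := Δ.inf_isFaceOf σ₂ hσ₂ σ₁ hσ₁
      have hpm : p ∈ σ₂ ⊓ σ₁ := by
        refine IsFaceOf.mem_of_sum hface (s := T₂) (f := id) (c := fun p => coord T₂ p x)
          (fun p hp => hle h2 (Submodule.subset_span hp))
          (fun p _ => coord_nonneg (hindep h2) hx2 p) ?_ hp hpx
        show ∑ p ∈ T₂, coord T₂ p x • p ∈ _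
        rw [sum_coord_hull (hindep h2) hx2]
        exact ⟨hle h2 hx2, hle h1 hx1⟩
      have hf2 := Δ.inf_isFaceOf σ₁ hσ₁ σ₂ hσ₂
      rw [inf_comm] at hf2
      exact (hGc _ hσ₁).symm.subset (primGens_mono hf2 (mem_primGens_of_face hface
        (hG _ _ (h2.1 hp)) hpm))
    refine le_antisymm ?_ (le_inf (Submodule.span_mono (by simp)) (Submodule.span_mono (by simp)))
    rintro x ⟨hx1, hx2⟩
    have k1 := key hσ₁ h1 hσ₂ h2 x hx1 hx2
    have k2 := key hσ₂ h2 hσ₁ h1 x hx2 hx1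
    obtain ⟨hT1, m1, hm1⟩ := id h1
    obtain ⟨hT2, m2, hm2⟩ := id h2
    have e1 : ∑ p ∈ T₁, coord T₁ p x • p = x := sum_coord_hull (hindep h1) hx1
    have e2 : ∑ p ∈ T₂, coord T₂ p x • p = x := sum_coord_hull (hindep h2) hx2
    have a1 : m1 x = ∑ p ∈ T₁, coord T₁ p x * h p := by
      conv_lhs => rw [← e1]
      rw [map_sum]
      exact Finset.sum_congr rfl fun p hp => by
        rw [map_smul, smul_eq_mul, (hm1 p (hT1 hp)).2.2 hp]
    have a2 : m2 x = ∑ p ∈ T₂, coord T₂ p x * h p := by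
      conv_lhs => rw [← e2]
      rw [map_sum]
      exact Finset.sum_congr rfl fun p hp => by
        rw [map_smul, smul_eq_mul, (hm2 p (hT2 hp)).2.2 hp]
    have b1 : m1 x = ∑ p ∈ T₂, coord T₂ p x * m1 p := by
      conv_lhs => rw [← e2]
      rw [map_sum]; simp
    -- The expansion of x in T₁ lies on the graph of m₁ and weakly above that of m₂. This inequality
    -- makes the nonnegative sum of coord T₂ p x times (h p - m₁ p) vanish, so the generators of T₂
    -- carrying x lie on the graph of m₁ and belong to T₁.
    have b2 : m2 x ≤ m1 x := by
      have : m2 x = ∑ p ∈ T₁, coord T₁ p x * m2 p := by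
        conv_lhs => rw [← e1]
        rw [map_sum]; simp
      rw [this, a1]
      refine Finset.sum_le_sum fun p hp => ?_
      rcases (coord_nonneg (hindep h1) hx1 p).eq_or_lt with h0 | h0
      · rw [← h0]; simp
      · exact mul_le_mul_of_nonneg_left (hm2 p (k2 p hp h0)).1 h0.le
    have hterm : ∀ p ∈ T₂, 0 ≤ coord T₂ p x * (h p - m1 p) := by
      intro p hp
      rcases (coord_nonneg (hindep h2) hx2 p).eq_or_lt with h0 | h0
      · rw [← h0]; simp
      · exact mul_nonneg h0.le (sub_nonneg.2 (hm1 p (k1 p hp h0)).1)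
    have hsum0 : ∑ p ∈ T₂, coord T₂ p x * (h p - m1 p) = 0 := by
      refine le_antisymm ?_ (Finset.sum_nonneg hterm)
      simp only [mul_sub, Finset.sum_sub_distrib]
      rw [← a2, ← b1]; linarith
    refine mem_hull_of_coord (hindep h2) hx2 fun p hp hpx => ?_
    have h0 := (Finset.sum_eq_zero_iff_of_nonneg hterm).1 hsum0 p hp
    have h3 : m1 p = h p := by
      rcases mul_eq_zero.1 h0 with h | h
      · exact absurd h hpx.ne'
      · linarith
    simp [hp, (hm1 p (k1 p hp hpx)).2.1 h3]
  let Δ' : RationalFan n :=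
    { cones := {τ | ∃ σ ∈ Δ.cones, ∃ T, IsLowerFace h (G σ) T ∧
        PointedCone.hull ℝ (T : Set (Fin n → ℝ)) = τ}
      finite := by
        refine (hfin.toFinset.powerset.finite_toSet.image
          fun T : Finset (Fin n → ℝ) => PointedCone.hull ℝ (T : Set (Fin n → ℝ))).subset ?_
        rintro _ ⟨σ, hσ, T, hT, rfl⟩
        exact ⟨T, by simpa using hT.1.trans (hGsub σ), rfl⟩
      rational := by
        rintro _ ⟨σ, hσ, T, hT, rfl⟩
        exact ⟨T, T.finite_toSet, fun p hp => (hG _ p (hT.1 hp)).1.1, rfl⟩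
      salient := by
        rintro _ ⟨σ, hσ, T, hT, rfl⟩
        exact (Δ.salient σ hσ).anti (hle hT)
      face_mem := by
        rintro _ ⟨σ, hσ, T, hT, rfl⟩ F hF
        refine ⟨σ, hσ, T.filter (· ∈ F), hT.subset (hindep hT) (Finset.filter_subset _ _), ?_⟩
        conv_rhs => rw [eq_hull_of_isFaceOf (hindep hT) hF]
        congr 1
        ext p; simp
      inf_isFaceOf := by
        rintro _ ⟨σ, hσ, T, hT, rfl⟩ _ ⟨σ₂, hσ₂, T₂, hT₂, rfl⟩
        rw [hcap hσ hT hσ₂ hT₂]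
        exact hull_isFaceOf (hindep hT) Finset.inter_subset_left }
  refine ⟨Δ', ⟨⟨Set.Subset.antisymm ?_ ?_, ?_⟩, ?_, ?_⟩⟩
  · rintro x ⟨_, ⟨σ, hσ, T, hT, rfl⟩, hx⟩
    exact ⟨σ, hσ, hle hT hx⟩
  · rintro x ⟨σ, hσ, hx⟩
    obtain ⟨L, hL⟩ := (hK σ hσ).1
    obtain ⟨T, hT, hxT⟩ := exists_isLowerFace h (G σ) L (fun p hp => by
      have := hG _ p hp
      rw [← hL p (primGens_subset this), (hK σ hσ).2.2 p this]) (x := x)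
      (by rwa [hGc σ hσ, Δ.hull_primGens hσ])
    exact ⟨_, ⟨σ, hσ, T, hT, rfl⟩, hxT⟩
  · rintro _ ⟨σ, hσ, T, hT, rfl⟩
    exact ⟨σ, hσ, hle hT⟩
  · rintro _ ⟨σ, hσ, T, hT, rfl⟩
    exact ⟨T, T.finite_toSet, hindep hT, rfl⟩
  · rintro _ ⟨σ, hσ, T, hT, rfl⟩
    obtain ⟨⟨L, hL⟩, h2, h3⟩ := hK σ hσ
    refine ⟨⟨L, fun v hv => hL v (hle hT hv)⟩, fun v hv => h2 v (hle hT hv), fun v hv => h3 v ?_⟩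
    rw [hprim hT] at hv
    exact hG _ v (hT.1 hv)

end RationalFan

end

end EhrhartFan

namespace EhrhartFan

/-! ### Generators of simplicial cones -/

section Gens

variable {n : ℕ} {σ τ ρ : PointedCone ℝ (Fin n → ℝ)}

open Classical in
/-- The primitive generators of a cone as a finite set. -/
noncomputable def gens (σ : PointedCone ℝ (Fin n → ℝ)) : Finset (Fin n → ℝ) :=
  if h : (primGens σ).Finite then h.toFinset else ∅

/-- The cone `σ` is generated by linearly independent primitive lattice points. -/
structure IsPrimSimplicial (σ : PointedCone ℝ (Fin n → ℝ)) : Prop where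
  coe_gens : (gens σ : Set (Fin n → ℝ)) = primGens σ
  li : LinearIndepOn ℝ id (gens σ : Set (Fin n → ℝ))
  hull : PointedCone.hull ℝ (gens σ : Set (Fin n → ℝ)) = σ

theorem RationalFan.IsSimplicial.isPrimSimplicial {Δ : RationalFan n} (h : Δ.IsSimplicial)
    (hσ : σ ∈ Δ.cones) : IsPrimSimplicial σ := by
  have h1 : (gens σ : Set (Fin n → ℝ)) = primGens σ := by
    simp [gens, Δ.finite_primGens hσ]
  exact ⟨h1, by rw [h1]; exact linearIndepOn_primGens (h σ hσ), by rw [h1, Δ.hull_primGens hσ]⟩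

namespace IsPrimSimplicial

variable (h : IsPrimSimplicial σ)
include h

theorem mem_gens {p : Fin n → ℝ} : p ∈ gens σ ↔ p ∈ primGens σ := by
  rw [← h.coe_gens]; rfl

theorem isPrimitive {p : Fin n → ℝ} (hp : p ∈ gens σ) : IsPrimitive p := (h.mem_gens.1 hp).1

theorem gens_mem {p : Fin n → ℝ} (hp : p ∈ gens σ) : p ∈ σ := primGens_subset (h.mem_gens.1 hp)

theorem coord_nonneg {x : Fin n → ℝ} (hx : x ∈ σ) (p : Fin n → ℝ) : 0 ≤ coord (gens σ) p x :=
  EhrhartFan.coord_nonneg h.li (by rwa [h.hull]) p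

theorem sum_coord {x : Fin n → ℝ} (hx : x ∈ σ) : ∑ p ∈ gens σ, coord (gens σ) p x • p = x :=
  sum_coord_hull h.li (by rwa [h.hull])

theorem gens_subset (hτ : IsPrimSimplicial τ) (hτσ : τ.IsFaceOf σ) : gens τ ⊆ gens σ :=
  fun _ hp => h.mem_gens.2 (primGens_mono hτσ (hτ.mem_gens.1 hp))

theorem mem_gens_face (hτ : IsPrimSimplicial τ) (hτσ : τ.IsFaceOf σ) {p : Fin n → ℝ}
    (hp : p ∈ gens σ) (hpτ : p ∈ τ) : p ∈ gens τ :=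
  hτ.mem_gens.2 (mem_primGens_of_face hτσ (h.mem_gens.1 hp) hpτ)

theorem coord_face (hτ : IsPrimSimplicial τ) (hτσ : τ.IsFaceOf σ) {x : Fin n → ℝ} (hx : x ∈ τ)
    {p : Fin n → ℝ} (hp : p ∈ gens τ) : coord (gens σ) p x = coord (gens τ) p x := by
  conv_lhs => rw [← hτ.sum_coord hx]
  rw [map_sum, Finset.sum_eq_single_of_mem p hp]
  · rw [map_smul, coord_self h.li (h.gens_subset hτ hτσ hp), smul_eq_mul, mul_one]
  · intro q hq hqp
    rw [map_smul, coord_of_ne h.li (h.gens_subset hτ hτσ hq) hqp.symm, smul_zero]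

theorem coord_face_eq_zero (hτ : IsPrimSimplicial τ) (hτσ : τ.IsFaceOf σ) {x : Fin n → ℝ}
    (hx : x ∈ τ) {p : Fin n → ℝ} (hp : p ∉ gens τ) : coord (gens σ) p x = 0 :=
  coord_eq_zero_of_mem_hull h.li (h.gens_subset hτ hτσ) (by rwa [hτ.hull]) hp

theorem mem_of_pos {x : Fin n → ℝ} (hx : x ∈ σ) (hτσ : τ.IsFaceOf σ) (hxτ : x ∈ τ)
    {p : Fin n → ℝ} (hp : p ∈ gens σ) (hpx : 0 < coord (gens σ) p x) : p ∈ τ := by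
  refine IsFaceOf.mem_of_sum hτσ (s := gens σ) (f := id) (c := fun p => coord (gens σ) p x)
    (fun p hp => h.gens_mem hp) (fun p _ => h.coord_nonneg hx p) ?_ hp hpx
  show ∑ p ∈ gens σ, coord (gens σ) p x • p ∈ τ
  rwa [h.sum_coord hx]

/-- The generators are independent, so the coefficients in the definition of `Box` can only be the
coordinates. -/
theorem mem_box_iff {v : Fin n → ℝ} : v ∈ Box σ ↔
    IsLatticePoint v ∧ v ∈ σ ∧ ∀ p, coord (gens σ) p v < 1 := by
  constructor
  · rintro ⟨hlat, c, hc, hc1, hsum⟩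
    rw [← h.coe_gens] at hc
    have hs : ∑ p ∈ gens σ, c p • p = v := by
      rw [← hsum, Finsupp.sum]
      exact (Finset.sum_subset (by exact_mod_cast hc) fun p _ hp => by
        simp [Finsupp.notMem_support_iff.1 hp]).symm
    refine ⟨hlat, ?_, fun p => ?_⟩
    · rw [← hs]
      exact Submodule.sum_mem _ fun p hp => PointedCone.smul_mem _ (hc1 p).1 (h.gens_mem hp)
    · by_cases hp : p ∈ gens σ
      · rw [← hs, coord_sum h.li c hp]; exact (hc1 p).2
      · rw [coord_off hp]; exact zero_lt_one
  · rintro ⟨hlat, hv, hlt⟩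
    refine ⟨hlat, Finsupp.onFinset (gens σ) (fun p => coord (gens σ) p v) fun p hp => ?_, ?_,
      fun p => ?_, ?_⟩
    · by_contra h'
      exact hp (by rw [coord_off h']; rfl)
    · rw [← h.coe_gens]; exact_mod_cast Finsupp.support_onFinset_subset
    · exact ⟨h.coord_nonneg hv p, hlt p⟩
    · rw [Finsupp.onFinset_sum _ (by simp), h.sum_coord hv]

theorem mem_box_face (hτ : IsPrimSimplicial τ) (hτσ : τ.IsFaceOf σ) {v : Fin n → ℝ}
    (hv : v ∈ Box σ) (hvτ : v ∈ τ) : v ∈ Box τ := by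
  obtain ⟨h1, h2, h3⟩ := h.mem_box_iff.1 hv
  refine hτ.mem_box_iff.2 ⟨h1, hvτ, fun p => ?_⟩
  by_cases hp : p ∈ gens τ
  · rw [← h.coord_face hτ hτσ hvτ hp]; exact h3 p
  · rw [coord_off hp]; exact zero_lt_one

end IsPrimSimplicial

end Gens

/-! ### Polynomial functions on simplicial cones -/

section PolyFun

variable {n : ℕ} {σ τ : PointedCone ℝ (Fin n → ℝ)}

theorem polyFun_ext {f g : polyFun σ} (h : ∀ x, f.1 x = g.1 x) : f = g := Subtype.ext (funext h)

theorem exists_linear_poly (l : (Fin n → ℝ) →ₗ[ℝ] ℝ) :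
    ∃ P : MvPolynomial (Fin n) ℝ, P.IsHomogeneous 1 ∧ ∀ x, MvPolynomial.eval x P = l x := by
  refine ⟨∑ i, MvPolynomial.C (l (Pi.single i 1)) * MvPolynomial.X i,
    MvPolynomial.IsHomogeneous.sum _ _ _ fun i _ => MvPolynomial.isHomogeneous_C_mul_X _ _,
    fun x => ?_⟩
  conv_rhs => rw [LinearMap.pi_apply_eq_sum_univ l x]
  simp only [map_sum, map_mul, MvPolynomial.eval_C, MvPolynomial.eval_X, smul_eq_mul]
  refine Finset.sum_congr rfl fun i _ => ?_
  rw [mul_comm]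
  congr 2
  funext j
  simp [Pi.single_apply, eq_comm]

/-- The restriction of a linear functional to a cone as a polynomial function. -/
noncomputable def linFun (σ : PointedCone ℝ (Fin n → ℝ)) (l : (Fin n → ℝ) →ₗ[ℝ] ℝ) : polyFun σ :=
  ⟨fun x => l x.1, by
    obtain ⟨P, -, hP⟩ := exists_linear_poly l
    exact ⟨P, funext fun x => (polyEval_apply σ P x).trans (hP x.1)⟩⟩

theorem linFun_mem_polyDeg (l : (Fin n → ℝ) →ₗ[ℝ] ℝ) : linFun σ l ∈ polyDeg σ 1 := by
  obtain ⟨P, hP1, hP⟩ := exists_linear_poly l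
  exact mem_polyDeg.2 ⟨P, hP1, funext fun x => (polyEval_apply σ P x).trans (hP x.1)⟩

theorem one_mem_polyDeg : (1 : polyFun σ) ∈ polyDeg σ 0 :=
  mem_polyDeg.2 ⟨1, MvPolynomial.isHomogeneous_one _ _, map_one _⟩

theorem prod_mem_polyDeg {α : Type*} (s : Finset α) (f : α → polyFun σ) (d : α → ℕ)
    (h : ∀ i ∈ s, f i ∈ polyDeg σ (d i)) : ∏ i ∈ s, f i ∈ polyDeg σ (∑ i ∈ s, d i) := by
  classical
  induction s using Finset.induction_on with
  | empty => simpa using one_mem_polyDeg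
  | insert a s ha ih =>
    rw [Finset.prod_insert ha, Finset.sum_insert ha]
    exact mul_mem_polyDeg (h a (Finset.mem_insert_self a s))
      (ih fun i hi => h i (Finset.mem_insert_of_mem hi))

theorem pow_mem_polyDeg {f : polyFun σ} {d : ℕ} (h : f ∈ polyDeg σ d) (k : ℕ) :
    f ^ k ∈ polyDeg σ (k * d) := by
  have := prod_mem_polyDeg (Finset.range k) (fun _ => f) (fun _ => d) fun _ _ => h
  simpa using this

theorem polyFun_prod_apply {α : Type*} (s : Finset α) (f : α → polyFun σ) (x : σ) :
    (∏ i ∈ s, f i).1 x = ∏ i ∈ s, (f i).1 x := by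
  classical
  induction s using Finset.induction_on with
  | empty => rfl
  | insert a s ha ih => rw [Finset.prod_insert ha, Finset.prod_insert ha, ← ih]; rfl

/-- The monomial of exponent `a` in the coordinates of a simplicial cone. -/
noncomputable def mono (σ : PointedCone ℝ (Fin n → ℝ)) (a : (Fin n → ℝ) → ℕ) : polyFun σ :=
  ∏ p ∈ gens σ, linFun σ (coord (gens σ) p) ^ a p

theorem mono_apply (a : (Fin n → ℝ) → ℕ) (x : σ) :
    (mono σ a).1 x = ∏ p ∈ gens σ, coord (gens σ) p x.1 ^ a p := by
  rw [mono, polyFun_prod_apply]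
  rfl

theorem mono_mem_polyDeg (a : (Fin n → ℝ) → ℕ) : mono σ a ∈ polyDeg σ (∑ p ∈ gens σ, a p) :=
  prod_mem_polyDeg _ _ _ fun p _ => by
    simpa using pow_mem_polyDeg (linFun_mem_polyDeg (σ := σ) (coord (gens σ) p)) (a p)

/-- Polynomials in the coordinates of a simplicial cone as polynomial functions. -/
noncomputable def coordEval (σ : PointedCone ℝ (Fin n → ℝ)) :
    MvPolynomial (gens σ) ℝ →ₐ[ℝ] polyFun σ :=
  MvPolynomial.aeval fun p => linFun σ (coord (gens σ) p)

theorem coordEval_apply (P : MvPolynomial (gens σ) ℝ) (x : σ) :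
    (coordEval σ P).1 x = MvPolynomial.eval (fun p : gens σ => coord (gens σ) p x.1) P := by
  induction P using MvPolynomial.induction_on with
  | C a => simp only [coordEval, MvPolynomial.aeval_C, MvPolynomial.eval_C]; rfl
  | add p q hp hq =>
    rw [map_add, map_add, ← hp, ← hq]; rfl
  | mul_X p i hp =>
    rw [map_mul, map_mul, ← hp, MvPolynomial.eval_X, coordEval, MvPolynomial.aeval_X]; rfl

/-- Injective since the coordinates of points of σ fill an orthant, on which only the zero
polynomial vanishes; surjective since on σ the standard coordinates are linear in those of the cone.
-/
theorem IsPrimSimplicial.coordEval_bijective (h : IsPrimSimplicial σ) :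
    Function.Bijective (coordEval σ) := by
  constructor
  · refine (injective_iff_map_eq_zero _).2 fun P hP => ?_
    refine MvPolynomial.funext_set (fun _ => Set.Ici (0 : ℝ)) (fun _ => Set.Ici_infinite 0)
      fun t ht => ?_
    classical
    rw [map_zero]
    let c : (Fin n → ℝ) → ℝ := fun p => if hp : p ∈ gens σ then t ⟨p, hp⟩ else 0
    have hx : ∑ p ∈ gens σ, c p • p ∈ σ :=
      Submodule.sum_mem _ fun p hp => PointedCone.smul_mem _ (by
        simp only [c, hp, dif_pos]
        exact ht _ trivial) (h.gens_mem hp)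
    have := coordEval_apply P ⟨_, hx⟩
    rw [hP] at this
    have e : (fun p : gens σ => coord (gens σ) p (∑ p ∈ gens σ, c p • p)) = t := by
      funext p
      rw [coord_sum h.li c p.2]
      simp [c]
    rw [← e, ← this]
    rfl
  · let N : MvPolynomial (Fin n) ℝ →ₐ[ℝ] MvPolynomial (gens σ) ℝ :=
      MvPolynomial.aeval fun i => ∑ p : gens σ, MvPolynomial.C (p.1 i) * MvPolynomial.X p
    have hN : ((polyFun σ).val.comp (coordEval σ)).comp N = polyEval σ := by
      refine MvPolynomial.algHom_ext fun i => ?_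
      funext x
      rw [polyEval_apply]
      show (coordEval σ (N _)).1 x = _
      rw [coordEval_apply]
      simp only [N, MvPolynomial.aeval_X, map_sum, map_mul, MvPolynomial.eval_C,
        MvPolynomial.eval_X]
      have := congrFun (h.sum_coord x.2) i
      refine Eq.trans ?_ this
      rw [Finset.sum_apply, ← Finset.sum_coe_sort (gens σ)
        (fun p => (coord (gens σ) p x.1 • p) i)]
      exact Finset.sum_congr rfl fun p _ => by simp [mul_comm]
    rintro ⟨f, P, rfl⟩
    exact ⟨N P, Subtype.ext (DFunLike.congr_fun hN P)⟩

end PolyFun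

end EhrhartFan

namespace EhrhartFan

/-! ### The basis of the box module indexed by the lattice points of the cone -/

section LatBasis

variable {n : ℕ} {σ τ : PointedCone ℝ (Fin n → ℝ)}

/-- The lattice points of a cone. -/
abbrev LatIn (σ : PointedCone ℝ (Fin n → ℝ)) : Type := {w : Fin n → ℝ // IsLatticePoint w ∧ w ∈ σ}

/-- The integral parts of the coordinates of a point of a simplicial cone. -/
noncomputable def expo (σ : PointedCone ℝ (Fin n → ℝ)) (w p : Fin n → ℝ) : ℕ :=
  ⌊coord (gens σ) p w⌋₊

/-- The part of a point of a simplicial cone that lies in the half-open box. -/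
noncomputable def boxPart (σ : PointedCone ℝ (Fin n → ℝ)) (w : Fin n → ℝ) : Fin n → ℝ :=
  w - ∑ p ∈ gens σ, (expo σ w p : ℝ) • p

namespace IsPrimSimplicial

variable (h : IsPrimSimplicial σ)
include h

theorem boxPart_eq {w : Fin n → ℝ} (hw : w ∈ σ) :
    boxPart σ w = ∑ p ∈ gens σ, (coord (gens σ) p w - expo σ w p) • p := by
  conv_lhs => rw [boxPart]; arg 1; rw [← h.sum_coord hw]
  simp only [sub_smul, Finset.sum_sub_distrib]

theorem coord_boxPart {w : Fin n → ℝ} (hw : w ∈ σ) {p : Fin n → ℝ} (hp : p ∈ gens σ) :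
    coord (gens σ) p (boxPart σ w) = coord (gens σ) p w - expo σ w p := by
  rw [h.boxPart_eq hw, coord_sum h.li (fun p => coord (gens σ) p w - expo σ w p) hp]

theorem isLatticePoint_sum (a : (Fin n → ℝ) → ℕ) :
    IsLatticePoint (∑ p ∈ gens σ, (a p : ℝ) • p) :=
  IsLatticePoint.sum _ _ fun p hp => by
    rw [Nat.cast_smul_eq_nsmul]
    exact (h.isPrimitive hp).1.nsmul _

theorem boxPart_mem {w : Fin n → ℝ} (hw : IsLatticePoint w) (hwσ : w ∈ σ) : boxPart σ w ∈ Box σ := by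
  refine h.mem_box_iff.2 ⟨hw.sub (h.isLatticePoint_sum _), ?_, fun p => ?_⟩
  · rw [h.boxPart_eq hwσ]
    exact Submodule.sum_mem _ fun p hp => PointedCone.smul_mem _
      (sub_nonneg.2 (Nat.floor_le (h.coord_nonneg hwσ p))) (h.gens_mem hp)
  · by_cases hp : p ∈ gens σ
    · rw [h.coord_boxPart hwσ hp]
      have := Nat.lt_floor_add_one (coord (gens σ) p w)
      rw [expo]; linarith
    · rw [coord_off hp]; exact zero_lt_one

/-- The basis element of the box module belonging to a lattice point of the cone. -/
noncomputable def latElt (w : LatIn σ) : BoxModule σ :=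
  boxSingle ⟨boxPart σ w.1, h.boxPart_mem w.2.1 w.2.2⟩ (mono σ (expo σ w.1))

omit h in
/-- The lattice point with given box part and integral parts of the coordinates. -/
noncomputable def latPoint (i : Σ _ : Box σ, (gens σ →₀ ℕ)) : Fin n → ℝ :=
  i.1.1 + ∑ p : gens σ, (i.2 p : ℝ) • p.1

omit h in
theorem latPoint_eq (i : Σ _ : Box σ, (gens σ →₀ ℕ)) :
    ∃ a : (Fin n → ℝ) → ℕ, (∀ p : gens σ, a p = i.2 p) ∧
      latPoint i = i.1.1 + ∑ p ∈ gens σ, (a p : ℝ) • p := by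
  classical
  refine ⟨fun p => if hp : p ∈ gens σ then i.2 ⟨p, hp⟩ else 0, fun p => by simp, ?_⟩
  rw [latPoint, ← Finset.sum_coe_sort (gens σ) (fun p =>
    (((if hp : p ∈ gens σ then i.2 ⟨p, hp⟩ else 0 : ℕ)) : ℝ) • p)]
  simp

theorem latPoint_mem (i : Σ _ : Box σ, (gens σ →₀ ℕ)) :
    IsLatticePoint (latPoint i) ∧ latPoint i ∈ σ := by
  obtain ⟨a, -, ha⟩ := latPoint_eq i
  obtain ⟨h1, h2, -⟩ := h.mem_box_iff.1 i.1.2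
  rw [ha]
  exact ⟨h1.add (h.isLatticePoint_sum a), Submodule.add_mem _ h2 (Submodule.sum_mem _ fun p hp =>
    PointedCone.smul_mem _ (Nat.cast_nonneg _) (h.gens_mem hp))⟩

theorem expo_latPoint (i : Σ _ : Box σ, (gens σ →₀ ℕ)) (p : gens σ) :
    expo σ (latPoint i) p = i.2 p := by
  obtain ⟨a, ha1, ha⟩ := latPoint_eq i
  obtain ⟨-, h2, h3⟩ := h.mem_box_iff.1 i.1.2
  rw [expo, ha, map_add, coord_sum h.li (fun p => (a p : ℝ)) p.2, ← ha1,
    Nat.floor_add_natCast (h.coord_nonneg h2 p), Nat.floor_eq_zero.2 (h3 p), zero_add]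

theorem boxPart_latPoint (i : Σ _ : Box σ, (gens σ →₀ ℕ)) : boxPart σ (latPoint i) = i.1.1 := by
  rw [boxPart, ← Finset.sum_coe_sort (gens σ) (fun p => (expo σ (latPoint i) p : ℝ) • p)]
  simp only [h.expo_latPoint]
  rw [latPoint, add_sub_cancel_right]

/-- Lattice points of a simplicial cone correspond to pairs of a point of the box and exponents. -/
noncomputable def latEquiv : (Σ _ : Box σ, (gens σ →₀ ℕ)) ≃ LatIn σ :=
  Equiv.ofBijective (fun i => ⟨latPoint i, h.latPoint_mem i⟩) (by
    constructor
    · rintro ⟨v, a⟩ ⟨v', a'⟩ hi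
      have hi : latPoint (σ := σ) ⟨v, a⟩ = latPoint ⟨v', a'⟩ := congrArg Subtype.val hi
      have h1 : v = v' := Subtype.ext (by
        rw [← h.boxPart_latPoint ⟨v, a⟩, ← h.boxPart_latPoint ⟨v', a'⟩, hi])
      have h2 : a = a' := Finsupp.ext fun p => by
        rw [← h.expo_latPoint ⟨v, a⟩, ← h.expo_latPoint ⟨v', a'⟩, hi]
      rw [h1, h2]
    · rintro ⟨w, hw, hwσ⟩
      refine ⟨⟨⟨boxPart σ w, h.boxPart_mem hw hwσ⟩,
        Finsupp.equivFunOnFinite.symm fun p => expo σ w p⟩, Subtype.ext ?_⟩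
      simp only [latPoint, Finsupp.equivFunOnFinite_symm_apply_apply]
      rw [Finset.sum_coe_sort (gens σ) (fun p => (expo σ w p : ℝ) • p), boxPart, sub_add_cancel])

/-- The basis of the ring of polynomial functions on a simplicial cone given by monomials. -/
noncomputable def monoBasis : Module.Basis (gens σ →₀ ℕ) ℝ (polyFun σ) :=
  (MvPolynomial.basisMonomials (gens σ) ℝ).map
    (LinearEquiv.ofBijective (coordEval σ).toLinearMap h.coordEval_bijective)

theorem monoBasis_apply (a : gens σ →₀ ℕ) (b : (Fin n → ℝ) → ℕ) (hab : ∀ p : gens σ, b p = a p) :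
    h.monoBasis a = mono σ b := by
  have : h.monoBasis a = coordEval σ (MvPolynomial.monomial a 1) := by
    rw [monoBasis, Module.Basis.map_apply, MvPolynomial.coe_basisMonomials]; rfl
  rw [this]
  refine polyFun_ext fun x => ?_
  rw [coordEval_apply, mono_apply, MvPolynomial.eval_monomial, one_mul, Finsupp.prod_fintype _ _
    (by simp), ← Finset.prod_coe_sort (gens σ) (fun p => coord (gens σ) p x.1 ^ b p)]
  simp [hab]

/-- The basis of the box module indexed by the lattice points of the cone. -/
noncomputable def latBasis : Module.Basis (LatIn σ) ℝ (BoxModule σ) :=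
  (show Module.Basis (Σ _ : Box σ, (gens σ →₀ ℕ)) ℝ (BoxModule σ) from
    Finsupp.basis fun _ : Box σ => h.monoBasis).reindex h.latEquiv

theorem latBasis_apply (w : LatIn σ) : h.latBasis w = h.latElt w := by
  obtain ⟨i, rfl⟩ := h.latEquiv.surjective w
  have h1 : h.latBasis (h.latEquiv i) = boxSingle i.1 (h.monoBasis i.2) := by
    rw [latBasis, Module.Basis.reindex_apply, Equiv.symm_apply_apply]
    exact congrFun (Finsupp.coe_basis fun _ : Box σ => h.monoBasis) i
  have h2 : (h.latEquiv i).1 = latPoint i := rfl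
  rw [h1, h.monoBasis_apply i.2 (expo σ (latPoint i)) (h.expo_latPoint i), latElt]
  congr 1
  congr 1
  exact Subtype.ext (h.boxPart_latPoint i).symm

/-- Restriction to a face sends the basis element of a lattice point to the one of the same point,
or to zero if the point is outside of the face. -/
theorem boxRes_latElt (hτ : IsPrimSimplicial τ) (hτσ : τ.IsFaceOf σ) (w : LatIn σ) :
    (∀ hw : w.1 ∈ τ, boxRes hτσ (h.latElt w) = hτ.latElt ⟨w.1, w.2.1, hw⟩) ∧
      (w.1 ∉ τ → boxRes hτσ (h.latElt w) = 0) := by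
  obtain ⟨w, hlat, hwσ⟩ := w
  constructor
  · intro hw
    have hw : w ∈ τ := hw
    have e0 : ∀ p ∈ gens σ, p ∉ gens τ → expo σ w p = 0 := fun p _ hp => by
      rw [expo, h.coord_face_eq_zero hτ hτσ hw hp, Nat.floor_zero]
    have e1 : ∀ p ∈ gens τ, expo σ w p = expo τ w p := fun p hp => by
      rw [expo, expo, h.coord_face hτ hτσ hw hp]
    have hbox : boxPart σ w = boxPart τ w := by
      rw [boxPart, boxPart, ← Finset.sum_subset (h.gens_subset hτ hτσ) fun p hp hp' => by
        rw [e0 p hp hp']; simp]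
      exact congrArg _ (Finset.sum_congr rfl fun p hp => by rw [e1 p hp])
    have hmono : polyRes hτσ.le (mono σ (expo σ w)) = mono τ (expo τ w) := by
      refine polyFun_ext fun x => ?_
      refine (mono_apply (σ := σ) (expo σ w) ⟨x.1, hτσ.le x.2⟩).trans ?_
      rw [mono_apply, ← Finset.prod_subset (h.gens_subset hτ hτσ) fun p hp hp' => by
        rw [e0 p hp hp', pow_zero]]
      exact Finset.prod_congr rfl fun p hp => by rw [e1 p hp, h.coord_face hτ hτσ x.2 hp]
    refine boxModule_ext fun v => ?_
    rw [boxCoeff_boxRes, latElt, latElt]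
    by_cases hv : v.1 = boxPart σ w
    · have h1 : (⟨v.1, box_mono hτσ v.2⟩ : Box σ) = ⟨boxPart σ w, h.boxPart_mem hlat hwσ⟩ :=
        Subtype.ext hv
      have h2 : v = ⟨boxPart τ w, hτ.boxPart_mem hlat hw⟩ := Subtype.ext (hv.trans hbox)
      rw [h1, boxCoeff_single_self, hmono, h2, boxCoeff_single_self]
    · rw [boxCoeff_single_of_ne fun h => hv (congrArg Subtype.val h).symm, map_zero,
        boxCoeff_single_of_ne fun h => hv ((congrArg Subtype.val h).symm.trans hbox.symm)]
  · intro hw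
    refine boxModule_ext fun v => ?_
    rw [boxCoeff_boxRes, latElt, map_zero]
    by_cases hv : v.1 = boxPart σ w
    · have h1 : (⟨v.1, box_mono hτσ v.2⟩ : Box σ) = ⟨boxPart σ w, h.boxPart_mem hlat hwσ⟩ :=
        Subtype.ext hv
      rw [h1, boxCoeff_single_self]
      have hvτ : boxPart σ w ∈ τ := hv ▸ (hτ.mem_box_iff.1 v.2).2.1
      -- The box part lies in τ but w does not, so the monomial involves a generator outside τ, and
      -- its coordinate vanishes on τ.
      obtain ⟨p, hp, hpx, hpτ⟩ : ∃ p ∈ gens σ, expo σ w p ≠ 0 ∧ p ∉ gens τ := by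
        by_contra! H
        refine hw ?_
        have : w = boxPart σ w + ∑ p ∈ gens σ, (expo σ w p : ℝ) • p := by
          rw [boxPart, sub_add_cancel]
        show w ∈ τ
        rw [this]
        refine Submodule.add_mem _ hvτ (Submodule.sum_mem _ fun p hp => ?_)
        by_cases h0 : expo σ w p = 0
        · rw [h0]; simp
        · exact PointedCone.smul_mem _ (Nat.cast_nonneg _) (hτ.gens_mem (H p hp h0))
      refine polyFun_ext fun x => ?_
      refine (mono_apply (σ := σ) (expo σ w) ⟨x.1, hτσ.le x.2⟩).trans ?_
      refine Finset.prod_eq_zero hp ?_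
      rw [h.coord_face_eq_zero hτ hτσ x.2 hpτ, zero_pow hpx]
    · rw [boxCoeff_single_of_ne fun h => hv (congrArg Subtype.val h).symm, map_zero]

/-- In terms of coefficients at lattice points, restricting to a face is restricting a function. The
description of sections rests on this. -/
theorem latBasis_repr_boxRes (hτ : IsPrimSimplicial τ) (hτσ : τ.IsFaceOf σ) (s : BoxModule σ)
    (w : LatIn τ) :
    hτ.latBasis.repr (boxRes hτσ s) w = h.latBasis.repr s ⟨w.1, w.2.1, hτσ.le w.2.2⟩ := by
  classical
  have : (Finsupp.lapply w ∘ₗ hτ.latBasis.repr.toLinearMap) ∘ₗ boxRes hτσ =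
      Finsupp.lapply ⟨w.1, w.2.1, hτσ.le w.2.2⟩ ∘ₗ h.latBasis.repr.toLinearMap := by
    refine h.latBasis.ext fun u => ?_
    simp only [LinearMap.comp_apply, LinearEquiv.coe_coe, Finsupp.lapply_apply,
      Module.Basis.repr_self]
    rw [h.latBasis_apply]
    by_cases hu : u.1 ∈ τ
    · rw [(h.boxRes_latElt hτ hτσ u).1 hu, ← hτ.latBasis_apply, Module.Basis.repr_self,
        Finsupp.single_apply, Finsupp.single_apply]
      simp only [Subtype.ext_iff]
    · rw [(h.boxRes_latElt hτ hτσ u).2 hu, map_zero, Finsupp.single_apply, if_neg]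
      · rfl
      · intro h
        exact hu (h ▸ w.2.2)
  exact LinearMap.congr_fun this s

/-- The element of the box module with given coefficients at the lattice points. -/
noncomputable def ofCoeff (c : (Fin n → ℝ) →₀ ℝ) : BoxModule σ :=
  h.latBasis.repr.symm (c.comapDomain Subtype.val Subtype.val_injective.injOn)

theorem repr_ofCoeff (c : (Fin n → ℝ) →₀ ℝ) (w : LatIn σ) :
    h.latBasis.repr (h.ofCoeff c) w = c w.1 := by
  rw [ofCoeff, LinearEquiv.apply_symm_apply]
  rfl

theorem eq_ofCoeff {s : BoxModule σ} {c : (Fin n → ℝ) →₀ ℝ}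
    (hs : ∀ w, h.latBasis.repr s w = c w.1) : s = h.ofCoeff c :=
  h.latBasis.repr.injective (Finsupp.ext fun w => by rw [hs, repr_ofCoeff])

theorem boxRes_ofCoeff (hτ : IsPrimSimplicial τ) (hτσ : τ.IsFaceOf σ) (c : (Fin n → ℝ) →₀ ℝ) :
    boxRes hτσ (h.ofCoeff c) = hτ.ofCoeff c :=
  hτ.eq_ofCoeff fun w => by rw [h.latBasis_repr_boxRes hτ hτσ, h.repr_ofCoeff]

theorem latElt_mem_boxDeg {K : (Fin n → ℝ) → ℝ} {L : (Fin n → ℝ) →ₗ[ℝ] ℝ}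
    (hL : ∀ v ∈ σ, K v = L v) (hone : ∀ p ∈ primGens σ, K p = 1) (w : LatIn σ) {k : ℕ}
    (hk : K w.1 = k) : h.latElt w ∈ boxDeg K σ k := by
  refine (mem_boxDeg K).2 fun v => ?_
  by_cases hv : (⟨boxPart σ w.1, h.boxPart_mem w.2.1 w.2.2⟩ : Box σ) = v
  · subst hv
    refine Or.inr ⟨_, ?_, by rw [latElt, boxCoeff_single_self]; exact mono_mem_polyDeg _⟩
    have h1 : ∀ p ∈ gens σ, L p = 1 := fun p hp => by
      rw [← hL p (h.gens_mem hp), hone p (h.mem_gens.1 hp)]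
    have h2 := (h.mem_box_iff.1 (h.boxPart_mem w.2.1 w.2.2)).2.1
    rw [hL _ h2, boxPart, map_sub, ← hL _ w.2.2, hk, map_sum]
    simp only [map_smul, smul_eq_mul]
    rw [Finset.sum_congr rfl fun p hp => by rw [h1 p hp, mul_one]]
    push_cast
    ring
  · exact Or.inl (boxCoeff_single_of_ne hv _)

end IsPrimSimplicial

end LatBasis

end EhrhartFan

namespace EhrhartFan

/-! ### Sections of the box sheaf -/

section Sections

variable {n : ℕ} {Δ Δ' : RationalFan n} {K : (Fin n → ℝ) → ℝ}

theorem RationalFan.IsSimplicial.prim (h : Δ'.IsSimplicial) (τ : Δ'.Cone) : IsPrimSimplicial τ.1 :=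
  h.isPrimSimplicial τ.2

/-- A compatible family of elements of the stalks of the box sheaf is determined by coefficients at
the lattice points. -/
theorem exists_coeff (hs : Δ'.IsSimplicial) (U : LowerSet Δ'.Cone) (s : ∀ τ : Δ'.Cone, τ ∈ U → BoxModule τ.1)
    (hres : ∀ (τ ρ : Δ'.Cone) (hτ : τ ∈ U) (hρ : ρ ∈ U) (h : ρ ≤ τ),
      boxRes ((Δ'.isFaceOf_iff_le ρ τ).2 h) (s τ hτ) = s ρ hρ) :
    ∃ c : (Fin n → ℝ) →₀ ℝ, ∀ τ hτ, s τ hτ = (hs.prim τ).ofCoeff c := by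
  classical
  let g : ∀ τ : Δ'.Cone, τ ∈ U → (Fin n → ℝ) →₀ ℝ := fun τ hτ =>
    ((hs.prim τ).latBasis.repr (s τ hτ)).mapDomain Subtype.val
  have hg : ∀ τ hτ w (hw : IsLatticePoint w ∧ w ∈ τ.1),
      g τ hτ w = (hs.prim τ).latBasis.repr (s τ hτ) ⟨w, hw⟩ := fun τ hτ w hw =>
    Finsupp.mapDomain_apply Subtype.val_injective _ (⟨w, hw⟩ : LatIn τ.1)
  have hg0 : ∀ τ hτ w, ¬ (IsLatticePoint w ∧ w ∈ τ.1) → g τ hτ w = 0 := fun τ hτ w hw =>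
    Finsupp.mapDomain_of_notMem_range _ _ (by simpa using hw)
  have hface : ∀ (τ ρ : Δ'.Cone) (hτ : τ ∈ U) (hρ : ρ ∈ U) (_ : ρ ≤ τ) (w),
      IsLatticePoint w → w ∈ ρ.1 → g τ hτ w = g ρ hρ w := by
    intro τ ρ hτ hρ h w hw hwρ
    rw [hg τ hτ w ⟨hw, h hwρ⟩, hg ρ hρ w ⟨hw, hwρ⟩, ← hres τ ρ hτ hρ h]
    exact ((hs.prim τ).latBasis_repr_boxRes (hs.prim ρ) _ _ (⟨w, hw, hwρ⟩ : LatIn ρ.1)).symm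
  -- Two cones through w are compared on their common face.
  have hind : ∀ (τ ρ : Δ'.Cone) (hτ : τ ∈ U) (hρ : ρ ∈ U) (w), IsLatticePoint w → w ∈ τ.1 →
      w ∈ ρ.1 → g τ hτ w = g ρ hρ w := by
    intro τ ρ hτ hρ w hw hwτ hwρ
    let κ : Δ'.Cone := ⟨τ.1 ⊓ ρ.1, Δ'.face_mem _ τ.2 _ (Δ'.inf_isFaceOf _ τ.2 _ ρ.2)⟩
    have h1 : κ ≤ τ := (inf_le_left : τ.1 ⊓ ρ.1 ≤ τ.1)
    have h2 : κ ≤ ρ := (inf_le_right : τ.1 ⊓ ρ.1 ≤ ρ.1)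
    rw [hface τ κ hτ (U.lower h1 hτ) h1 w hw ⟨hwτ, hwρ⟩,
      hface ρ κ hρ (U.lower h1 hτ) h2 w hw ⟨hwτ, hwρ⟩]
  have : Fintype Δ'.Cone := Fintype.ofFinite _
  -- The coefficient is read off in any cone of `U` through w, and is zero if there is none.
  let f : (Fin n → ℝ) → ℝ := fun w =>
    if h : ∃ τ : Δ'.Cone, τ ∈ U ∧ w ∈ τ.1 then g h.choose h.choose_spec.1 w else 0
  let S : Finset (Fin n → ℝ) := Finset.univ.biUnion fun τ : Δ'.Cone =>
    if hτ : τ ∈ U then (g τ hτ).support else ∅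
  refine ⟨Finsupp.onFinset S f fun w hw => ?_, fun τ hτ => (hs.prim τ).eq_ofCoeff fun w => ?_⟩
  · simp only [f] at hw
    split_ifs at hw with h
    · refine Finset.mem_biUnion.2 ⟨h.choose, Finset.mem_univ _, ?_⟩
      rw [dif_pos h.choose_spec.1]
      exact Finsupp.mem_support_iff.2 hw
    · exact absurd rfl hw
  · have h : ∃ τ : Δ'.Cone, τ ∈ U ∧ w.1 ∈ τ.1 := ⟨τ, hτ, w.2.2⟩
    rw [Finsupp.onFinset_apply]
    simp only [f]
    rw [dif_pos h, ← hind τ h.choose hτ h.choose_spec.1 w.1 w.2.1 w.2.2 h.choose_spec.2,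
      hg τ hτ w.1 w.2]

variable (hs : Δ'.IsSimplicial) (hK : Δ'.IsGorensteinFunction K)

/-- The section of the push-forward of the box sheaf with given coefficients. -/
noncomputable def coeffStalk (c : (Fin n → ℝ) →₀ ℝ) (σ : Δ.Cone) :
    ((boxSheaf Δ' K hK).pushforward Δ).stalk σ :=
  ⟨fun τ => (hs.prim τ.1).ofCoeff c, fun τ ρ h =>
    (hs.prim τ.1).boxRes_ofCoeff (hs.prim ρ.1) ((Δ'.isFaceOf_iff_le ρ.1 τ.1).2 h) c⟩

theorem coeffStalk_apply (c : (Fin n → ℝ) →₀ ℝ) (σ : Δ.Cone)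
    (τ : {τ // τ ∈ GradedSheaf.preimage Δ' σ}) :
    (coeffStalk hs hK c σ).1 τ = (hs.prim τ.1).ofCoeff c := rfl

theorem coeffStalk_mem_sections (c : (Fin n → ℝ) →₀ ℝ) (U : LowerSet Δ.Cone) :
    (fun σ : {σ // σ ∈ U} => coeffStalk hs hK c σ.1) ∈
      ((boxSheaf Δ' K hK).pushforward Δ).sections U :=
  fun _ _ _ => rfl

-- The value of s at a cone τ of `Δ'` does not depend on the cone σ ⊇ τ of U used, because two such
-- cones meet in a common face containing τ. So s amounts to a section over the preimage of U, and
-- `exists_coeff` applies.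
include hs in
theorem exists_coeff_pushforward (U : LowerSet Δ.Cone)
    {s : ∀ σ : {σ // σ ∈ U}, ((boxSheaf Δ' K hK).pushforward Δ).stalk σ.1}
    (h : s ∈ ((boxSheaf Δ' K hK).pushforward Δ).sections U) :
    ∃ c : (Fin n → ℝ) →₀ ℝ, ∀ σ, s σ = coeffStalk hs hK c σ.1 := by
  classical
  let U' : LowerSet Δ'.Cone :=
    ⟨{τ | ∃ σ : Δ.Cone, σ ∈ U ∧ τ.1 ≤ σ.1}, fun τ ρ hρτ hτ => by
      obtain ⟨σ, hσ, hτσ⟩ := hτ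
      exact ⟨σ, hσ, le_trans (show ρ.1 ≤ τ.1 from hρτ) hτσ⟩⟩
  have hU' : ∀ τ, τ ∈ U' → ∃ σ : Δ.Cone, σ ∈ U ∧ τ.1 ≤ σ.1 := fun τ hτ => hτ
  choose f hfU hf using hU'
  have hface : ∀ (σ κ : Δ.Cone) (hσ : σ ∈ U) (hκ : κ ∈ U) (_ : κ ≤ σ) (τ : Δ'.Cone)
      (h1 : τ.1 ≤ σ.1) (h2 : τ.1 ≤ κ.1), (s ⟨σ, hσ⟩).1 ⟨τ, h1⟩ = (s ⟨κ, hκ⟩).1 ⟨τ, h2⟩ := by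
    intro σ κ hσ hκ hκσ τ h1 h2
    rw [← h ⟨σ, hσ⟩ ⟨κ, hκ⟩ hκσ]
    rfl
  have hind : ∀ (σ κ : Δ.Cone) (hσ : σ ∈ U) (hκ : κ ∈ U) (τ : Δ'.Cone)
      (h1 : τ.1 ≤ σ.1) (h2 : τ.1 ≤ κ.1), (s ⟨σ, hσ⟩).1 ⟨τ, h1⟩ = (s ⟨κ, hκ⟩).1 ⟨τ, h2⟩ := by
    intro σ κ hσ hκ τ h1 h2
    let μ : Δ.Cone := ⟨σ.1 ⊓ κ.1, Δ.face_mem _ σ.2 _ (Δ.inf_isFaceOf _ σ.2 _ κ.2)⟩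
    have h3 : μ ≤ σ := (inf_le_left : σ.1 ⊓ κ.1 ≤ σ.1)
    have h4 : μ ≤ κ := (inf_le_right : σ.1 ⊓ κ.1 ≤ κ.1)
    rw [hface σ μ hσ (U.lower h3 hσ) h3 τ h1 (le_inf h1 h2),
      hface κ μ hκ (U.lower h3 hσ) h4 τ h2 (le_inf h1 h2)]
  obtain ⟨c, hc⟩ := exists_coeff hs U' (fun τ hτ => (s ⟨f τ hτ, hfU τ hτ⟩).1 ⟨τ, hf τ hτ⟩)
    (fun τ ρ hτ hρ hρτ => by
      rw [hind (f ρ hρ) (f τ hτ) (hfU ρ hρ) (hfU τ hτ) ρ (hf ρ hρ)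
        (le_trans (show ρ.1 ≤ τ.1 from hρτ) (hf τ hτ))]
      exact (s ⟨f τ hτ, hfU τ hτ⟩).2 ⟨τ, hf τ hτ⟩
        ⟨ρ, le_trans (show ρ.1 ≤ τ.1 from hρτ) (hf τ hτ)⟩ hρτ)
  refine ⟨c, fun σ => Subtype.ext (funext fun τ => ?_)⟩
  have hτ : τ.1 ∈ U' := ⟨σ.1, σ.2, τ.2⟩
  rw [coeffStalk_apply, ← hc τ.1 hτ]
  exact hind σ.1 (f τ.1 hτ) σ.2 (hfU τ.1 hτ) τ.1 τ.2 (hf τ.1 hτ)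

include hs in
/-- The push-forward of the box sheaf is flabby. -/
theorem isFlabby_pushforward : ((boxSheaf Δ' K hK).pushforward Δ).IsFlabby := by
  intro U V hUV s h
  -- The coefficient function is defined on all of ℝⁿ, so it also gives a section over `V`.
  obtain ⟨c, hc⟩ := exists_coeff_pushforward hs hK U h
  exact ⟨_, coeffStalk_mem_sections hs hK c V, fun σ hσ => (hc ⟨σ, hσ⟩).symm⟩

theorem finite_bounded_lattice (M : ℝ) :
    {v : Fin n → ℝ | IsLatticePoint v ∧ ∀ i, |v i| ≤ M}.Finite := by
  refine ((Set.Finite.pi fun _ : Fin n => (Set.finite_Icc (-⌈M⌉) ⌈M⌉)).image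
    fun (z : Fin n → ℤ) i => (z i : ℝ)).subset ?_
  rintro v ⟨hv, hM⟩
  choose z hz using hv
  refine ⟨z, fun i _ => ?_, funext fun i => (hz i).symm⟩
  have h1 := abs_le.1 (hM i)
  rw [hz] at h1
  have h2 := Int.le_ceil M
  constructor
  · have : (-⌈M⌉ : ℝ) ≤ z i := by linarith
    exact_mod_cast this
  · have : (z i : ℝ) ≤ ⌈M⌉ := by linarith
    exact_mod_cast this

-- Inside a cone the coordinates of v are nonnegative with sum K v, since K is 1 on the generators.
-- So a level set meets each cone in a bounded set.
include hs hK in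
theorem finite_level (hcov : Δ'.support = Set.univ) (k : ℝ) :
    {v : Fin n → ℝ | IsLatticePoint v ∧ K v = k}.Finite := by
  have hσ : ∀ σ ∈ Δ'.cones, {v : Fin n → ℝ | (IsLatticePoint v ∧ K v = k) ∧ v ∈ σ}.Finite := by
    intro σ hσ
    have h := hs.isPrimSimplicial hσ
    obtain ⟨⟨L, hL⟩, -, hone⟩ := hK σ hσ
    refine (finite_bounded_lattice (∑ p ∈ gens σ, k * ∑ i, |p i|)).subset ?_
    rintro v ⟨⟨hv, hk⟩, hvσ⟩
    refine ⟨hv, fun i => ?_⟩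
    have h1 : ∑ p ∈ gens σ, coord (gens σ) p v = k := by
      rw [← hk, hL v hvσ]
      conv_rhs => rw [← h.sum_coord hvσ]
      rw [map_sum]
      refine Finset.sum_congr rfl fun p hp => ?_
      rw [map_smul, ← hL p (h.gens_mem hp), hone p (h.mem_gens.1 hp), smul_eq_mul, mul_one]
    have h2 : v i = ∑ p ∈ gens σ, coord (gens σ) p v * p i := by
      conv_lhs => rw [← h.sum_coord hvσ]
      simp
    rw [h2]
    refine (Finset.abs_sum_le_sum_abs _ _).trans (Finset.sum_le_sum fun p hp => ?_)
    rw [abs_mul, abs_of_nonneg (h.coord_nonneg hvσ p)]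
    refine mul_le_mul ?_ (Finset.single_le_sum (f := fun i => |p i|) (fun _ _ => abs_nonneg _)
      (Finset.mem_univ i)) (abs_nonneg _) ?_
    · rw [← h1]
      exact Finset.single_le_sum (f := fun p => coord (gens σ) p v)
        (fun p _ => h.coord_nonneg hvσ p) hp
    · rw [← h1]
      exact Finset.sum_nonneg fun p _ => h.coord_nonneg hvσ p
  refine (Δ'.finite.biUnion hσ).subset fun v hv => ?_
  obtain ⟨σ, hσ, hvσ⟩ : v ∈ Δ'.support := by rw [hcov]; trivial
  exact Set.mem_iUnion₂.2 ⟨σ, hσ, hv, hvσ⟩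

include hs hK in
/-- The coefficients of an element of degree `k` are supported on the lattice points of degree
`k`. -/
theorem repr_eq_zero_of_mem_boxDeg (τ : Δ'.Cone) {k : ℕ} {x : BoxModule τ.1}
    (hx : x ∈ boxDeg K τ.1 k) (w : LatIn τ.1) (hw : K w.1 ≠ k) :
    (hs.prim τ).latBasis.repr x w = 0 := by
  classical
  have h := hs.prim τ
  obtain ⟨⟨L, hL⟩, hint, hone⟩ := hK τ.1 τ.2
  obtain ⟨p, hp1, hp2, hp3, -⟩ := exists_proj (boxDeg_isInternal Δ' K hK τ)
  have hnat : ∀ u : LatIn τ.1, ∃ m : ℕ, K u.1 = m := by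
    intro u
    obtain ⟨z, hz⟩ := hint u.1 u.2.2 u.2.1
    have h0 : 0 ≤ K u.1 := by
      rw [hL _ u.2.2, ← h.sum_coord u.2.2, map_sum]
      refine Finset.sum_nonneg fun q hq => ?_
      rw [map_smul, ← hL q (h.gens_mem hq), hone q (h.mem_gens.1 hq), smul_eq_mul, mul_one]
      exact h.coord_nonneg u.2.2 q
    rw [hz] at h0
    obtain ⟨m, rfl⟩ := Int.eq_ofNat_of_zero_le (by exact_mod_cast h0 : 0 ≤ z)
    exact ⟨m, by simpa using hz⟩
  -- The coefficient at w of the degree k part is zero on each basis element: the basis element of u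
  -- has degree K u, and K w ≠ k.
  have key : Finsupp.lapply w ∘ₗ h.latBasis.repr.toLinearMap ∘ₗ p k = 0 := by
    refine h.latBasis.ext fun u => ?_
    obtain ⟨m, hm⟩ := hnat u
    have hmem := h.latElt_mem_boxDeg hL hone u hm
    simp only [LinearMap.comp_apply, LinearEquiv.coe_coe, Finsupp.lapply_apply,
      LinearMap.zero_apply]
    rw [h.latBasis_apply]
    by_cases hmk : m = k
    · subst hmk
      rw [hp2 _ _ hmem, ← h.latBasis_apply, Module.Basis.repr_self, Finsupp.single_apply, if_neg]
      rintro rfl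
      exact hw hm
    · rw [hp3 _ _ hmk _ hmem, map_zero]
      rfl
  have := LinearMap.congr_fun key x
  simp only [LinearMap.comp_apply, LinearEquiv.coe_coe, Finsupp.lapply_apply,
      LinearMap.zero_apply] at this
  rwa [hp2 k x hx] at this

include hs in
/-- The global sections of degree `k` correspond to the functions on the set of lattice points of
degree `k`. -/
theorem exists_sectionsDeg_equiv (h : Δ'.IsSubdivision Δ) (hcov : Δ'.support = Set.univ) (k : ℕ) :
    Nonempty (({v : Fin n → ℝ | IsLatticePoint v ∧ K v = (k : ℝ)} →₀ ℝ) ≃ₗ[ℝ]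
      ((boxSheaf Δ' K hK).pushforward Δ).sectionsDeg ⊤ k) := by
  classical
  let F := (boxSheaf Δ' K hK).pushforward Δ
  let A := {v : Fin n → ℝ | IsLatticePoint v ∧ K v = (k : ℝ)}
  have hadd : ∀ (τ : Δ'.Cone) (c d : (Fin n → ℝ) →₀ ℝ), (hs.prim τ).ofCoeff (c + d) =
      (hs.prim τ).ofCoeff c + (hs.prim τ).ofCoeff d := fun τ c d =>
    ((hs.prim τ).eq_ofCoeff fun w => by
      simp [(hs.prim τ).repr_ofCoeff]).symm
  have hsmul : ∀ (τ : Δ'.Cone) (r : ℝ) (c : (Fin n → ℝ) →₀ ℝ), (hs.prim τ).ofCoeff (r • c) =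
      r • (hs.prim τ).ofCoeff c := fun τ r c =>
    ((hs.prim τ).eq_ofCoeff fun w => by
      simp [(hs.prim τ).repr_ofCoeff]).symm
  have hdeg : ∀ (τ : Δ'.Cone) (c : A →₀ ℝ),
      (hs.prim τ).ofCoeff (c.mapDomain Subtype.val) ∈ boxDeg K τ.1 k := by
    intro τ c
    obtain ⟨⟨L, hL⟩, hint, hone⟩ := hK τ.1 τ.2
    rw [IsPrimSimplicial.ofCoeff, Module.Basis.repr_symm_apply, Finsupp.linearCombination_apply,
      Finsupp.sum]
    refine Submodule.sum_mem _ fun w hw => Submodule.smul_mem _ _ ?_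
    rw [(hs.prim τ).latBasis_apply]
    refine (hs.prim τ).latElt_mem_boxDeg hL hone w ?_
    have : w.1 ∈ Set.range (Subtype.val : A → _) := by
      by_contra hr
      refine Finsupp.mem_support_iff.1 hw ?_
      rw [Finsupp.comapDomain_apply]
      exact Finsupp.mapDomain_of_notMem_range c _ hr
    obtain ⟨a, ha⟩ := this
    rw [← ha]
    exact a.2.2
  let Φ : (A →₀ ℝ) →ₗ[ℝ] F.sectionsDeg ⊤ k :=
    { toFun := fun c => ⟨⟨_, coeffStalk_mem_sections hs hK (c.mapDomain Subtype.val) ⊤⟩,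
        fun σ τ => hdeg τ.1 c⟩
      map_add' := fun c d => Subtype.ext (Subtype.ext (funext fun σ => Subtype.ext
        (funext fun τ => by
          show (hs.prim τ.1).ofCoeff _ = (hs.prim τ.1).ofCoeff _ + (hs.prim τ.1).ofCoeff _
          rw [Finsupp.mapDomain_add, hadd])))
      map_smul' := fun r c => Subtype.ext (Subtype.ext (funext fun σ => Subtype.ext
        (funext fun τ => by
          show (hs.prim τ.1).ofCoeff _ = r • (hs.prim τ.1).ofCoeff _
          rw [Finsupp.mapDomain_smul, hsmul]))) }
  have hΦ : ∀ c (σ : Δ.Cone) (τ : Δ'.Cone) (hτσ : τ.1 ≤ σ.1),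
      ((Φ c).1.1 ⟨σ, trivial⟩).1 ⟨τ, hτσ⟩ = (hs.prim τ).ofCoeff (c.mapDomain Subtype.val) :=
    fun _ _ _ _ => rfl
  -- Completeness enters here: the coefficient at any lattice point can be read off in some stalk.
  have hcov' : ∀ w : Fin n → ℝ, ∃ (τ : Δ'.Cone) (σ : Δ.Cone), w ∈ τ.1 ∧ τ.1 ≤ σ.1 := by
    intro w
    obtain ⟨τ, hτ, hw⟩ : w ∈ Δ'.support := by rw [hcov]; trivial
    obtain ⟨σ, hσ, hτσ⟩ := h.2 τ hτ
    exact ⟨⟨τ, hτ⟩, ⟨σ, hσ⟩, hw, hτσ⟩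
  refine ⟨LinearEquiv.ofBijective Φ ⟨?_, ?_⟩⟩
  · refine (injective_iff_map_eq_zero _).2 fun c hc => Finsupp.ext fun w => ?_
    obtain ⟨τ, σ, hw, hτσ⟩ := hcov' w
    have h1 := hΦ c σ τ hτσ
    rw [hc] at h1
    have h1 : (0 : BoxModule τ.1) = _ := h1
    have h2 := (hs.prim τ).repr_ofCoeff (c.mapDomain Subtype.val) ⟨w.1, w.2.1, hw⟩
    rw [← h1, map_zero, Finsupp.mapDomain_apply Subtype.val_injective] at h2
    exact h2.symm
  · rintro ⟨⟨s, hsec⟩, hsk⟩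
    obtain ⟨c, hc⟩ := exists_coeff_pushforward hs hK ⊤ hsec
    refine ⟨c.comapDomain Subtype.val Subtype.val_injective.injOn,
      Subtype.ext (Subtype.ext (funext fun σ => Subtype.ext (funext fun τ => ?_)))⟩
    rw [show ((⟨⟨s, hsec⟩, hsk⟩ : F.sectionsDeg ⊤ k).1.1 σ) = coeffStalk hs hK c σ.1 from hc σ]
    refine ((hs.prim τ.1).eq_ofCoeff fun w => ?_).symm
    have h1 := (hs.prim τ.1).repr_ofCoeff c w
    show (hs.prim τ.1).latBasis.repr ((hs.prim τ.1).ofCoeff c) w = _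
    -- A section of degree k has no coefficients off the level k, so nothing is lost by restricting
    -- c to it.
    by_cases hw : K w.1 = k
    · rw [h1]
      exact (Finsupp.mapDomain_apply Subtype.val_injective
        (c.comapDomain Subtype.val Subtype.val_injective.injOn) (⟨w.1, w.2.1, hw⟩ : A)).symm
    · have h2 : (hs.prim τ.1).ofCoeff c ∈ boxDeg K τ.1.1 k := by
        have := hsk σ τ
        rwa [show ((⟨s, hsec⟩ : F.sections ⊤).1 σ) = coeffStalk hs hK c σ.1 from hc σ] at this
      rw [repr_eq_zero_of_mem_boxDeg hs hK τ.1 h2 w hw, Finsupp.mapDomain_of_notMem_range]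
      rintro ⟨a, ha⟩
      exact hw (ha ▸ a.2.2)

end Sections

end EhrhartFan

namespace EhrhartFan

/-! ### Stars of cones in simplicial fans with convex support of full dimension -/

section Star

variable {κ W : Type*} [AddCommGroup W] [Module ℝ W]

theorem coord_eq_of_mem_span {S T : Finset W} (hT : LinearIndepOn ℝ id (T : Set W)) (hST : S ⊆ T)
    {x : W} (hx : x ∈ Submodule.span ℝ (S : Set W)) (i : W) : coord T i x = coord S i x := by
  have hS : LinearIndepOn ℝ id (S : Set W) := hT.mono (by exact_mod_cast hST)
  induction hx using Submodule.span_induction with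
  | mem x hx =>
    by_cases hi : i = x
    · subst hi; rw [coord_self hT (hST hx), coord_self hS hx]
    · rw [coord_of_ne hT (hST hx) hi, coord_of_ne hS hx hi]
  | zero => simp
  | add x y _ _ hx hy => rw [map_add, map_add, hx, hy]
  | smul r x _ hx => rw [map_smul, map_smul, hx]

variable (κ W) in
/-- A simplicial fan, given by the generators of its maximal cones, all of which have full
dimension, and with support closed under addition. -/
structure FullFan where
  gen : κ → Finset W
  inj : Function.Injective gen
  li : ∀ k, LinearIndepOn ℝ id (gen k : Set W)
  span_gen : ∀ k, Submodule.span ℝ (gen k : Set W) = ⊤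
  inter : ∀ k k' x, x ∈ PointedCone.hull ℝ (gen k : Set W) →
    x ∈ PointedCone.hull ℝ (gen k' : Set W) →
    x ∈ PointedCone.hull ℝ ((gen k : Set W) ∩ (gen k' : Set W))
  add : ∀ k k' x y, x ∈ PointedCone.hull ℝ (gen k : Set W) →
    y ∈ PointedCone.hull ℝ (gen k' : Set W) → ∃ k'', x + y ∈ PointedCone.hull ℝ (gen k'' : Set W)

namespace FullFan

variable (A : FullFan κ W) {S : Finset W}

theorem mem_hull_iff {k : κ} {x : W} :
    x ∈ PointedCone.hull ℝ (A.gen k : Set W) ↔ ∀ i, 0 ≤ coord (A.gen k) i x := by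
  rw [mem_hull_iff_coord (A.li k), A.span_gen k]
  simp

theorem coord_eq {k k' : κ} {x : W} (hx : x ∈ PointedCone.hull ℝ (A.gen k : Set W))
    (hx' : x ∈ PointedCone.hull ℝ (A.gen k' : Set W)) (i : W) :
    coord (A.gen k) i x = coord (A.gen k') i x := by
  classical
  have h := A.inter k k' x hx hx'
  rw [← Finset.coe_inter] at h
  have h1 := PointedCone.hull_le_span ℝ _ h
  rw [coord_eq_of_mem_span (A.li k) Finset.inter_subset_left h1,
    coord_eq_of_mem_span (A.li k') Finset.inter_subset_right h1]

variable (S) in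
/-- The sum of the generators of a cone. -/
def bary : W := ∑ p ∈ S, p

theorem coord_bary {k : κ} (hS : S ⊆ A.gen k) {i : W} (hi : i ∈ S) :
    coord (A.gen k) i (bary S) = 1 := by
  rw [bary, map_sum, Finset.sum_eq_single_of_mem i hi, coord_self (A.li k) (hS hi)]
  intro j hj hji
  exact coord_of_ne (A.li k) (hS hj) hji.symm

theorem coord_bary_eq_zero {k : κ} (hS : S ⊆ A.gen k) {i : W} (hi : i ∉ S) :
    coord (A.gen k) i (bary S) = 0 := by
  rw [bary, map_sum]
  exact Finset.sum_eq_zero fun j hj => coord_of_ne (A.li k) (hS hj) (by rintro rfl; exact hi hj)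

theorem bary_mem {k : κ} (hS : S ⊆ A.gen k) : bary S ∈ PointedCone.hull ℝ (A.gen k : Set W) :=
  Submodule.sum_mem _ fun _ hp => Submodule.subset_span (hS hp)

/-- Adding a large multiple of the sum of the generators in `S` makes the coordinates in `S`
nonnegative. -/
theorem eventually_mem_hull {k : κ} (hS : S ⊆ A.gen k) {y : W}
    (hy : ∀ i ∉ S, 0 ≤ coord (A.gen k) i y) :
    ∀ᶠ N : ℝ in Filter.atTop, y + N • bary S ∈ PointedCone.hull ℝ (A.gen k : Set W) := by
  have h : ∀ᶠ N : ℝ in Filter.atTop, ∀ i ∈ S, -coord (A.gen k) i y ≤ N := by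
    rw [Filter.eventually_all_finset]
    exact fun i _ => Filter.eventually_ge_atTop _
  filter_upwards [h] with N hN
  rw [A.mem_hull_iff]
  intro i
  rw [map_add, map_smul, smul_eq_mul]
  by_cases hi : i ∈ S
  · rw [A.coord_bary hS hi]
    linarith [hN i hi]
  · rw [A.coord_bary_eq_zero hS hi, mul_zero, add_zero]
    exact hy i hi

/-- A negative coordinate of b would dominate in y + N b for large N. -/
theorem eventually_coord_nonneg {k : κ} {y b : W} {N : ℕ → ℝ}
    (hN : Filter.Tendsto N Filter.atTop Filter.atTop)
    (h : ∃ᶠ m in Filter.atTop, y + N m • b ∈ PointedCone.hull ℝ (A.gen k : Set W)) :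
    b ∈ PointedCone.hull ℝ (A.gen k : Set W) := by
  rw [A.mem_hull_iff]
  intro i
  by_contra! hneg
  have h1 : ∀ᶠ m in Filter.atTop, coord (A.gen k) i y / -coord (A.gen k) i b < N m :=
    hN.eventually_gt_atTop _
  obtain ⟨m, hm1, hm2⟩ := (h.and_eventually h1).exists
  have h2 := A.mem_hull_iff.1 hm1 i
  rw [map_add, map_smul, smul_eq_mul] at h2
  rw [div_lt_iff₀ (by linarith)] at hm2
  linarith

/-- The barycentre has coordinate 1 at every element of S, and its coordinates are the same in all
cones containing it. -/
theorem subset_of_bary_mem {k k' : κ} (hS : S ⊆ A.gen k)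
    (h : bary S ∈ PointedCone.hull ℝ (A.gen k' : Set W)) : S ⊆ A.gen k' := by
  intro i hi
  by_contra hik
  have := A.coord_eq (A.bary_mem hS) h i
  rw [A.coord_bary hS hi, coord_off hik] at this
  exact one_ne_zero this

open Classical in
variable (S) in
/-- The coordinates on the quotient by the span of `S`. -/
noncomputable def starCoord (T : Finset W) (i : W) : (W ⧸ Submodule.span ℝ (S : Set W)) →ₗ[ℝ] ℝ :=
  if h : Submodule.span ℝ (S : Set W) ≤ LinearMap.ker (coord (T ∪ S) i) ∧ i ∈ T then
    Submodule.liftQ _ (coord (T ∪ S) i) h.1 else 0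

open Classical in
theorem starCoord_mk {k : κ} (hS : S ⊆ A.gen k) {i : W} (hi : i ∉ S) (y : W) :
    starCoord S (A.gen k \ S) i (Submodule.Quotient.mk y) = coord (A.gen k) i y := by
  have e : A.gen k \ S ∪ S = A.gen k := Finset.sdiff_union_of_subset hS
  unfold starCoord
  split_ifs with h
  · rw [Submodule.liftQ_apply]
    rw [e]
  · by_cases hik : i ∈ A.gen k
    · refine absurd ⟨Submodule.span_le.2 fun j hj => ?_, by simp [hik, hi]⟩ h
      show coord _ i j = 0
      have e' : coord (A.gen k) i j = 0 :=
        coord_of_ne (A.li k) (hS hj) (by rintro rfl; exact hi hj)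
      rwa [e]
    · rw [coord_off hik]; rfl

variable [Fintype κ]

open Classical in
variable (S) in
/-- The star of the cone generated by `S`, as a fan in the quotient by its span. -/
noncomputable def star : SFan W (W ⧸ Submodule.span ℝ (S : Set W)) where
  F := (Finset.univ.filter fun k => S ⊆ A.gen k).image fun k => A.gen k \ S
  v := Submodule.Quotient.mk
  X := starCoord S
  X_off T _ i hi := by rw [starCoord, dif_neg fun h => hi h.2]
  X_self {T} hT {i} hi := by
    obtain ⟨k, hk, rfl⟩ := Finset.mem_image.1 hT
    have hk := (Finset.mem_filter.1 hk).2
    obtain ⟨h1, h2⟩ := Finset.mem_sdiff.1 hi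
    rw [A.starCoord_mk hk h2, coord_self (A.li k) h1]
  X_of_ne {T} hT {i j} hj hij := by
    obtain ⟨k, hk, rfl⟩ := Finset.mem_image.1 hT
    have hk := (Finset.mem_filter.1 hk).2
    obtain ⟨h1, h2⟩ := Finset.mem_sdiff.1 hj
    by_cases hi : i ∈ S
    · rw [starCoord, dif_neg fun h => (Finset.mem_sdiff.1 h.2).2 hi]; rfl
    · rw [A.starCoord_mk hk hi, coord_of_ne (A.li k) h1 hij]
  sum_X T hT x := by
    obtain ⟨k, hk, rfl⟩ := Finset.mem_image.1 hT
    have hk := (Finset.mem_filter.1 hk).2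
    obtain ⟨y, rfl⟩ := Submodule.Quotient.mk_surjective _ x
    have h1 : ∑ i ∈ A.gen k, coord (A.gen k) i y • i = y :=
      sum_coord (A.li k) (by rw [A.span_gen k]; trivial)
    conv_rhs => rw [← h1]
    show _ = Submodule.mkQ _ (∑ i ∈ A.gen k, _)
    rw [map_sum, ← Finset.sum_sdiff hk]
    rw [Finset.sum_eq_zero (s := S), add_zero]
    · refine Finset.sum_congr rfl fun i hi => ?_
      rw [A.starCoord_mk hk (Finset.mem_sdiff.1 hi).2, map_smul]; rfl
    · intro i hi
      rw [Submodule.mkQ_apply, Submodule.Quotient.mk_eq_zero]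
      exact Submodule.smul_mem _ _ (Submodule.subset_span hi)
  glue T hT T' hT' x hx hx' i := by
    obtain ⟨k, hk, rfl⟩ := Finset.mem_image.1 hT
    obtain ⟨k', hk', rfl⟩ := Finset.mem_image.1 hT'
    have hk := (Finset.mem_filter.1 hk).2
    have hk' := (Finset.mem_filter.1 hk').2
    obtain ⟨y, rfl⟩ := Submodule.Quotient.mk_surjective _ x
    by_cases hi : i ∈ S
    · rw [starCoord, dif_neg fun h => (Finset.mem_sdiff.1 h.2).2 hi, starCoord,
        dif_neg fun h => (Finset.mem_sdiff.1 h.2).2 hi]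
    · rw [A.starCoord_mk hk hi, A.starCoord_mk hk' hi]
      -- Adding a large multiple of `bary S` moves a lift of x into both actual cones without
      -- changing the coordinates outside `S`.
      have e1 := A.eventually_mem_hull hk (y := y) fun j hj => by
        rw [← A.starCoord_mk hk hj]; exact hx j
      have e2 := A.eventually_mem_hull hk' (y := y) fun j hj => by
        rw [← A.starCoord_mk hk' hj]; exact hx' j
      obtain ⟨N, h1, h2⟩ := (e1.and e2).exists
      have := A.coord_eq h1 h2 i
      simpa [A.coord_bary_eq_zero hk hi, A.coord_bary_eq_zero hk' hi] using this
  add T hT T' hT' x y hx hy := by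
    obtain ⟨k, hk, rfl⟩ := Finset.mem_image.1 hT
    obtain ⟨k', hk', rfl⟩ := Finset.mem_image.1 hT'
    have hk := (Finset.mem_filter.1 hk).2
    have hk' := (Finset.mem_filter.1 hk').2
    obtain ⟨x, rfl⟩ := Submodule.Quotient.mk_surjective _ x
    obtain ⟨y, rfl⟩ := Submodule.Quotient.mk_surjective _ y
    have e1 := A.eventually_mem_hull hk (y := x) fun j hj => by
      rw [← A.starCoord_mk hk hj]; exact hx j
    have e2 := A.eventually_mem_hull hk' (y := y) fun j hj => by
      rw [← A.starCoord_mk hk' hj]; exact hy j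
    -- The sum of the shifted lifts is in some cone for all large m, hence in a fixed one for
    -- infinitely many m. That cone contains `bary S`, so it belongs to the star.
    have e3 : ∀ᶠ m : ℕ in Filter.atTop, ∃ k'',
        (x + y) + (2 * (m : ℝ)) • bary S ∈ PointedCone.hull ℝ (A.gen k'' : Set W) := by
      filter_upwards [tendsto_natCast_atTop_atTop.eventually e1,
        tendsto_natCast_atTop_atTop.eventually e2] with m h1 h2
      obtain ⟨k'', h⟩ := A.add k k' _ _ h1 h2
      refine ⟨k'', ?_⟩
      convert h using 1
      module
    have e4 : ∃ k'', ∃ᶠ m : ℕ in Filter.atTop,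
        (x + y) + (2 * (m : ℝ)) • bary S ∈ PointedCone.hull ℝ (A.gen k'' : Set W) := by
      by_contra! H
      obtain ⟨m, ⟨k'', h1⟩, h2⟩ := (e3.and (Filter.eventually_all.2 H)).exists
      exact h2 k'' h1
    obtain ⟨k'', h⟩ := e4
    have hk'' : S ⊆ A.gen k'' := A.subset_of_bary_mem hk (A.eventually_coord_nonneg
      (tendsto_natCast_atTop_atTop.const_mul_atTop (by norm_num : (0 : ℝ) < 2)) h)
    refine ⟨A.gen k'' \ S, Finset.mem_image.2 ⟨k'', by simp [hk''], rfl⟩, fun i => ?_⟩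
    by_cases hi : i ∈ S
    · rw [starCoord, dif_neg fun h => (Finset.mem_sdiff.1 h.2).2 hi]; rfl
    · rw [← Submodule.Quotient.mk_add, A.starCoord_mk hk'' hi]
      obtain ⟨m, hm⟩ := h.exists
      have := A.mem_hull_iff.1 hm i
      rwa [map_add, map_smul, A.coord_bary_eq_zero hk'' hi, smul_zero, add_zero] at this

variable (S) in
/-- The piecewise polynomial functions on the star of the cone generated by `S`. -/
def starPoly : Submodule (PolyOn W) (κ → PolyOn W) where
  carrier := {f | (∀ k, ¬ S ⊆ A.gen k → f k = 0) ∧ ∀ k k', S ⊆ A.gen k → S ⊆ A.gen k' →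
    ∀ y ∈ Submodule.span ℝ ((A.gen k : Set W) ∩ (A.gen k' : Set W)), (f k).1 y = (f k').1 y}
  add_mem' {f g} hf hg := ⟨fun k hk => by rw [Pi.add_apply, hf.1 k hk, hg.1 k hk, add_zero],
    fun k k' hk hk' y hy => by
      simp only [Pi.add_apply, PolyOn.add_apply, hf.2 k k' hk hk' y hy, hg.2 k k' hk hk' y hy]⟩
  zero_mem' := ⟨fun _ _ => rfl, fun _ _ _ _ _ _ => rfl⟩
  smul_mem' r f hf := ⟨fun k hk => by rw [Pi.smul_apply, hf.1 k hk, smul_zero],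
    fun k k' hk hk' y hy => by
      simp only [Pi.smul_apply, smul_eq_mul, PolyOn.mul_apply, hf.2 k k' hk hk' y hy]⟩

instance : Module (PolyOn W) (A.starPoly S) := (A.starPoly S).module

/-- This is `pwPoly` of the star fan for the projection along the span of S, reindexed by the cones
themselves. The fan lives in the quotient but the polynomials live on W, which is why `pwPoly`
allows a pullback along q. -/
theorem finiteProjective_starPoly (hW : Nontrivial W → Infinite W) :
    FiniteProjective (PolyOn W) (A.starPoly S) := by
  classical
  have hq : Function.Surjective (Submodule.mkQ (Submodule.span ℝ (S : Set W))) :=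
    Submodule.mkQ_surjective _
  have h := SFan.finiteProjective_pwPoly (S := A.star S) hq fun _ => hW hq.nontrivial
  have hF : ∀ {T}, T ∈ (A.star S).F ↔ ∃ k, S ⊆ A.gen k ∧ A.gen k \ S = T := by
    intro T
    simp [star]
  have huniq : ∀ {k k'}, S ⊆ A.gen k → S ⊆ A.gen k' → A.gen k \ S = A.gen k' \ S → k = k' := by
    intro k k' hk hk' e
    refine A.inj ?_
    rw [← Finset.sdiff_union_of_subset hk, e, Finset.sdiff_union_of_subset hk']
  let g : (κ → PolyOn W) → Finset W → PolyOn W := fun f T =>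
    if h : ∃ k, S ⊆ A.gen k ∧ A.gen k \ S = T then f h.choose else 0
  have hg : ∀ f k, S ⊆ A.gen k → g f (A.gen k \ S) = f k := by
    intro f k hk
    have h : ∃ k', S ⊆ A.gen k' ∧ A.gen k' \ S = A.gen k \ S := ⟨k, hk, rfl⟩
    simp only [g]
    rw [dif_pos h, huniq h.choose_spec.1 hk h.choose_spec.2]
  have hg0 : ∀ f T, (¬ ∃ k, S ⊆ A.gen k ∧ A.gen k \ S = T) → g f T = 0 := fun f T h => dif_neg h
  have hspan : ∀ {k k'} (_ : S ⊆ A.gen k) (_ : S ⊆ A.gen k') y,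
      (Submodule.mkQ (Submodule.span ℝ (S : Set W)) y ∈
        (A.star S).span (A.gen k \ S) (A.gen k' \ S) ↔
      y ∈ Submodule.span ℝ ((A.gen k : Set W) ∩ (A.gen k' : Set W))) := by
    intro k k' hk hk' y
    have e : (A.star S).span (A.gen k \ S) (A.gen k' \ S) = Submodule.map
        (Submodule.mkQ (Submodule.span ℝ (S : Set W)))
        (Submodule.span ℝ ((A.gen k : Set W) ∩ (A.gen k' : Set W))) := by
      rw [Submodule.map_span]
      refine le_antisymm (Submodule.span_mono (Set.image_mono ?_)) (Submodule.span_le.2 ?_)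
      · intro p hp
        simp only [Finset.coe_sdiff, Set.mem_inter_iff, Set.mem_sdiff, Finset.mem_coe] at hp
        exact ⟨hp.1.1, hp.2.1⟩
      · rintro _ ⟨p, hp, rfl⟩
        by_cases hpS : p ∈ S
        · rw [Submodule.mkQ_apply,
            (Submodule.Quotient.mk_eq_zero _).2 (Submodule.subset_span hpS)]
          exact Submodule.zero_mem _
        · refine Submodule.subset_span ⟨p, ?_, rfl⟩
          simp only [Finset.coe_sdiff, Set.mem_inter_iff, Set.mem_sdiff, Finset.mem_coe]
          exact ⟨⟨hp.1, hpS⟩, hp.2, hpS⟩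
    rw [e, ← Submodule.mem_comap, Submodule.comap_map_mkQ, sup_eq_right.2]
    exact Submodule.span_mono fun p hp => ⟨hk hp, hk' hp⟩
  refine h.of_retract
    { toFun := fun f => ⟨g f.1, fun T hT => hg0 _ _ fun h => hT (hF.2 h), fun T hT T' hT' y hy => by
        obtain ⟨k, hk, rfl⟩ := hF.1 hT
        obtain ⟨k', hk', rfl⟩ := hF.1 hT'
        rw [hg _ _ hk, hg _ _ hk']
        exact f.2.2 k k' hk hk' y ((hspan hk hk' y).1 hy)⟩
      map_add' := fun f f' => Subtype.ext (funext fun T => by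
        show g _ T = g _ T + g _ T
        simp only [g]
        split_ifs <;> simp)
      map_smul' := fun r f => Subtype.ext (funext fun T => by
        show g _ T = r • g _ T
        simp only [g]
        split_ifs <;> simp) }
    { toFun := fun f => ⟨fun k => if S ⊆ A.gen k then f.1 (A.gen k \ S) else 0,
        fun k hk => if_neg hk, fun k k' hk hk' y hy => by
          simp only [if_pos hk, if_pos hk']
          exact f.2.2 _ (hF.2 ⟨k, hk, rfl⟩) _ (hF.2 ⟨k', hk', rfl⟩) y ((hspan hk hk' y).2 hy)⟩
      map_add' := fun f f' => Subtype.ext (funext fun k => by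
        show (if S ⊆ A.gen k then f.1 (A.gen k \ S) + f'.1 (A.gen k \ S) else 0) =
          (if S ⊆ A.gen k then f.1 (A.gen k \ S) else 0) +
            (if S ⊆ A.gen k then f'.1 (A.gen k \ S) else 0)
        split_ifs <;> simp)
      map_smul' := fun r f => Subtype.ext (funext fun k => by
        show (if S ⊆ A.gen k then r • f.1 (A.gen k \ S) else 0) =
          r • (if S ⊆ A.gen k then f.1 (A.gen k \ S) else 0)
        split_ifs <;> simp) }
    fun f => Subtype.ext (funext fun k => ?_)
  show (if S ⊆ A.gen k then g f.1 (A.gen k \ S) else 0) = f.1 k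
  split_ifs with hk
  · exact hg _ _ hk
  · exact (f.2.1 k hk).symm

end FullFan

end Star

end EhrhartFan

namespace EhrhartFan

/-! ### The cones of a subdivision inside a cone -/

section SubdividedCone

variable {n : ℕ}

theorem span_hull {V : Type*} [AddCommGroup V] [Module ℝ V] (s : Set V) :
    Submodule.span ℝ (PointedCone.hull ℝ s : Set V) = Submodule.span ℝ s :=
  le_antisymm (Submodule.span_le.2 (PointedCone.hull_le_span ℝ s))
    (Submodule.span_mono Submodule.subset_span)

theorem mem_hull_preimage {V : Type*} [AddCommGroup V] [Module ℝ V] {W : Submodule ℝ V} {s : Set V}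
    (hs : s ⊆ W) (x : W) :
    x ∈ PointedCone.hull ℝ ((↑) ⁻¹' s : Set W) ↔ (x : V) ∈ PointedCone.hull ℝ s := by
  have e : ((↑) : W → V) '' ((↑) ⁻¹' s) = s :=
    (Subtype.image_preimage_coe (W : Set V) s).trans (Set.inter_eq_right.2 hs)
  have h := PointedCone.mem_map (R := ℝ) (f := W.subtype)
    (C := PointedCone.hull ℝ ((↑) ⁻¹' s : Set W)) (y := (x : V))
  have h2 : PointedCone.map W.subtype (PointedCone.hull ℝ ((↑) ⁻¹' s : Set W)) =
      PointedCone.hull ℝ s := by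
    conv_rhs => rw [← e]
    exact Submodule.map_span _ _
  rw [← h2, h]
  exact ⟨fun hx => ⟨x, hx, rfl⟩, fun ⟨y, hy, hyx⟩ => by rwa [← Subtype.ext hyx]⟩

theorem mem_span_preimage {V : Type*} [AddCommGroup V] [Module ℝ V] {W : Submodule ℝ V} {s : Set V}
    (hs : s ⊆ W) (x : W) :
    x ∈ Submodule.span ℝ ((↑) ⁻¹' s : Set W) ↔ (x : V) ∈ Submodule.span ℝ s := by
  have e : ((↑) : W → V) '' ((↑) ⁻¹' s) = s :=
    (Subtype.image_preimage_coe (W : Set V) s).trans (Set.inter_eq_right.2 hs)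
  have h2 : Submodule.map W.subtype (Submodule.span ℝ ((↑) ⁻¹' s : Set W)) =
      Submodule.span ℝ s := by
    conv_rhs => rw [← e]
    exact Submodule.map_span _ _
  rw [← h2, Submodule.mem_map]
  exact ⟨fun hx => ⟨x, hx, rfl⟩, fun ⟨y, hy, hyx⟩ => by rwa [← Subtype.ext hyx]⟩

theorem IsPrimSimplicial.span_gens {τ : PointedCone ℝ (Fin n → ℝ)} (h : IsPrimSimplicial τ) :
    Submodule.span ℝ (gens τ : Set (Fin n → ℝ)) = Submodule.span ℝ (τ : Set (Fin n → ℝ)) := by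
  conv_rhs => rw [← h.hull]
  rw [span_hull]

theorem IsPrimSimplicial.mem_iff {τ : PointedCone ℝ (Fin n → ℝ)} (h : IsPrimSimplicial τ)
    {x : Fin n → ℝ} : x ∈ τ ↔ x ∈ Submodule.span ℝ (τ : Set (Fin n → ℝ)) ∧
      ∀ p, 0 ≤ coord (gens τ) p x := by
  conv_lhs => rw [← h.hull]
  rw [mem_hull_iff_coord h.li, h.span_gens]

/-- If a simplicial cone contains infinitely many of the points `y + m b`, it contains `b`, and its
span contains `y`. -/
theorem IsPrimSimplicial.mem_of_frequently {τ : PointedCone ℝ (Fin n → ℝ)} (h : IsPrimSimplicial τ)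
    {y b : Fin n → ℝ} (hf : ∃ᶠ m : ℕ in Filter.atTop, y + (m : ℝ) • b ∈ τ) :
    b ∈ τ ∧ y ∈ Submodule.span ℝ (τ : Set (Fin n → ℝ)) := by
  have hb : b ∈ Submodule.span ℝ (τ : Set (Fin n → ℝ)) := by
    obtain ⟨m₁, h1⟩ := hf.exists
    obtain ⟨m₂, h2, h3⟩ := (hf.and_eventually (Filter.eventually_gt_atTop m₁)).exists
    have h4 := Submodule.sub_mem _ (Submodule.subset_span (R := ℝ) h2)
      (Submodule.subset_span (R := ℝ) h1)
    have h5 : (m₂ : ℝ) - m₁ ≠ 0 := sub_ne_zero.2 (by exact_mod_cast h3.ne')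
    have h6 : b = ((m₂ : ℝ) - m₁)⁻¹ • ((y + (m₂ : ℝ) • b) - (y + (m₁ : ℝ) • b)) := by
      rw [add_sub_add_left_eq_sub, ← sub_smul, smul_smul, inv_mul_cancel₀ h5, one_smul]
    rw [h6]
    exact Submodule.smul_mem _ _ h4
  refine ⟨h.mem_iff.2 ⟨hb, fun i => ?_⟩, ?_⟩
  · by_contra! hneg
    have h1 : ∀ᶠ m : ℕ in Filter.atTop, coord (gens τ) i y / -coord (gens τ) i b < m :=
      tendsto_natCast_atTop_atTop.eventually_gt_atTop _
    obtain ⟨m, hm1, hm2⟩ := (hf.and_eventually h1).exists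
    have h2 := h.coord_nonneg hm1 i
    rw [map_add, map_smul, smul_eq_mul] at h2
    rw [div_lt_iff₀ (by linarith)] at hm2
    linarith
  · obtain ⟨m, h1⟩ := hf.exists
    have := Submodule.sub_mem _ (Submodule.subset_span (R := ℝ) h1) (Submodule.smul_mem _ (m : ℝ) hb)
    rwa [add_sub_cancel_right] at this

variable {Δ Δ' : RationalFan n}

namespace RationalFan

/-- The intersection of two cones of a fan. -/
def inter (τ ρ : Δ'.Cone) : Δ'.Cone :=
  ⟨τ.1 ⊓ ρ.1, Δ'.face_mem _ τ.2 _ (Δ'.inf_isFaceOf _ τ.2 _ ρ.2)⟩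

theorem inter_isFaceOf_left (τ ρ : Δ'.Cone) : (inter τ ρ).1.IsFaceOf τ.1 :=
  Δ'.inf_isFaceOf _ τ.2 _ ρ.2

theorem inter_isFaceOf_right (τ ρ : Δ'.Cone) : (inter τ ρ).1.IsFaceOf ρ.1 := by
  have := Δ'.inf_isFaceOf _ ρ.2 _ τ.2
  rwa [inf_comm] at this

/-- A cone τ through x lies in some σ₁, and σ₁ ⊓ σ is a face of σ₁, so it cuts out a face of τ that
still contains x and lies in σ. -/
theorem IsSubdivision.exists_mem (h : Δ'.IsSubdivision Δ) (σ : Δ.Cone) {x : Fin n → ℝ}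
    (hx : x ∈ σ.1) : ∃ τ : Δ'.Cone, τ.1 ≤ σ.1 ∧ x ∈ τ.1 := by
  obtain ⟨τ, hτ, hxτ⟩ : x ∈ Δ'.support := by
    rw [h.1]
    exact ⟨σ.1, σ.2, hx⟩
  obtain ⟨σ₁, hσ₁, hle⟩ := h.2 τ hτ
  have h1 := (Δ.inf_isFaceOf σ₁ hσ₁ σ.1 σ.2).inf (PointedCone.IsFaceOf.refl τ)
  rw [inf_eq_right.2 hle] at h1
  exact ⟨⟨_, Δ'.face_mem _ hτ _ h1⟩, inf_le_left.trans inf_le_right, ⟨hle hxτ, hx⟩, hxτ⟩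

variable (hs : Δ'.IsSimplicial)
include hs

/-- A cone of a simplicial fan containing the sum of the generators of another one contains it. -/
theorem le_of_sum_mem {τ ρ : Δ'.Cone} (h : ∑ p ∈ gens τ.1, p ∈ ρ.1) : τ.1 ≤ ρ.1 := by
  have hτ := hs.isPrimSimplicial τ.2
  conv_lhs => rw [← hτ.hull]
  refine Submodule.span_le.2 fun p hp => ?_
  have := IsFaceOf.mem_of_sum (inter_isFaceOf_left τ ρ) (s := gens τ.1) (f := id) (c := fun _ => 1)
    (fun p hp => hτ.gens_mem hp) (fun _ _ => zero_le_one) (by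
      simp only [id, one_smul]
      exact ⟨Submodule.sum_mem _ fun p hp => hτ.gens_mem hp, h⟩) hp zero_lt_one
  exact this.2

/-- Every cone of a subdivision inside `σ` is a face of one of full dimension. -/
theorem IsSubdivision.exists_full (h : Δ'.IsSubdivision Δ) (σ : Δ.Cone) {τ : Δ'.Cone}
    (hτ : τ.1 ≤ σ.1) : ∃ τ' : Δ'.Cone, τ ≤ τ' ∧ τ'.1 ≤ σ.1 ∧
      Submodule.span ℝ (τ'.1 : Set (Fin n → ℝ)) = Submodule.span ℝ (σ.1 : Set (Fin n → ℝ)) := by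
  -- For g in σ and p in the interior of a maximal τ', some cone inside σ contains g + m p for
  -- infinitely many m. It contains p, hence τ', hence equals τ', and its span contains g.
  obtain ⟨τ', hττ', hmax⟩ := (Set.toFinite {τ : Δ'.Cone | τ.1 ≤ σ.1}).exists_le_maximal hτ
  have hτ' : τ'.1 ≤ σ.1 := hmax.1
  refine ⟨τ', hττ', hτ', le_antisymm (Submodule.span_mono hτ') (Submodule.span_le.2 ?_)⟩
  intro g hg
  let p := ∑ p ∈ gens τ'.1, p
  have hp : p ∈ τ'.1 := Submodule.sum_mem _ fun q hq => (hs.isPrimSimplicial τ'.2).gens_mem hq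
  have h1 : ∀ m : ℕ, ∃ ρ : Δ'.Cone, ρ.1 ≤ σ.1 ∧ g + (m : ℝ) • p ∈ ρ.1 := fun m =>
    h.exists_mem σ (Submodule.add_mem _ hg (PointedCone.smul_mem _ (Nat.cast_nonneg m) (hτ' hp)))
  have h2 : ∃ ρ : Δ'.Cone, ∃ᶠ m : ℕ in Filter.atTop, ρ.1 ≤ σ.1 ∧ g + (m : ℝ) • p ∈ ρ.1 := by
    by_contra! H
    obtain ⟨m, hm⟩ := (Filter.eventually_all.2 H).exists
    obtain ⟨ρ, h3, h4⟩ := h1 m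
    exact hm ρ h3 h4
  obtain ⟨ρ, hρ⟩ := h2
  obtain ⟨m, hρσ, -⟩ := hρ.exists
  obtain ⟨h3, h4⟩ := (hs.isPrimSimplicial ρ.2).mem_of_frequently (hρ.mono fun _ h => h.2)
  have h5 : τ' ≤ ρ := le_of_sum_mem hs h3
  have h6 : ρ = τ' := le_antisymm (hmax.2 hρσ h5) h5
  rwa [h6] at h4

end RationalFan

/-- The linear span of a cone of a fan. -/
abbrev coneSpan (σ : PointedCone ℝ (Fin n → ℝ)) : Submodule ℝ (Fin n → ℝ) :=
  Submodule.span ℝ (σ : Set (Fin n → ℝ))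

/-- The cones of full dimension of a subdivision inside the cone `σ`. -/
abbrev FullCone (Δ' : RationalFan n) (σ : PointedCone ℝ (Fin n → ℝ)) : Type :=
  {τ : Δ'.Cone // τ.1 ≤ σ ∧ coneSpan τ.1 = coneSpan σ}

/-- The generators of a cone as elements of a subspace. -/
noncomputable def wgens (W : Submodule ℝ (Fin n → ℝ)) (τ : PointedCone ℝ (Fin n → ℝ)) : Finset W :=
  (gens τ).preimage (↑) Subtype.val_injective.injOn

theorem coe_wgens (W : Submodule ℝ (Fin n → ℝ)) (τ : PointedCone ℝ (Fin n → ℝ)) :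
    (wgens W τ : Set W) = (↑) ⁻¹' (gens τ : Set (Fin n → ℝ)) := Finset.coe_preimage _ _

theorem mem_wgens {W : Submodule ℝ (Fin n → ℝ)} {τ : PointedCone ℝ (Fin n → ℝ)} {p : W} :
    p ∈ wgens W τ ↔ (p : Fin n → ℝ) ∈ gens τ := Finset.mem_preimage

theorem IsPrimSimplicial.gens_subset_span {τ σ : PointedCone ℝ (Fin n → ℝ)}
    (h : IsPrimSimplicial τ) (hτ : τ ≤ σ) : (gens τ : Set (Fin n → ℝ)) ⊆ coneSpan σ :=
  fun _ hp => Submodule.subset_span (hτ (h.gens_mem hp))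

variable (hs : Δ'.IsSimplicial) (h : Δ'.IsSubdivision Δ)

-- Generators of τ carrying x lie in the common face with ρ, and the generators of that face are
-- generators of ρ.
include hs in
theorem mem_hull_inter (τ ρ : Δ'.Cone) {x : Fin n → ℝ} (hτ : x ∈ τ.1) (hρ : x ∈ ρ.1) :
    x ∈ PointedCone.hull ℝ ((gens τ.1 : Set (Fin n → ℝ)) ∩ (gens ρ.1 : Set (Fin n → ℝ))) := by
  have h1 := hs.isPrimSimplicial τ.2
  have h2 := hs.isPrimSimplicial ρ.2
  have h3 := hs.isPrimSimplicial (RationalFan.inter τ ρ).2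
  refine mem_hull_of_coord h1.li (by rwa [h1.hull]) fun p hp hpx => ⟨hp, ?_⟩
  have hpf := h1.mem_of_pos hτ (RationalFan.inter_isFaceOf_left τ ρ) ⟨hτ, hρ⟩ hp hpx
  exact h2.gens_subset h3 (RationalFan.inter_isFaceOf_right τ ρ)
    (h1.mem_gens_face h3 (RationalFan.inter_isFaceOf_left τ ρ) hp hpf)

/-- The full-dimensional cones of a subdivision inside a cone. -/
noncomputable def subdivFan (σ : Δ.Cone) : FullFan (FullCone Δ' σ.1) (coneSpan σ.1) where
  gen k := wgens _ k.1.1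
  inj k k' hkk' := by
    have h1 := hs.isPrimSimplicial k.1.2
    have h2 := hs.isPrimSimplicial k'.1.2
    have hkk' : wgens (coneSpan σ.1) k.1.1 = wgens (coneSpan σ.1) k'.1.1 := hkk'
    have : gens k.1.1 = gens k'.1.1 := by
      ext p
      constructor
      · intro hp
        have : (⟨p, h1.gens_subset_span k.2.1 hp⟩ : coneSpan σ.1) ∈ wgens _ k.1.1 :=
          mem_wgens.2 hp
        rw [hkk'] at this
        exact mem_wgens.1 this
      · intro hp
        have : (⟨p, h2.gens_subset_span k'.2.1 hp⟩ : coneSpan σ.1) ∈ wgens _ k'.1.1 :=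
          mem_wgens.2 hp
        rw [← hkk'] at this
        exact mem_wgens.1 this
    exact Subtype.ext (Subtype.ext (by rw [← h1.hull, ← h2.hull, this]))
  li k := by
    have h1 : LinearIndependent ℝ (fun p : (gens k.1.1 : Set (Fin n → ℝ)) => (p : Fin n → ℝ)) :=
      (hs.isPrimSimplicial k.1.2).li
    let e : (wgens (coneSpan σ.1) k.1.1 : Set (coneSpan σ.1)) →
        (gens k.1.1 : Set (Fin n → ℝ)) := fun p => ⟨p.1.1, mem_wgens.1 p.2⟩
    have he : Function.Injective e := fun p q hpq => by
      have hpq := congrArg Subtype.val hpq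
      exact Subtype.ext (Subtype.ext hpq)
    exact (h1.comp e he).of_comp (coneSpan σ.1).subtype
  span_gen k := by
    have h1 := hs.isPrimSimplicial k.1.2
    rw [eq_top_iff]
    rintro x -
    rw [coe_wgens, mem_span_preimage (h1.gens_subset_span k.2.1), h1.span_gens]
    show x.1 ∈ coneSpan k.1.1
    rw [k.2.2]
    exact x.2
  inter k k' x hx hx' := by
    have h1 := hs.isPrimSimplicial k.1.2
    have h2 := hs.isPrimSimplicial k'.1.2
    rw [coe_wgens, mem_hull_preimage (h1.gens_subset_span k.2.1), h1.hull] at hx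
    rw [coe_wgens, mem_hull_preimage (h2.gens_subset_span k'.2.1), h2.hull] at hx'
    rw [coe_wgens, coe_wgens, ← Set.preimage_inter,
      mem_hull_preimage (Set.inter_subset_left.trans (h1.gens_subset_span k.2.1))]
    exact mem_hull_inter hs k.1 k'.1 hx hx'
  add k k' x y hx hy := by
    have h1 := hs.isPrimSimplicial k.1.2
    have h2 := hs.isPrimSimplicial k'.1.2
    rw [coe_wgens, mem_hull_preimage (h1.gens_subset_span k.2.1), h1.hull] at hx
    rw [coe_wgens, mem_hull_preimage (h2.gens_subset_span k'.2.1), h2.hull] at hy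
    -- Closure under addition comes from the convexity of σ; the cone found is then enlarged to full
    -- dimension.
    obtain ⟨τ, hτ, hxy⟩ := h.exists_mem σ (Submodule.add_mem _ (k.2.1 hx) (k'.2.1 hy))
    obtain ⟨τ', h3, h4, h5⟩ := h.exists_full hs σ hτ
    refine ⟨⟨τ', h4, h5⟩, ?_⟩
    have h6 := hs.isPrimSimplicial τ'.2
    rw [coe_wgens, mem_hull_preimage (h6.gens_subset_span h4), h6.hull]
    exact h3 hxy

end SubdividedCone

end EhrhartFan

namespace EhrhartFan

/-! ### Projective modules and ring isomorphisms -/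

section SemilinearRetract

variable {R R' N M : Type*} [CommRing R] [CommRing R'] [AddCommGroup N] [Module R N]
  [AddCommGroup M] [Module R' M]

/-- A semilinear retract of a finitely generated projective module is finitely generated
projective. -/
theorem FiniteProjective.of_semilinear_retract (h : FiniteProjective R N) (e : R ≃+* R')
    (i : M →+ N) (s : N →+ M) (hi : ∀ r m, i (e r • m) = r • i m)
    (hs : ∀ r x, s (r • x) = e r • s x) (his : ∀ m, s (i m) = m) : FiniteProjective R' M := by
  obtain ⟨h1, h2⟩ := h
  -- N is a retract of R^k. Moving coordinates through e turns the semilinear retraction into a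
  -- linear one from R'^k to M.
  obtain ⟨k, b, hb⟩ := Module.Finite.exists_fin' R N
  obtain ⟨a, ha⟩ := Module.projective_lifting_property b LinearMap.id hb
  have ha' : ∀ x, b (a x) = x := fun x => LinearMap.congr_fun ha x
  have hfree : FiniteProjective R' (Fin k → R') := ⟨inferInstance, inferInstance⟩
  refine hfree.of_retract
    { toFun := fun m j => e (a (i m) j)
      map_add' := fun x y => funext fun j => by simp
      map_smul' := fun r x => funext fun j => by
        obtain ⟨r, rfl⟩ := e.surjective r
        simp [hi] }
    { toFun := fun x => s (b fun j => e.symm (x j))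
      map_add' := fun x y => by
        rw [← map_add, ← map_add]
        congr 2
        funext j
        simp
      map_smul' := fun r x => by
        obtain ⟨r, rfl⟩ := e.surjective r
        rw [RingHom.id_apply, ← hs, ← map_smul]
        congr 2
        funext j
        simp } fun m => ?_
  show s (b fun j => e.symm (e (a (i m) j))) = m
  simp only [RingEquiv.symm_apply_apply]
  rw [ha', his]

theorem FiniteProjective.pi {ι : Type*} [Finite ι] {P : ι → Type*} [∀ i, AddCommGroup (P i)]
    [∀ i, Module R (P i)] (h : ∀ i, FiniteProjective R (P i)) : FiniteProjective R (∀ i, P i) := by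
  classical
  have := Fintype.ofFinite ι
  have h1 : ∀ i, Module.Finite R (P i) := fun i => (h i).1
  have h2 : ∀ i, Module.Projective R (P i) := fun i => (h i).2
  exact ⟨inferInstance, Module.Projective.of_equiv' DFinsupp.linearEquivFunOnFintype⟩

end SemilinearRetract

/-! ### Polynomial functions on a cone and on its span -/

section ResPoly

variable {n : ℕ} {σ τ ρ : PointedCone ℝ (Fin n → ℝ)}

theorem polyOn_restrict_mem (h : τ ≤ σ) (f : PolyOn (coneSpan σ)) :
    (fun x : τ => f.1 ⟨x.1, Submodule.subset_span (h x.2)⟩) ∈ polyFun τ := by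
  obtain ⟨f, hf⟩ := f
  induction hf using Algebra.adjoin_induction with
  | mem f hf =>
    obtain ⟨l, rfl⟩ := hf
    obtain ⟨L, hL⟩ := l.exists_extend
    convert (linFun τ L).2 using 1
    funext x
    exact (LinearMap.congr_fun hL ⟨x.1, Submodule.subset_span (h x.2)⟩).symm
  | algebraMap r => exact (polyFun τ).algebraMap_mem r
  | add f g _ _ hf hg => exact (polyFun τ).add_mem hf hg
  | mul f g _ _ hf hg => exact (polyFun τ).mul_mem hf hg

/-- The restriction of polynomial functions on the span of a cone to a smaller cone. -/
def resPoly (h : τ ≤ σ) : PolyOn (coneSpan σ) →ₐ[ℝ] polyFun τ where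
  toFun f := ⟨_, polyOn_restrict_mem h f⟩
  map_one' := rfl
  map_mul' _ _ := rfl
  map_zero' := rfl
  map_add' _ _ := rfl
  commutes' _ := rfl

/-- A polynomial function vanishing on a cone vanishes on its span. This turns compatibility on
common faces into the conditions on subspaces defining `pwPoly` and `starPoly`. -/
theorem resPoly_eq_iff (h : τ ≤ σ) {f g : PolyOn (coneSpan σ)} :
    resPoly h f = resPoly h g ↔
      ∀ y : coneSpan σ, (y : Fin n → ℝ) ∈ coneSpan τ → f.1 y = g.1 y := by
  have hsub : (τ : Set (Fin n → ℝ)) ⊆ coneSpan σ := fun x hx => Submodule.subset_span (h hx)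
  constructor
  · intro hfg y hy
    rw [← sub_eq_zero]
    refine PolyOn.eq_zero_of_cone (f - g)
      (C := PointedCone.hull ℝ ((↑) ⁻¹' (τ : Set (Fin n → ℝ)) : Set (coneSpan σ))) ?_ ?_
    · intro x hx
      rw [mem_hull_preimage hsub] at hx
      have hx : x.1 ∈ τ := by
        rwa [PointedCone.hull, Submodule.span_eq] at hx
      have := congrFun (congrArg Subtype.val hfg) ⟨x.1, hx⟩
      exact sub_eq_zero.2 this
    · rw [span_hull, mem_span_preimage hsub]
      exact hy
  · intro hfg
    exact polyFun_ext fun x => hfg _ (Submodule.subset_span x.2)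

theorem resPoly_surjective (h : τ ≤ σ) : Function.Surjective (resPoly h) := by
  let N : MvPolynomial (Fin n) ℝ →ₐ[ℝ] PolyOn (coneSpan σ) :=
    MvPolynomial.aeval fun i => PolyOn.lin (LinearMap.proj i ∘ₗ (coneSpan σ).subtype)
  have hN : ((polyFun τ).val.comp (resPoly h)).comp N = polyEval τ := by
    refine MvPolynomial.algHom_ext fun i => ?_
    funext x
    rw [polyEval_apply, MvPolynomial.eval_X]
    show (resPoly h (N _)).1 x = _
    simp only [N, MvPolynomial.aeval_X]
    rfl
  rintro ⟨f, P, rfl⟩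
  exact ⟨N P, Subtype.ext (DFunLike.congr_fun hN P)⟩

theorem resPoly_bijective (h : τ ≤ σ) (hspan : coneSpan τ = coneSpan σ) :
    Function.Bijective (resPoly h) := by
  refine ⟨fun f g hfg => PolyOn.ext fun y => (resPoly_eq_iff h).1 hfg y ?_, resPoly_surjective h⟩
  rw [hspan]
  exact y.2

/-- Polynomial functions on a cone of full dimension extend uniquely to the span. -/
noncomputable def polyEquiv (h : τ ≤ σ) (hspan : coneSpan τ = coneSpan σ) :
    PolyOn (coneSpan σ) ≃ₐ[ℝ] polyFun τ :=
  AlgEquiv.ofBijective (resPoly h) (resPoly_bijective h hspan)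

theorem resPoly_symm (h : τ ≤ σ) (hspan : coneSpan τ = coneSpan σ) (f : polyFun τ) :
    resPoly h ((polyEquiv h hspan).symm f) = f := (polyEquiv h hspan).apply_symm_apply f

end ResPoly

/-- Restrict to the line through a point where f is nonzero and one where g is nonzero. -/
theorem PolyOn.eq_zero_or_eq_zero {V : Type*} [AddCommGroup V] [Module ℝ V] {f g : PolyOn V}
    (h : f * g = 0) : f = 0 ∨ g = 0 := by
  by_contra! H
  obtain ⟨x, hx⟩ : ∃ x, f.1 x ≠ 0 := by
    by_contra! hx
    exact H.1 (PolyOn.ext hx)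
  obtain ⟨y, hy⟩ : ∃ y, g.1 y ≠ 0 := by
    by_contra! hy
    exact H.2 (PolyOn.ext hy)
  obtain ⟨P, hP⟩ := PolyOn.exists_line f x (y - x)
  obtain ⟨Q, hQ⟩ := PolyOn.exists_line g x (y - x)
  have hPQ : P * Q = 0 := Polynomial.funext fun t => by
    rw [Polynomial.eval_mul, hP, hQ, ← PolyOn.mul_apply, h, Polynomial.eval_zero]
    rfl
  rcases mul_eq_zero.1 hPQ with h0 | h0
  · refine hx ?_
    have := hP 0
    rw [h0, Polynomial.eval_zero] at this
    simpa using this.symm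
  · refine hy ?_
    have := hQ 1
    rw [h0, Polynomial.eval_zero] at this
    simpa using this.symm

theorem polyFun_isDomain {n : ℕ} (σ : PointedCone ℝ (Fin n → ℝ)) : IsDomain (polyFun σ) := by
  have : Nontrivial (polyFun σ) := ⟨0, 1, fun h =>
    zero_ne_one (congrFun (congrArg Subtype.val h) (0 : σ))⟩
  have : NoZeroDivisors (polyFun σ) := ⟨fun {a b} hab => by
    let e := polyEquiv (le_refl σ) rfl
    have h1 : e.symm a * e.symm b = 0 := by rw [← map_mul, hab, map_zero]
    rcases PolyOn.eq_zero_or_eq_zero h1 with h | h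
    · exact Or.inl ((map_eq_zero_iff _ e.symm.injective).1 h)
    · exact Or.inr ((map_eq_zero_iff _ e.symm.injective).1 h)⟩
  exact NoZeroDivisors.to_isDomain _

/-! ### The stalks of the push-forward of the box sheaf -/

section Stalk

variable {n : ℕ} {Δ Δ' : RationalFan n} {K : (Fin n → ℝ) → ℝ}

theorem IsPrimSimplicial.finite_box {τ : PointedCone ℝ (Fin n → ℝ)} (h : IsPrimSimplicial τ) :
    (Box τ).Finite := by
  refine (finite_bounded_lattice (∑ p ∈ gens τ, ∑ i, |p i|)).subset fun v hv => ?_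
  obtain ⟨h1, h2, h3⟩ := h.mem_box_iff.1 hv
  refine ⟨h1, fun i => ?_⟩
  have h4 : v i = ∑ p ∈ gens τ, coord (gens τ) p v * p i := by
    conv_lhs => rw [← h.sum_coord h2]
    simp
  rw [h4]
  refine (Finset.abs_sum_le_sum_abs _ _).trans (Finset.sum_le_sum fun p hp => ?_)
  rw [abs_mul, abs_of_nonneg (h.coord_nonneg h2 p)]
  refine (mul_le_of_le_one_left (abs_nonneg _) (h3 p).le).trans ?_
  exact Finset.single_le_sum (f := fun i => |p i|) (fun _ _ => abs_nonneg _) (Finset.mem_univ i)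

/-- The element of the box module with given coefficients. -/
noncomputable def boxMk {τ : PointedCone ℝ (Fin n → ℝ)} (h : IsPrimSimplicial τ)
    (f : Box τ → polyFun τ) : BoxModule τ :=
  have := h.finite_box.to_subtype
  (Finsupp.equivFunOnFinite.symm f : Box τ →₀ polyFun τ)

variable (hs : Δ'.IsSimplicial)
include hs

/-- The cones containing a given box point are those containing the generators of the smallest
one. -/
theorem exists_boxSupport (σ : Δ.Cone) {v : Fin n → ℝ}
    (hv : ∃ k : FullCone Δ' σ.1, v ∈ Box k.1.1) :
    ∃ S : Finset (coneSpan σ.1), ∀ k : FullCone Δ' σ.1, S ⊆ wgens _ k.1.1 ↔ v ∈ Box k.1.1 := by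
  classical
  obtain ⟨k₀, hk₀⟩ := hv
  have h0 := hs.isPrimSimplicial k₀.1.2
  obtain ⟨-, hv1, -⟩ := h0.mem_box_iff.1 hk₀
  -- The generators of the smallest cone containing v, read off in one cone having v in its box.
  refine ⟨(wgens _ k₀.1.1).filter fun p => 0 < coord (gens k₀.1.1) p.1 v, fun k => ?_⟩
  have h1 := hs.isPrimSimplicial k.1.2
  have h2 := hs.isPrimSimplicial (RationalFan.inter k₀.1 k.1).2
  have f0 := RationalFan.inter_isFaceOf_left k₀.1 k.1
  have f1 := RationalFan.inter_isFaceOf_right k₀.1 k.1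
  constructor
  · intro hS
    have hvk : v ∈ k.1.1 := by
      rw [← h1.hull]
      refine mem_hull_of_coord h0.li (by rwa [h0.hull]) fun p hp hpv => ?_
      exact mem_wgens.1 (hS (Finset.mem_filter.2
        ⟨(mem_wgens (p := (⟨p, h0.gens_subset_span k₀.2.1 hp⟩ : coneSpan σ.1))).2 hp, hpv⟩))
    exact box_mono f1 (h0.mem_box_face h2 f0 hk₀ ⟨hv1, hvk⟩)
  · intro hvk p hp
    obtain ⟨hp1, hp2⟩ := Finset.mem_filter.1 hp
    have hvm : v ∈ (RationalFan.inter k₀.1 k.1).1 := ⟨hv1, (h1.mem_box_iff.1 hvk).2.1⟩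
    have hpf := h0.mem_of_pos hv1 f0 hvm (mem_wgens.1 hp1) hp2
    exact mem_wgens.2 (h1.gens_subset h2 f1 (h0.mem_gens_face h2 f0 (mem_wgens.1 hp1) hpf))

theorem mem_span_wgens_inter {σ : PointedCone ℝ (Fin n → ℝ)} (k k' : FullCone Δ' σ) {ρ : Δ'.Cone}
    (h : ρ ≤ k.1) (h' : ρ ≤ k'.1) {y : coneSpan σ} (hy : (y : Fin n → ℝ) ∈ coneSpan ρ.1) :
    y ∈ Submodule.span ℝ ((wgens (coneSpan σ) k.1.1 : Set (coneSpan σ)) ∩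
      (wgens (coneSpan σ) k'.1.1 : Set (coneSpan σ))) := by
  have hρ := hs.isPrimSimplicial ρ.2
  have hsub := hρ.gens_subset_span (le_trans (show ρ.1 ≤ k.1.1 from h) k.2.1)
  rw [coneSpan, ← hρ.span_gens, ← mem_span_preimage hsub] at hy
  refine Submodule.span_mono ?_ hy
  refine fun p hp => ⟨?_, ?_⟩
  · exact mem_wgens.2
      ((hs.isPrimSimplicial k.1.2).gens_subset hρ ((Δ'.isFaceOf_iff_le _ _).2 h) hp)
  · exact mem_wgens.2
      ((hs.isPrimSimplicial k'.1.2).gens_subset hρ ((Δ'.isFaceOf_iff_le _ _).2 h') hp)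

theorem mem_coneSpan_inter {σ : PointedCone ℝ (Fin n → ℝ)} (k k' : FullCone Δ' σ) {y : coneSpan σ}
    (hy : y ∈ Submodule.span ℝ ((wgens (coneSpan σ) k.1.1 : Set (coneSpan σ)) ∩
      (wgens (coneSpan σ) k'.1.1 : Set (coneSpan σ)))) :
    (y : Fin n → ℝ) ∈ coneSpan (RationalFan.inter k.1 k'.1).1 := by
  have h1 := Submodule.mem_map_of_mem (f := (coneSpan σ).subtype) hy
  rw [Submodule.map_span] at h1
  refine Submodule.span_mono ?_ h1
  rintro _ ⟨p, ⟨hp, hp'⟩, rfl⟩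
  exact ⟨(hs.isPrimSimplicial k.1.2).gens_mem (mem_wgens.1 hp),
    (hs.isPrimSimplicial k'.1.2).gens_mem (mem_wgens.1 hp')⟩

omit hs

open Classical in
/-- The coefficient of a box point, extended to the span. -/
noncomputable def liftCoeff {σ : PointedCone ℝ (Fin n → ℝ)} (v : Fin n → ℝ) (k : FullCone Δ' σ) :
    BoxModule k.1.1 →+ PolyOn (coneSpan σ) :=
  if hv : v ∈ Box k.1.1 then
    (polyEquiv k.2.1 k.2.2).symm.toLinearMap.toAddMonoidHom.comp
      (boxCoeff ⟨v, hv⟩).toAddMonoidHom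
  else 0

section LiftCoeff

variable {σ : PointedCone ℝ (Fin n → ℝ)} {v : Fin n → ℝ} {k : FullCone Δ' σ}

theorem liftCoeff_of_mem (hv : v ∈ Box k.1.1) (x : BoxModule k.1.1) :
    liftCoeff v k x = (polyEquiv k.2.1 k.2.2).symm (boxCoeff ⟨v, hv⟩ x) := by
  rw [liftCoeff, dif_pos hv]
  rfl

theorem liftCoeff_of_notMem (hv : v ∉ Box k.1.1) (x : BoxModule k.1.1) : liftCoeff v k x = 0 := by
  rw [liftCoeff, dif_neg hv]
  rfl

theorem resPoly_liftCoeff (hv : v ∈ Box k.1.1) (x : BoxModule k.1.1) :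
    resPoly k.2.1 (liftCoeff v k x) = boxCoeff ⟨v, hv⟩ x := by
  rw [liftCoeff_of_mem hv, resPoly_symm]

theorem liftCoeff_smul (r : PolyOn (coneSpan σ)) (x : BoxModule k.1.1) :
    liftCoeff v k (resPoly k.2.1 r • x) = r * liftCoeff v k x := by
  by_cases hv : v ∈ Box k.1.1
  · rw [liftCoeff_of_mem hv, liftCoeff_of_mem hv, boxCoeff_smul, map_mul]
    congr 1
    exact (polyEquiv k.2.1 k.2.2).symm_apply_apply r
  · rw [liftCoeff_of_notMem hv, liftCoeff_of_notMem hv, mul_zero]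

end LiftCoeff

include hs

/-- The stalks of the push-forward of the box sheaf are finitely generated projective modules. -/
theorem finiteProjective_stalk (hK : Δ'.IsGorensteinFunction K) (h : Δ'.IsSubdivision Δ)
    (σ : Δ.Cone) :
    FiniteProjective (polyFun σ.1) (((boxSheaf Δ' K hK).pushforward Δ).stalk σ) := by
  classical
  have : Fintype (FullCone Δ' σ.1) := Fintype.ofFinite _
  let B := {v : Fin n → ℝ // ∃ k : FullCone Δ' σ.1, v ∈ Box k.1.1}
  have hB : Finite B := by
    have h1 : (⋃ k : FullCone Δ' σ.1, Box k.1.1).Finite :=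
      Set.finite_iUnion fun k => (hs.isPrimSimplicial k.1.2).finite_box
    exact (h1.subset fun v hv => Set.mem_iUnion.2 hv :
      {v | ∃ k : FullCone Δ' σ.1, v ∈ Box k.1.1}.Finite).to_subtype
  choose S hS using fun v : B => exists_boxSupport hs σ v.2
  let A := subdivFan hs h σ
  have hN : FiniteProjective (PolyOn (coneSpan σ.1)) (∀ v : B, A.starPoly (S v)) :=
    FiniteProjective.pi fun v => A.finiteProjective_starPoly fun _ => Module.Free.infinite ℝ _
  -- A section over the cones in σ is determined by its values on the full-dimensional ones; `κ τ`
  -- is a chosen one above τ.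
  have hfull : ∀ τ : {τ // τ ∈ GradedSheaf.preimage Δ' σ}, ∃ k : FullCone Δ' σ.1, τ.1 ≤ k.1 :=
    fun τ => by
      obtain ⟨τ', h1, h2, h3⟩ := RationalFan.IsSubdivision.exists_full hs h σ τ.2
      exact ⟨⟨τ', h2, h3⟩, h1⟩
  choose κ hκ using hfull
  have hbox : ∀ (τ : {τ // τ ∈ GradedSheaf.preimage Δ' σ}) {v}, v ∈ Box τ.1.1 →
      v ∈ Box (κ τ).1.1 := fun τ v hv => box_mono ((Δ'.isFaceOf_iff_le _ _).2 (hκ τ)) hv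
  have hres : ∀ (m : ((boxSheaf Δ' K hK).pushforward Δ).stalk σ) (k : FullCone Δ' σ.1)
      (τ : {τ // τ ∈ GradedSheaf.preimage Δ' σ}) (hτ : τ.1 ≤ k.1) {v} (hv : v ∈ Box τ.1.1),
      resPoly τ.2 (liftCoeff v k (m.1 ⟨k.1, k.2.1⟩)) = boxCoeff ⟨v, hv⟩ (m.1 τ) := by
    intro m k τ hτ v hv
    exact (congrArg (polyRes (show τ.1.1 ≤ k.1.1 from hτ)) (resPoly_liftCoeff
      (box_mono ((Δ'.isFaceOf_iff_le _ _).2 hτ) hv) (m.1 ⟨k.1, k.2.1⟩))).trans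
      (congrArg (boxCoeff ⟨v, hv⟩) (m.2 ⟨k.1, k.2.1⟩ τ hτ))
  -- Record, for each box point v, the coefficients on full-dimensional cones, extended to the span
  -- of σ. They agree where two such cones meet, since v then lies in the box of the common face.
  let i : ((boxSheaf Δ' K hK).pushforward Δ).stalk σ →+ ∀ v : B, A.starPoly (S v) :=
    { toFun := fun m v => ⟨fun k => liftCoeff v.1 k (m.1 ⟨k.1, k.2.1⟩),
        fun k hk => liftCoeff_of_notMem (fun hv => hk ((hS v k).2 hv)) _, by
        intro k k' hk hk' y hy
        have f0 := RationalFan.inter_isFaceOf_left k.1 k'.1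
        have f1 := RationalFan.inter_isFaceOf_right k.1 k'.1
        have hv := (hS v k).1 hk
        have hvρ := (hs.isPrimSimplicial k.1.2).mem_box_face
          (hs.isPrimSimplicial (RationalFan.inter k.1 k'.1).2) f0 hv
          ⟨((hs.isPrimSimplicial k.1.2).mem_box_iff.1 hv).2.1,
            ((hs.isPrimSimplicial k'.1.2).mem_box_iff.1 ((hS v k').1 hk')).2.1⟩
        let ρ : {τ // τ ∈ GradedSheaf.preimage Δ' σ} :=
          ⟨RationalFan.inter k.1 k'.1, f0.le.trans k.2.1⟩
        exact (resPoly_eq_iff ρ.2).1 ((hres m k ρ f0.le hvρ).trans (hres m k' ρ f1.le hvρ).symm) y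
          (mem_coneSpan_inter hs k k' hy)⟩
      map_zero' := funext fun v => Subtype.ext (funext fun k => map_zero (liftCoeff v.1 k))
      map_add' := fun m m' => funext fun v => Subtype.ext (funext fun k =>
        map_add (liftCoeff v.1 k) _ _) }
  -- Conversely, coefficients at τ are restricted from `κ τ`. Membership in the modules of the stars
  -- makes the results compatible for different choices of `κ`.
  let s : (∀ v : B, A.starPoly (S v)) →+ ((boxSheaf Δ' K hK).pushforward Δ).stalk σ :=
    { toFun := fun g => ⟨fun τ => boxMk (hs.isPrimSimplicial τ.1.2) fun v =>
        resPoly τ.2 ((g ⟨v.1, κ τ, hbox τ v.2⟩).1 (κ τ)), by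
        intro τ ρ hρ
        refine boxModule_ext fun v => ?_
        have f0 := (Δ'.isFaceOf_iff_le _ _).2 hρ
        have hv : v.1 ∈ Box τ.1.1 := box_mono f0 v.2
        refine (resPoly_eq_iff ρ.2).2 fun y hy => ?_
        exact (g ⟨v.1, κ τ, hbox τ hv⟩).2.2 (κ τ) (κ ρ) ((hS _ _).2 (hbox τ hv))
          ((hS _ _).2 (hbox ρ v.2)) y
          (mem_span_wgens_inter hs (κ τ) (κ ρ) (hρ.trans (hκ τ)) (hκ ρ) hy)⟩
      map_zero' := Subtype.ext (funext fun τ => boxModule_ext fun v => map_zero (resPoly τ.2))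
      map_add' := fun g g' =>
        Subtype.ext (funext fun τ => boxModule_ext fun v => map_add (resPoly τ.2) _ _) }
  refine hN.of_semilinear_retract (polyEquiv (le_refl σ.1) rfl).toRingEquiv i s ?_ ?_ ?_
  · intro r m
    exact funext fun v => Subtype.ext (funext fun k => liftCoeff_smul r _)
  · intro r g
    exact Subtype.ext (funext fun τ => boxModule_ext fun v => map_mul (resPoly τ.2) r _)
  · intro m
    exact Subtype.ext (funext fun τ => boxModule_ext fun v => hres m (κ τ) τ (hκ τ) v.2)

end Stalk

section LocallyFree

variable {n : ℕ} {Δ Δ' : RationalFan n} {K : (Fin n → ℝ) → ℝ}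

/-- The value of a polynomial function at the vertex of the cone. -/
noncomputable def evalZero (σ : PointedCone ℝ (Fin n → ℝ)) : polyFun σ →ₐ[ℝ] ℝ :=
  (Pi.evalAlgHom ℝ (fun _ : σ => ℝ) 0).comp (polyFun σ).val

/-- The push-forward of the box sheaf is locally free. -/
theorem isLocallyFree_pushforward (hs : Δ'.IsSimplicial) (hK : Δ'.IsGorensteinFunction K)
    (h : Δ'.IsSubdivision Δ) : ((boxSheaf Δ' K hK).pushforward Δ).IsLocallyFree := by
  intro σ
  obtain ⟨h1, h2⟩ := finiteProjective_stalk hs hK h σ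
  have := polyFun_isDomain σ.1
  -- The vertex is 0 • x, so homogeneity gives the factor 0 ^ k. For k = 0 it is 1, and functions of
  -- degree zero are constant.
  have hz : ∀ (k : ℕ), ∀ a ∈ polyDeg σ.1 k, ∀ x, evalZero σ.1 a = 0 ^ k * a.1 x := by
    intro k a ha x
    rw [← polyFun_smul_apply ha 0 le_rfl x]
    exact congrArg a.1 (Subtype.ext (zero_smul ℝ x.1).symm : (0 : σ.1) = ⟨(0 : ℝ) • x.1, _⟩)
  refine ⟨h1, free_of_graded_projective (polyDeg_isInternal σ.1)
    (((boxSheaf Δ' K hK).pushforward Δ).isInternal σ)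
    (((boxSheaf Δ' K hK).pushforward Δ).smul_mem_deg σ) (evalZero σ.1) ?_ ?_⟩
  · intro k hk a ha
    rw [hz k a ha 0, zero_pow hk, zero_mul]
  · intro a ha ha0
    refine polyFun_ext fun x => ?_
    have := hz 0 a ha x
    rw [pow_zero, one_mul, ha0] at this
    exact this.symm

end LocallyFree

end EhrhartFan

theorem mainTheorem3 {n : ℕ} (Δ : EhrhartFan.RationalFan n) (hΔ : Δ.IsComplete)
    (K : (Fin n → ℝ) → ℝ) (hK : Δ.IsGorensteinFunction K) :
    (∃ Δ' : EhrhartFan.RationalFan n, Δ'.IsCrepantSimplicialSubdivision Δ K) ∧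
    ∀ (Δ' : EhrhartFan.RationalFan n) (h : Δ'.IsCrepantSimplicialSubdivision Δ K),
      ((EhrhartFan.boxSheaf Δ' K h.crepant).pushforward Δ).IsLocallyFree ∧
      ((EhrhartFan.boxSheaf Δ' K h.crepant).pushforward Δ).IsFlabby ∧
      ∀ k : ℕ,
        {v : Fin n → ℝ | EhrhartFan.IsLatticePoint v ∧ K v = (k : ℝ)}.Finite ∧
        Module.Finite ℝ
          (((EhrhartFan.boxSheaf Δ' K h.crepant).pushforward Δ).sectionsDeg ⊤ k) ∧
        Module.finrank ℝ
          (((EhrhartFan.boxSheaf Δ' K h.crepant).pushforward Δ).sectionsDeg ⊤ k) =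
          {v : Fin n → ℝ | EhrhartFan.IsLatticePoint v ∧ K v = (k : ℝ)}.ncard := by
  refine ⟨Δ.exists_crepantSimplicialSubdivision hK, fun Δ' h => ?_⟩
  have hcov : Δ'.support = Set.univ := h.subdivision.1.trans hΔ
  refine ⟨EhrhartFan.isLocallyFree_pushforward h.simplicial h.crepant h.subdivision,
    EhrhartFan.isFlabby_pushforward h.simplicial h.crepant, fun k => ?_⟩
  have hfin := EhrhartFan.finite_level h.simplicial h.crepant hcov (k : ℝ)
  obtain ⟨e⟩ := EhrhartFan.exists_sectionsDeg_equiv h.simplicial h.crepant h.subdivision hcov k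
  have := hfin.fintype
  refine ⟨hfin, Module.Finite.equiv e, ?_⟩
  rw [← e.finrank_eq, Module.finrank_finsupp_self, ← Nat.card_eq_fintype_card,
    Nat.card_coe_set_eq]
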